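/- Let $k$ be an algebraically closed field of characteristic $0$. A modular operad here is one in $\mathbb Z/2$-graded vector spaces without genus grading: spaces $P((n))$, $n\ge 0$, with relabelling ($S_n$-)actions, contractions $\mu_{ff'}\colon P((I\sqcup\{f,f'\}))\to P((I))$ along loops and compositions $P((I\sqcup\{f\}))\otimes P((J\sqcup\{f'\}))\to P((I\sqcup J))$ along edges, all even, equivariant and such that contractions of different edges commute (with Koszul signs). **The modular operad $\mathcal S$.** $\mathcal S((n))=k[S_n]$ (purely even), with $S_n$ acting by conjugation. The contraction $\mu_{ff'}\colon k[\mathrm{Aut}(I\sqcup\{f,f'\})]\to k[\mathrm{Aut}(I)]$ is given on the cycles of a permutation through $f$ and $f'$ (the other cycles being unchanged) by $$(f\,a_1\ldots a_r)(f'\,b_1\ldots b_t)\mapsto(a_1\ldots a_r\,b_1\ldots b_t),\qquad (f\,a_1\ldots a_r\,f'\,b_1\ldots b_t)\mapsto (a_1\ldots a_r)(b_1\ldots b_t),$$ except that the result is $0$ if an empty cycle arises on the right, i.e. if $f,f'$ are adjacent in the same cycle ($r=0$ or $t=0$ in the second case) or are both fixed points ($r=t=0$ in the first case). The composition along an edge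 is the disjoint union of permutations followed by $\mu_{ff'}$. **The modular operad $\mathcal E[\mathrm{End}_k]^{GL}$.** For a super vector space $U$ let $\mathcal E[\mathrm{End}_k(U)]((n))=\mathrm{End}_k(U)^{\otimes n}$, with $S_n$ permuting the factors with Koszul signs, the contraction being $X_0\otimes X_1\otimes X_2\otimes\cdots\mapsto \mathrm{str}(X_0X_1)\,X_2\otimes\cdots$, and the composition along an edge being tensor product followed by contraction. Let $\mathcal E[\mathrm{End}_k(U)]((n))^{GL(U)}$ be the invariants of the supergroup $GL(U)$ (tensors fixed by all $A$-points, for every supercommutative $k$-algebra $A$), and let $\mu=\mu_U\colon k[S_n]\to \mathrm{End}_k(U)^{\otimes n}=\mathrm{End}_k(U^{\otimes n})$ be the signed permutation action. Write $U_N=k^{N|N}$. Then: 1. $\mathcal S$ is a modular operad. For every $N$, $\mathcal E[\mathrm{End}_k(U_N)]$ is a modular operad and its $GL(N|N)$-invariants form a modular suboperad. 2. For $n\le N$, $\mu\colon k[S_n]\to\mathcal E[\mathrm{End}_k(U_N)]((n))^{GL(N|N)}$ is bijective, and the compression $\mathrm{End}_k(U_{N+1})^{\otimes n}\to\mathrm{End}_k(U_N)^{\otimes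 n}$ restricts to a bijection of the $GL$-invariants. Its inverse is the transition map from $N$ to $N+1$. 3. The direct limit $\mathcal E[\mathrm{End}_k]^{GL}=\varinjlim_N\mathcal E[\mathrm{End}_k(U_N)]^{GL(N|N)}$ along these transition maps (elements: germs as $N\to\infty$ of sequences of invariants $x_N$ such that, for all large $N$, $x_{N+1}$ is the image of $x_N$) is closed under the termwise operations and is a modular operad, and $\mathcal S$ is isomorphic to $\mathcal E[\mathrm{End}_k]^{GL}$ as a modular operad, by an isomorphism that sends $x\in k[S_n]$ to the class of $(\mu_{U_N}(x))_N$. 4. For every $U=k^{p|q}$ and every $\sigma\in\mathrm{Aut}(I\sqcup\{f,f'\})$ one has $\mu_{ff'}(\mu(\sigma))=(p-q)^{c}\,\mu(\bar\sigma)$, where $\bar\sigma$ is obtained by the cycle rule above with empty cycles deleted, and $c$ is the number of empty cycles that arise. If $f,f'$ are adjacent in the same cycle of $\sigma$, then $c>0$ and the contraction of $\sigma$ in $\mathcal S$ is $0$; this corresponds to $\mathrm{sdim}\,U_N=0$. -/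

import Mathlib

open scoped TensorProduct
open Module

universe u

noncomputable section

namespace MatrixModular

/-! ### Signs and relabellings -/

/-- The sign `(-1)^i` of a parity `i`. -/
def sgn (i : ZMod 2) : ℤ := if i = 0 then 1 else -1

/-- The Koszul sign of moving the `i`-th of `m` homogeneous elements, of parity `d i`, to place
`e i`: a factor `(-1)^(d i * d j)` for each pair `i < j` whose order is reversed. -/
def koszulSign {m n : ℕ} (e : Fin m ≃ Fin n) (d : Fin m → ZMod 2) : ℤ :=
  ∏ i, ∏ j, if i < j ∧ e j < e i then sgn (d i * d j) else 1

/-- The extension of a bijection by `0 ↦ 0`, the other labels being shifted by one. -/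
def liftZero {m n : ℕ} (e : Fin m ≃ Fin n) : Fin (m + 1) ≃ Fin (n + 1) :=
  (finSuccEquiv m).trans (e.optionCongr.trans (finSuccEquiv n).symm)

/-- The juxtaposition of two bijections. -/
def juxtapose {m m' n n' : ℕ} (e : Fin m ≃ Fin m') (f : Fin n ≃ Fin n') :
    Fin (m + n) ≃ Fin (m' + n') :=
  finSumFinEquiv.symm.trans ((Equiv.sumCongr e f).trans finSumFinEquiv)

/-- In a row of `m` labels followed by `n + 1` labels, bring the first label of the second block
to the front; the order of the other labels is unchanged. -/
def pullRight (m n : ℕ) : Fin (m + (n + 1)) ≃ Fin (m + n + 1) :=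
  Fin.cycleRange (⟨m, by omega⟩ : Fin (m + n + 1))

/-- The order preserving bijection `m + r + n = m + n + r`. -/
def pullLeft (m n r : ℕ) : Fin (m + r + n) ≃ Fin (m + n + r) := finCongr (by omega)

/-- In a row of `m + 1` labels followed by `n + 1` labels, bring the first label of the first block
to place `0` and the first label of the second block to place `1`; the order of the other labels is
unchanged. -/
def bringFront (m n : ℕ) : Fin (m + 1 + (n + 1)) ≃ Fin (m + n + 2) :=
  (pullLeft m (n + 1) 1).trans (liftZero (pullRight m n))

/-! ### Modular operads in super vector spaces -/

/-- The data of a modular operad (without genus grading) in `ℤ/2`-graded vector spaces: the spaces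
`V((n))` with their grading, relabelling along bijections `{0,…,m-1} ≃ {0,…,n-1}`
(that is, the action of the symmetric groups), the contraction `V((n+2)) → V((n))` of the labels
`0` and `1` along a loop, and the composition `V((m+1)) ⊗ V((n+1)) → V((m+n))` along an edge
that joins the labels `0` of two vertices. Contractions of other labels are obtained by
relabelling. In the output of a contraction or composition the remaining labels keep their order,
those of the first factor preceding those of the second. -/
structure PreModularOperad (k : Type u) [Field k] where
  V : ℕ → Type u
  [addCommGroup : ∀ n, AddCommGroup (V n)]
  [module : ∀ n, Module k (V n)]
  gr : ∀ n, ZMod 2 → Submodule k (V n)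
  act : ∀ {m n : ℕ}, (Fin m ≃ Fin n) → V m →ₗ[k] V n
  contr : ∀ n, V (n + 2) →ₗ[k] V n
  comp : ∀ m n, V (m + 1) →ₗ[k] V (n + 1) →ₗ[k] V (m + n)

attribute [instance] PreModularOperad.addCommGroup PreModularOperad.module

namespace PreModularOperad

variable {k : Type u} [Field k]

/-- The axioms of a modular operad: the structure maps are even, equivariant, and contractions of
different edges commute. -/
structure IsModularOperad (P : PreModularOperad k) : Prop where
  gr_internal : ∀ n, DirectSum.IsInternal (P.gr n)
  act_even : ∀ {m n : ℕ} (e : Fin m ≃ Fin n) (i : ZMod 2) (x : P.V m),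
    x ∈ P.gr m i → P.act e x ∈ P.gr n i
  contr_even : ∀ (n : ℕ) (i : ZMod 2) (x : P.V (n + 2)),
    x ∈ P.gr (n + 2) i → P.contr n x ∈ P.gr n i
  comp_even : ∀ (m n : ℕ) (i j : ZMod 2) (x : P.V (m + 1)) (y : P.V (n + 1)),
    x ∈ P.gr (m + 1) i → y ∈ P.gr (n + 1) j → P.comp m n x y ∈ P.gr (m + n) (i + j)
  act_refl : ∀ (n : ℕ) (x : P.V n), P.act (Equiv.refl (Fin n)) x = x
  act_trans : ∀ {l m n : ℕ} (e : Fin l ≃ Fin m) (f : Fin m ≃ Fin n) (x : P.V l),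
    P.act (e.trans f) x = P.act f (P.act e x)
  contr_act : ∀ {m n : ℕ} (e : Fin m ≃ Fin n) (x : P.V (m + 2)),
    P.contr n (P.act (liftZero (liftZero e)) x) = P.act e (P.contr m x)
  contr_swap : ∀ (n : ℕ) (x : P.V (n + 2)),
    P.contr n (P.act (Equiv.swap 0 1) x) = P.contr n x
  comp_act : ∀ {m m' n n' : ℕ} (e : Fin m ≃ Fin m') (f : Fin n ≃ Fin n')
    (x : P.V (m + 1)) (y : P.V (n + 1)),
    P.comp m' n' (P.act (liftZero e) x) (P.act (liftZero f) y) =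
      P.act (juxtapose e f) (P.comp m n x y)
  comp_comm : ∀ (m n : ℕ) (i j : ZMod 2) (x : P.V (m + 1)) (y : P.V (n + 1)),
    x ∈ P.gr (m + 1) i → y ∈ P.gr (n + 1) j →
    P.comp n m y x = sgn (i * j) • P.act finAddFlip (P.comp m n x y)
  /-- Two loops at one vertex. -/
  contr_contr : ∀ (n : ℕ) (x : P.V (n + 4)),
    P.contr n (P.contr (n + 2) (P.act (Equiv.swap 0 2 * Equiv.swap 1 3) x)) =
      P.contr n (P.contr (n + 2) x)
  /-- Two edges that join the same two vertices. -/
  contr_comp : ∀ (m n : ℕ) (x : P.V (m + 2)) (y : P.V (n + 2)),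
    P.contr (m + n) (P.act (bringFront m n)
        (P.comp (m + 1) (n + 1) (P.act (Equiv.swap 0 1) x) (P.act (Equiv.swap 0 1) y))) =
      P.contr (m + n) (P.act (bringFront m n) (P.comp (m + 1) (n + 1) x y))
  /-- A loop at one end of an edge: the labels `0`, `1` of `x` form the loop, and its label `2` is
  joined to the label `0` of `y`. -/
  contr_comp_left : ∀ (m n : ℕ) (x : P.V (m + 3)) (y : P.V (n + 1)),
    P.contr (m + n) (P.act (pullLeft m n 2)
        (P.comp (m + 2) n (P.act (Fin.cycleRange 2) x) y)) =
      P.comp m n (P.contr (m + 1) x) y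
  /-- Two edges that form a path of length two through `y`: the label `0` of `y` is joined to `x`,
  its label `1` to `z`. -/
  comp_assoc : ∀ (l m n : ℕ) (x : P.V (l + 1)) (y : P.V (m + 2)) (z : P.V (n + 1)),
    P.act (finCongr (add_assoc l m n))
        (P.comp (l + m) n (P.act (pullRight l m) (P.comp l (m + 1) x y)) z) =
      P.comp l (m + n) x
        (P.act (pullLeft m n 1) (P.comp (m + 1) n (P.act (Equiv.swap 0 1) y) z))

/-- An isomorphism of modular operads: even linear isomorphisms `P((n)) ≃ Q((n))` that commute with
all structure maps. -/
structure Iso (P Q : PreModularOperad k) where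
  equiv : ∀ n, P.V n ≃ₗ[k] Q.V n
  map_gr : ∀ (n : ℕ) (i : ZMod 2), (P.gr n i).map (equiv n : P.V n →ₗ[k] Q.V n) = Q.gr n i
  map_act : ∀ {m n : ℕ} (e : Fin m ≃ Fin n) (x : P.V m),
    equiv n (P.act e x) = Q.act e (equiv m x)
  map_contr : ∀ (n : ℕ) (x : P.V (n + 2)),
    equiv n (P.contr n x) = Q.contr n (equiv (n + 2) x)
  map_comp : ∀ (m n : ℕ) (x : P.V (m + 1)) (y : P.V (n + 1)),
    equiv (m + n) (P.comp m n x y) = Q.comp m n (equiv (m + 1) x) (equiv (n + 1) y)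

/-- A family of subspaces that is closed under all structure maps. -/
structure Suboperad (P : PreModularOperad k) where
  carrier : ∀ n, Submodule k (P.V n)
  act_mem : ∀ {m n : ℕ} (e : Fin m ≃ Fin n) (x : P.V m),
    x ∈ carrier m → P.act e x ∈ carrier n
  contr_mem : ∀ (n : ℕ) (x : P.V (n + 2)), x ∈ carrier (n + 2) → P.contr n x ∈ carrier n
  comp_mem : ∀ (m n : ℕ) (x : P.V (m + 1)) (y : P.V (n + 1)),
    x ∈ carrier (m + 1) → y ∈ carrier (n + 1) → P.comp m n x y ∈ carrier (m + n)

/-- The restriction of the structure to a suboperad. -/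
def Suboperad.toPre {P : PreModularOperad k} (Q : P.Suboperad) : PreModularOperad k where
  V n := Q.carrier n
  gr n i := (P.gr n i).comap (Q.carrier n).subtype
  act e := (P.act e).restrict (Q.act_mem e)
  contr n := (P.contr n).restrict (Q.contr_mem n)
  comp m n := LinearMap.mk₂ k
    (fun x y => ⟨P.comp m n x y, Q.comp_mem m n x y x.2 y.2⟩)
    (fun _ _ _ => Subtype.ext (by simp)) (fun _ _ _ => Subtype.ext (by simp))
    (fun _ _ _ => Subtype.ext (by simp)) (fun _ _ _ => Subtype.ext (by simp))

/-- The subspace of the sequences that vanish from some index on. -/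
def eventuallyZero (P : ℕ → PreModularOperad k) (n : ℕ) : Submodule k (∀ N, (P N).V n) where
  carrier := {x | ∀ᶠ N in Filter.atTop, x N = 0}
  zero_mem' := by simp
  add_mem' {x y} hx hy := by
    filter_upwards [hx, hy] with N h₁ h₂
    simp [h₁, h₂]
  smul_mem' c x hx := by
    filter_upwards [hx] with N h
    simp [h]

/-- The space of germs, as `N → ∞`, of sequences `x_N ∈ P_N((n))`. -/
abbrev GermSpace (P : ℕ → PreModularOperad k) (n : ℕ) : Type u :=
  (∀ N, (P N).V n) ⧸ eventuallyZero P n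

/-- The germ of a sequence. -/
def germ (P : ℕ → PreModularOperad k) (n : ℕ) : (∀ N, (P N).V n) →ₗ[k] GermSpace P n :=
  (eventuallyZero P n).mkQ

/-- A linear map on germs from a sequence of linear maps. -/
def germMap (P : ℕ → PreModularOperad k) (m n : ℕ) (f : ∀ N, (P N).V m →ₗ[k] (P N).V n) :
    GermSpace P m →ₗ[k] GermSpace P n :=
  (eventuallyZero P m).mapQ (eventuallyZero P n)
    (LinearMap.pi fun N => f N ∘ₗ LinearMap.proj N) (by
      intro x hx
      change ∀ᶠ N in Filter.atTop, f N (x N) = 0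
      have hx' : ∀ᶠ N in Filter.atTop, x N = 0 := hx
      filter_upwards [hx'] with N h
      rw [h, map_zero])

lemma germMap_germ (P : ℕ → PreModularOperad k) (m n : ℕ) (f : ∀ N, (P N).V m →ₗ[k] (P N).V n)
    (x : ∀ N, (P N).V m) : germMap P m n f (germ P m x) = germ P n (fun N => f N (x N)) := rfl

lemma germ_surjective (P : ℕ → PreModularOperad k) (n : ℕ) : Function.Surjective (germ P n) :=
  Submodule.mkQ_surjective _

/-- The germs, as `N → ∞`, of sequences of elements of modular operads `P_N`, with the termwise
operations. -/
def germs (P : ℕ → PreModularOperad k) : PreModularOperad k where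
  V n := GermSpace P n
  gr n i := (Submodule.pi Set.univ fun N => (P N).gr n i).map (germ P n)
  act {m n} e := germMap P m n fun N => (P N).act e
  contr n := germMap P (n + 2) n fun N => (P N).contr n
  comp m n := (eventuallyZero P (m + 1)).liftQ
    { toFun := fun x => germMap P (n + 1) (m + n) fun N => (P N).comp m n (x N)
      map_add' := fun x y => by
        refine LinearMap.ext fun z => ?_
        obtain ⟨z, rfl⟩ := germ_surjective P (n + 1) z
        simp only [LinearMap.add_apply, germMap_germ, Pi.add_apply, map_add]
        rw [← map_add]; rfl
      map_smul' := fun c x => by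
        refine LinearMap.ext fun z => ?_
        obtain ⟨z, rfl⟩ := germ_surjective P (n + 1) z
        simp only [LinearMap.smul_apply, germMap_germ, Pi.smul_apply, map_smul, RingHom.id_apply]
        rw [← map_smul]; rfl }
    (by
      intro x hx
      refine LinearMap.ext fun z => ?_
      obtain ⟨z, rfl⟩ := germ_surjective P (n + 1) z
      have hx' : ∀ᶠ N in Filter.atTop, x N = 0 := hx
      refine (Submodule.Quotient.mk_eq_zero _).2 ?_
      change ∀ᶠ N in Filter.atTop, (P N).comp m n (x N) (z N) = 0
      filter_upwards [hx'] with N h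
      rw [h, map_zero, LinearMap.zero_apply])

end PreModularOperad

/-! ### The modular operad of permutations -/

section Permutations

variable {I : Type*} [DecidableEq I]

/-- Cut a permutation of `I ⊔ {f, f'}` at `f = none` and `f' = some none` and reglue: if `f`, `f'`
lie in different cycles `(f A)`, `(f' B)` these become `(f A f' B)`, and a cycle `(f A f' B)`
becomes `(f A)(f' B)`. -/
def reglue (σ : Equiv.Perm (Option (Option I))) : Equiv.Perm (Option (Option I)) :=
  Equiv.swap none (some none) * σ

/-- Reglue and then erase `f` and `f'` from the cycles: different cycles `(f A)(f' B)` become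
`(A B)`, and a cycle `(f A f' B)` becomes `(A)(B)`. -/
def glue (σ : Equiv.Perm (Option (Option I))) : Equiv.Perm I :=
  Equiv.removeNone (Equiv.removeNone (reglue σ))

/-- The number of cycles that become empty when `f` and `f'` are erased after regluing, that is, of
the cycles `(f)`, `(f')`, `(f f')` of the reglued permutation. It is positive exactly when `f`, `f'`
are neighbours in one cycle or both are fixed points. -/
def emptyCycles (σ : Equiv.Perm (Option (Option I))) : ℕ :=
  (if reglue σ none = none then 1 else 0) +
  (if reglue σ (some none) = some none then 1 else 0) +
  (if reglue σ none = some none ∧ reglue σ (some none) = none then 1 else 0)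

end Permutations

/-- `{0,…,n+1}` as `I ⊔ {f, f'}` with `f = 0`, `f' = 1` and `I = {0,…,n-1}` shifted by two. -/
def finTwoEquiv (n : ℕ) : Fin (n + 2) ≃ Option (Option (Fin n)) :=
  (finSuccEquiv (n + 1)).trans (finSuccEquiv n).optionCongr

/-- A permutation of `{0,…,n+1}` as a permutation of `I ⊔ {f, f'}`. -/
def splitPerm {n : ℕ} (σ : Equiv.Perm (Fin (n + 2))) : Equiv.Perm (Option (Option (Fin n))) :=
  (finTwoEquiv n).permCongr σ

section Operads

variable (k : Type u) [Field k]

/-- Contraction of the labels `0`, `1` in the group algebras: regluing of cycles, and zero if an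
empty cycle arises. -/
def permContr (n : ℕ) : MonoidAlgebra k (Equiv.Perm (Fin (n + 2))) →ₗ[k]
    MonoidAlgebra k (Equiv.Perm (Fin n)) :=
  (MonoidAlgebra.basis (Equiv.Perm (Fin (n + 2))) k).constr k fun σ =>
    if emptyCycles (splitPerm σ) = 0 then MonoidAlgebra.single (glue (splitPerm σ)) 1 else 0

/-- Relabelling of permutations (conjugation). -/
def permAct {m n : ℕ} (e : Fin m ≃ Fin n) : MonoidAlgebra k (Equiv.Perm (Fin m)) →ₗ[k]
    MonoidAlgebra k (Equiv.Perm (Fin n)) :=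
  (MonoidAlgebra.basis (Equiv.Perm (Fin m)) k).constr k fun σ =>
    MonoidAlgebra.single (e.permCongr σ) 1

/-- Juxtaposition of permutations. -/
def permProd (m n : ℕ) : MonoidAlgebra k (Equiv.Perm (Fin m)) →ₗ[k]
    MonoidAlgebra k (Equiv.Perm (Fin n)) →ₗ[k] MonoidAlgebra k (Equiv.Perm (Fin (m + n))) :=
  (MonoidAlgebra.basis (Equiv.Perm (Fin m)) k).constr k fun σ =>
    (MonoidAlgebra.basis (Equiv.Perm (Fin n)) k).constr k fun τ =>
      MonoidAlgebra.single (juxtapose σ τ) 1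

/-- The modular operad `𝒮((n)) = k[S_n]`, purely even. The composition along an edge is
juxtaposition followed by contraction. -/
def permOperad : PreModularOperad k where
  V n := MonoidAlgebra k (Equiv.Perm (Fin n))
  gr _ i := if i = 0 then ⊤ else ⊥
  act e := permAct k e
  contr n := permContr k n
  comp m n := (permProd k (m + 1) (n + 1)).compr₂
    (permContr k (m + n) ∘ₗ permAct k (bringFront m n))

/-! ### The endomorphism modular operad of `(End U, supertrace)`, `U = k^{p|q}` -/

/-- The index set of the standard basis of `U = k^{p|q}`. -/
abbrev Idx (p q : ℕ) : Type := Fin p ⊕ Fin q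

variable {k} {p q : ℕ}

/-- The parity of a basis vector of `U`. -/
def par (i : Idx p q) : ZMod 2 := Sum.elim (fun _ => 0) (fun _ => 1) i

/-- The parity of an elementary matrix `E_{ij}`, given by the pair `(i, j)`. -/
def parE (a : Idx p q × Idx p q) : ZMod 2 := par a.1 + par a.2

variable (k) in
/-- The elementary matrix `E_{ij} : e_j ↦ e_i`, given by the pair `(i, j)`. -/
def elem (a : Idx p q × Idx p q) : Matrix (Idx p q) (Idx p q) k :=
  Matrix.stdBasis k (Idx p q) (Idx p q) a

/-- The supertrace. -/
def superTrace (X : Matrix (Idx p q) (Idx p q) k) : k := ∑ i, (sgn (par i) : k) * X i i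

variable (k p q)

/-- `End(U)^{⊗ n}`. -/
abbrev EndPow (n : ℕ) : Type u := ⨂[k] _ : Fin n, Matrix (Idx p q) (Idx p q) k

/-- The basis of `End(U)^{⊗ n}` formed by the tensor products of elementary matrices. -/
def elemBasis (n : ℕ) : Basis (Fin n → Idx p q × Idx p q) k (EndPow k p q n) :=
  Basis.piTensorProduct fun _ => Matrix.stdBasis k (Idx p q) (Idx p q)

/-- Relabelling of tensor factors: the `i`-th factor becomes the `e i`-th one, with the Koszul
sign. -/
def endAct {m n : ℕ} (e : Fin m ≃ Fin n) : EndPow k p q m →ₗ[k] EndPow k p q n :=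
  (elemBasis k p q m).constr k fun a =>
    koszulSign e (fun i => parE (a i)) • elemBasis k p q n (fun i => a (e.symm i))

/-- Contraction by the supertrace pairing:
`X₀ ⊗ X₁ ⊗ X₂ ⊗ … ↦ str(X₀ X₁) X₂ ⊗ …`. -/
def endContr (n : ℕ) : EndPow k p q (n + 2) →ₗ[k] EndPow k p q n :=
  (elemBasis k p q (n + 2)).constr k fun a =>
    superTrace (elem k (a 0) * elem k (a 1)) • elemBasis k p q n (fun i => a i.succ.succ)

/-- The tensor product `End(U)^{⊗ m} × End(U)^{⊗ n} → End(U)^{⊗ (m+n)}`. -/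
def endProd (m n : ℕ) : EndPow k p q m →ₗ[k] EndPow k p q n →ₗ[k] EndPow k p q (m + n) :=
  (elemBasis k p q m).constr k fun a =>
    (elemBasis k p q n).constr k fun b => elemBasis k p q (m + n) (Fin.append a b)

/-- The endomorphism modular operad `ℰ[End U]((n)) = End(U)^{⊗ n}`, `U = k^{p|q}`. The composition
along an edge is tensor product followed by contraction. -/
def endOperad : PreModularOperad k where
  V n := EndPow k p q n
  gr n i := Submodule.span k
    {x | ∃ a : Fin n → Idx p q × Idx p q, ∑ t, parE (a t) = i ∧ x = elemBasis k p q n a}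
  act e := endAct k p q e
  contr n := endContr k p q n
  comp m n := (endProd k p q (m + 1) (n + 1)).compr₂
    (endContr k p q (m + n) ∘ₗ endAct k p q (bringFront m n))

/-- The invariant tensor `μ(σ) ∈ End(U)^{⊗ n} = End(U^{⊗ n})` of a permutation, that is, the
endomorphism `u_1 ⊗ … ⊗ u_n ↦ ± u_{σ⁻¹(1)} ⊗ … ⊗ u_{σ⁻¹(n)}`. The second sign is the one of
`(X_1 ⊗ … ⊗ X_n)(u_1 ⊗ … ⊗ u_n) = ± X_1 u_1 ⊗ … ⊗ X_n u_n`. -/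
def permTensor (n : ℕ) : MonoidAlgebra k (Equiv.Perm (Fin n)) →ₗ[k] EndPow k p q n :=
  (MonoidAlgebra.basis (Equiv.Perm (Fin n)) k).constr k fun σ =>
    ∑ α : Fin n → Idx p q,
      (koszulSign σ (fun i => par (α i)) *
        ∏ s, ∏ t, if s < t then sgn ((par (α (σ.symm t)) + par (α t)) * par (α s)) else 1) •
        elemBasis k p q n (fun t => (α (σ.symm t), α t))

/-! ### Invariants of the supergroup `GL(U)` -/

section Supergroup

variable {k} {A : Type u} [Ring A] [Algebra k A]

/-- Supercommutativity of a `ℤ/2`-graded algebra. -/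
def IsSupercommutative (𝒜 : ZMod 2 → Submodule k A) : Prop :=
  ∀ (i j : ZMod 2) (a b : A), a ∈ 𝒜 i → b ∈ 𝒜 j → a * b = sgn (i * j) • (b * a)

/-- The `A`-points of the supergroup `GL(U)`: the even automorphisms `e_j ↦ ∑ i, e_i g_{ij}` of the
right `A`-module `U ⊗ A`. -/
def IsGLPoint {p q : ℕ} (𝒜 : ZMod 2 → Submodule k A)
    (g : (Matrix (Idx p q) (Idx p q) A)ˣ) : Prop :=
  ∀ i j, (g : Matrix (Idx p q) (Idx p q) A) i j ∈ 𝒜 (par i + par j)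

/-- The coefficient of `E_b` in `g E_a g⁻¹ ∈ End(U) ⊗ A`. The sign is the one of
`(E_b ⊗ c)(e_l ⊗ 1) = ± E_b e_l ⊗ c`. -/
def adCoeff {p q : ℕ} (g : (Matrix (Idx p q) (Idx p q) A)ˣ) (a b : Idx p q × Idx p q) : A :=
  sgn ((parE a + parE b) * par b.2) •
    ((g : Matrix (Idx p q) (Idx p q) A) b.1 a.1 *
      (↑g⁻¹ : Matrix (Idx p q) (Idx p q) A) a.2 b.2)

/-- The diagonal action of an `A`-point of `GL(U)` on `End(U)^{⊗ n}` by conjugation,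
`X_1 ⊗ … ⊗ X_n ↦ g X_1 g⁻¹ ⊗ … ⊗ g X_n g⁻¹ ∈ End(U)^{⊗ n} ⊗ A`. The sign comes from moving
the coefficients in `A` to the right. -/
def glAction {p q n : ℕ} (g : (Matrix (Idx p q) (Idx p q) A)ˣ) :
    EndPow k p q n →ₗ[k] EndPow k p q n ⊗[k] A :=
  (elemBasis k p q n).constr k fun a =>
    ∑ b : Fin n → Idx p q × Idx p q, elemBasis k p q n b ⊗ₜ[k]
      ((∏ s, ∏ t, if s < t then sgn ((parE (a s) + parE (b s)) * parE (b t)) else 1) •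
        (List.ofFn fun t => adCoeff g (a t) (b t)).prod)

end Supergroup

/-- The invariants of the supergroup `GL(U)` in `End(U)^{⊗ n}`: the tensors that are fixed by all
`A`-points of `GL(U)`, for all supercommutative algebras `A`. -/
def glInvariants (n : ℕ) : Submodule k (EndPow k p q n) where
  carrier := {x | ∀ (A : Type u) [Ring A] [Algebra k A] (𝒜 : ZMod 2 → Submodule k A)
    [GradedAlgebra 𝒜], IsSupercommutative 𝒜 →
    ∀ g : (Matrix (Idx p q) (Idx p q) A)ˣ, IsGLPoint 𝒜 g → glAction g x = x ⊗ₜ[k] (1 : A)}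
  zero_mem' := by
    intro A _ _ 𝒜 _ _ g _
    simp
  add_mem' {x y} hx hy := by
    intro A _ _ 𝒜 _ h g hg
    rw [map_add, hx A 𝒜 h g hg, hy A 𝒜 h g hg, TensorProduct.add_tmul]
  smul_mem' c x hx := by
    intro A _ _ 𝒜 _ h g hg
    rw [map_smul, hx A 𝒜 h g hg, TensorProduct.smul_tmul']

/-! ### The stable limit -/

/-- The compression `X ↦ pr ∘ X ∘ inc` from `End(U ⊕ k^{1|1})` to `End(U)`, `U = k^{N|N}`. -/
def compress (N : ℕ) : Matrix (Idx (N + 1) (N + 1)) (Idx (N + 1) (N + 1)) k →ₗ[k]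
    Matrix (Idx N N) (Idx N N) k where
  toFun X := X.submatrix (Sum.map Fin.castSucc Fin.castSucc) (Sum.map Fin.castSucc Fin.castSucc)
  map_add' _ _ := rfl
  map_smul' _ _ := rfl

/-- The compression `End(U ⊕ k^{1|1})^{⊗ n} → End(U)^{⊗ n}`, `U = k^{N|N}`. -/
def compressPow (N n : ℕ) : EndPow k (N + 1) (N + 1) n →ₗ[k] EndPow k N N n :=
  PiTensorProduct.map fun _ => compress k N

/-- The sequences of invariants `x_N ∈ ℰ[End k^{N|N}]((n))^{GL(N|N)}` in which, for all large `N`,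
`x_{N+1}` is the image of `x_N` under the transition map of the direct system, which is the inverse
of the compression. -/
def stableSequences (n : ℕ) : Submodule k (∀ N, EndPow k N N n) where
  carrier := {x | ∀ᶠ N in Filter.atTop,
    x N ∈ glInvariants k N N n ∧ compressPow k N n (x (N + 1)) = x N}
  zero_mem' := Filter.Eventually.of_forall fun N => ⟨zero_mem _, map_zero _⟩
  add_mem' {x y} hx hy := by
    filter_upwards [hx, hy] with N h₁ h₂
    exact ⟨add_mem h₁.1 h₂.1, by rw [Pi.add_apply, map_add, h₁.2, h₂.2, Pi.add_apply]⟩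
  smul_mem' c x hx := by
    filter_upwards [hx] with N h
    exact ⟨Submodule.smul_mem _ c h.1, by rw [Pi.smul_apply, map_smul, h.2, Pi.smul_apply]⟩

/-- The direct limit `lim_{N → ∞} ℰ[End k^{N|N}]((n))^{GL(N|N)}`: the germs, as `N → ∞`, of these
sequences. -/
def stableInvariants (n : ℕ) :
    Submodule k ((PreModularOperad.germs fun N => endOperad k N N).V n) :=
  Submodule.map (PreModularOperad.germ (fun N => endOperad k N N) n) (stableSequences k n)

end Operads

end MatrixModular

end

/-!
The space `End(U)^{⊗ n}` has the basis of words `u_{β 0} u_{γ 0}^* u_{β 1} u_{γ 1}^* …` in `2 n`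
homogeneous letters. A pair of bijections, one for the letters `u` and one for the dual letters,
acts on such words with a Koszul sign (`letterAct`). Since Koszul signs form a cocycle
(`koszulExp_trans`), this action is functorial (`letterAct_trans`). It contains the structure of
the endomorphism operad: a relabelling moves both rows of letters alike, and the contraction is
the supertrace of the first slot, taken twice, after the letters `u` of the slots `0` and `1` have
been exchanged (`endContr_eq`). The axioms of a modular operad for `End(U)^{⊗ n}` thereby become
identities between bijections of finite sets of labels, checked on values (`HasVal`), together
with the remark that a contracted pair of letters contributes only if it is even.

**Contraction of permutations.** The tensor `μ(σ)` arises from the identity by moving the letters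
`u` by `σ` (`permTensor_eq_letterAct`). Exchanging two letters `u` multiplies `σ` by the
transposition `(0 1)`, and the supertrace of a slot erases its label from the cycles of `σ`; if
the label is a fixed point, the factor `sdim U = p - q` appears (`firstTrace_permTensor`). Erasing
`0` and `1` from the cycles of `(0 1) σ` is the rule for regluing cycles, which gives
`endContr_permTensor_single`. For `p = q` the superdimension vanishes, so that `μ` is compatible
with the contraction of `𝒮` (`permTensor_contr`).

**Invariants.** For points of `GL(U)` over a supercommutative algebra, the matrix coefficients of
the action are products of homogeneous elements, one for each letter, and reordering them costs
the same sign as reordering the letters (`glCoeff_moveLetters`). Hence the action commutes with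
`letterAct`, and also with the supertrace of a slot (`glAction_firstTrace`). A product of
invariants is invariant since invariants are even (`glInvariants_even`).

**Invariants come from permutations for `n ≤ p, q`.** Let `z` be an invariant. Invariance under
the diagonal torus shows that `z` is supported on words whose two rows have the same content, so a
coefficient at a word with dual letters `w 0, …, w (n - 1)`, distinct, is a coefficient of some
`μ(σ)` (`exists_perm_of_repr_ne_zero`). Subtracting a combination of the `μ(σ)`, one may assume
that the coefficients vanish at all words whose dual letters are the first `n` even labels.
Invariance under `1 + ε E_{cd}`, with `ε` the odd generator of the dual numbers, allows one to
replace a dual letter `d` that occurs only once by a letter `c` of the other parity without losing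
this vanishing (`VanishesAt.update`). As there are at least `n` even and `n` odd labels, all rows
of dual letters are reached in this way (`VanishesAt.of_evenWord`), and `z = 0`. The coefficients
of `μ(x)` at words of distinct even labels are those of `x`, so `μ` is injective as well.

**The modular operads.** The maps `μ_N` for all `N` are jointly injective and compatible with all
operations, so the axioms for `𝒮` follow from those for `End(U_N)^{⊗ n}`; for the invariants they
follow by inclusion (`IsModularOperad.of_jointly_injective`). Compressions send `μ_{N+1}(x)` to
`μ_N(x)`, hence they are bijective on invariants in the stable range, every germ of stable
invariants is the germ of a sequence `μ_N(x)` (`range_stableTensor`), and these germs form a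
modular operad isomorphic to `𝒮` (`stableIso`).
-/

noncomputable section

namespace MatrixModular

/-! ### Koszul signs -/

lemma zmod_two_cases (i : ZMod 2) : i = 0 ∨ i = 1 := by
  revert i
  decide

lemma sgn_zero : sgn 0 = 1 := by decide

lemma sgn_one : sgn 1 = -1 := by decide

lemma sgn_add (i j : ZMod 2) : sgn (i + j) = sgn i * sgn j := by
  revert i j; decide

lemma sgn_mul_self (i : ZMod 2) : sgn i * sgn i = 1 := by
  revert i; decide

lemma sgn_sum {ι : Type*} (s : Finset ι) (f : ι → ZMod 2) :
    sgn (∑ i ∈ s, f i) = ∏ i ∈ s, sgn (f i) := by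
  classical
  induction s using Finset.induction_on with
  | empty => simp [sgn_zero]
  | insert a s ha ih => rw [Finset.sum_insert ha, Finset.prod_insert ha, sgn_add, ih]

/-- The Koszul sign exponent between two orderings of a finite set of homogeneous letters, given by
injective position functions `r` and `s`: the sum of `d i * d j` over the pairs that occur in the
order `i, j` for `r` and in the order `j, i` for `s`. -/
def koszulExp {ι : Type*} [Fintype ι] (r s : ι → ℕ) (d : ι → ZMod 2) : ZMod 2 :=
  ∑ i, ∑ j, if r i < r j ∧ s j < s i then d i * d j else 0

section koszulExp

variable {ι κ : Type*} [Fintype ι] [Fintype κ]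

lemma koszulExp_self (r : ι → ℕ) (d : ι → ZMod 2) : koszulExp r r d = 0 := by
  refine Finset.sum_eq_zero fun i _ => Finset.sum_eq_zero fun j _ => if_neg ?_
  omega

lemma koszulExp_comp_equiv (e : κ ≃ ι) (r s : ι → ℕ) (d : ι → ZMod 2) :
    koszulExp (r ∘ e) (s ∘ e) (d ∘ e) = koszulExp r s d := by
  unfold koszulExp
  rw [← e.sum_comp]
  refine Finset.sum_congr rfl fun i _ => ?_
  rw [← e.sum_comp]
  rfl

/-- The cocycle property of Koszul signs. It is the reason why permutations of homogeneous letters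
act functorially. -/
lemma koszulExp_trans {r s t : ι → ℕ} (hr : Function.Injective r) (hs : Function.Injective s)
    (ht : Function.Injective t) (d : ι → ZMod 2) :
    koszulExp r t d = koszulExp r s d + koszulExp s t d := by
  -- the pairs that two of the three comparisons reverse cancel between `(i, j)` and `(j, i)`
  have key : koszulExp r s d + koszulExp s t d + koszulExp r t d =
      (∑ i, ∑ j, if r i < r j ∧ s j < s i ∧ t i < t j then d i * d j else 0) +
      ∑ j, ∑ i, if r i < r j ∧ s j < s i ∧ t i < t j then d i * d j else 0 := by
    unfold koszulExp
    simp only [← Finset.sum_add_distrib]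
    refine Finset.sum_congr rfl fun i _ => Finset.sum_congr rfl fun j _ => ?_
    rw [mul_comm (d j)]
    by_cases hij : i = j
    · subst hij; simp
    have h1 := hr.ne hij
    have h2 := hs.ne hij
    have h3 := ht.ne hij
    generalize d i * d j = x
    have hx : x + x = 0 := CharTwo.add_self_eq_zero x
    rcases lt_or_gt_of_ne h1 with h1 | h1 <;> rcases lt_or_gt_of_ne h2 with h2 | h2 <;>
      rcases lt_or_gt_of_ne h3 with h3 | h3 <;>
      simp [h1, h2, h3, h1.not_gt, h2.not_gt, h3.not_gt, hx]
  rw [Finset.sum_comm (f := fun j i => if r i < r j ∧ s j < s i ∧ t i < t j then d i * d j else 0),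
    CharTwo.add_self_eq_zero] at key
  exact ((CharTwo.add_eq_zero).1 key).symm

end koszulExp

lemma koszulSign_eq {m n : ℕ} (e : Fin m ≃ Fin n) (d : Fin m → ZMod 2) :
    koszulSign e d = sgn (koszulExp Fin.val (fun i => (e i).val) d) := by
  unfold koszulSign koszulExp
  rw [sgn_sum]
  refine Finset.prod_congr rfl fun i _ => ?_
  rw [sgn_sum]
  refine Finset.prod_congr rfl fun j _ => ?_
  by_cases h : i < j ∧ e j < e i
  · rw [if_pos h, if_pos (by exact_mod_cast h)]
  · rw [if_neg h, if_neg (by exact_mod_cast h), sgn_zero]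

/-! ### Extensions of bijections by a fixed point -/

@[simp] lemma liftZero_zero {m n : ℕ} (e : Fin m ≃ Fin n) : liftZero e 0 = 0 := by
  simp [liftZero]

@[simp] lemma liftZero_succ {m n : ℕ} (e : Fin m ≃ Fin n) (i : Fin m) :
    liftZero e i.succ = (e i).succ := by
  simp [liftZero]

@[simp] lemma liftZero_symm {m n : ℕ} (e : Fin m ≃ Fin n) :
    (liftZero e).symm = liftZero e.symm := by
  ext x
  induction x using Fin.cases with
  | zero => rw [(Equiv.symm_apply_eq _).2 (liftZero_zero e).symm, liftZero_zero]
  | succ i =>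
    rw [liftZero_succ, (Equiv.symm_apply_eq (liftZero e) (y := (e.symm i).succ)).2 (by simp)]

lemma liftZero_refl (n : ℕ) : liftZero (Equiv.refl (Fin n)) = Equiv.refl _ := by
  ext x
  induction x using Fin.cases <;> simp

lemma liftZero_one (n : ℕ) : liftZero (1 : Equiv.Perm (Fin n)) = 1 := liftZero_refl n

/-- The transposition of the labels `0` and `1` fixes the other labels. -/
lemma swap_zero_one_succ_succ {n : ℕ} (i : Fin n) :
    Equiv.swap (0 : Fin (n + 2)) 1 i.succ.succ = i.succ.succ :=
  Equiv.swap_apply_of_ne_of_ne (Fin.succ_ne_zero _)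
    (fun h => Fin.succ_ne_zero i (Fin.succ_injective _ h))

/-! ### Permutations of letters

`End(U)^{⊗ n}` has a basis of words of `2 n` letters: the slot `t` of `E_{β γ}` contributes the
letter `u_β` (index `Sum.inl t`) followed by the dual letter `u_γ^*` (index `Sum.inr t`). -/

/-- The position of a letter in the word `u_{β 0} u_{γ 0}^* u_{β 1} u_{γ 1}^* …`. -/
def letterPos (n : ℕ) : Fin n ⊕ Fin n → ℕ :=
  Sum.elim (fun t => 2 * t.val) (fun t => 2 * t.val + 1)

@[simp] lemma letterPos_inl {n : ℕ} (t : Fin n) : letterPos n (Sum.inl t) = 2 * t.val := rfl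

@[simp] lemma letterPos_inr {n : ℕ} (t : Fin n) : letterPos n (Sum.inr t) = 2 * t.val + 1 := rfl

lemma letterPos_injective (n : ℕ) : Function.Injective (letterPos n) := by
  rintro (i | i) (j | j) h <;> simp [Fin.ext_iff] at h ⊢ <;> omega

/-- The sign exponent of moving the letters `u` by `e₁` and the dual letters by `e₂`. -/
def letterExp {m n : ℕ} (e₁ e₂ : Fin m ≃ Fin n) (d : Fin m ⊕ Fin m → ZMod 2) : ZMod 2 :=
  koszulExp (letterPos m) (letterPos n ∘ Equiv.sumCongr e₁ e₂) d

lemma letterExp_refl (n : ℕ) (d : Fin n ⊕ Fin n → ZMod 2) :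
    letterExp (Equiv.refl _) (Equiv.refl _) d = 0 := by
  unfold letterExp
  rw [Equiv.sumCongr_refl]
  exact koszulExp_self _ _

lemma letterExp_trans {l m n : ℕ} (e₁ e₂ : Fin l ≃ Fin m) (f₁ f₂ : Fin m ≃ Fin n)
    (d : Fin l ⊕ Fin l → ZMod 2) :
    letterExp (e₁.trans f₁) (e₂.trans f₂) d =
      letterExp e₁ e₂ d + letterExp f₁ f₂ (d ∘ (Equiv.sumCongr e₁ e₂).symm) := by
  unfold letterExp
  rw [koszulExp_trans (letterPos_injective l)
    ((letterPos_injective m).comp (Equiv.sumCongr e₁ e₂).injective)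
    ((letterPos_injective n).comp (Equiv.injective _))]
  congr 1
  rw [← koszulExp_comp_equiv (Equiv.sumCongr e₁ e₂) (letterPos m)]
  congr 1
  · ext (i | i) <;> rfl
  · ext i
    simp

lemma letterExp_sum {m n : ℕ} (e₁ e₂ : Fin m ≃ Fin n) (d : Fin m ⊕ Fin m → ZMod 2) :
    letterExp e₁ e₂ d = ∑ i, ∑ j,
      ((if i < j ∧ e₁ j < e₁ i then d (.inl i) * d (.inl j) else 0) +
        (if i ≤ j ∧ e₂ j < e₁ i then d (.inl i) * d (.inr j) else 0) +
        (if i < j ∧ e₁ j ≤ e₂ i then d (.inr i) * d (.inl j) else 0) +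
        (if i < j ∧ e₂ j < e₂ i then d (.inr i) * d (.inr j) else 0)) := by
  unfold letterExp koszulExp
  simp only [Fintype.sum_sum_type, ← Finset.sum_add_distrib]
  refine Finset.sum_congr rfl fun i _ => Finset.sum_congr rfl fun j _ => ?_
  rw [add_assoc (_ + _)]
  refine congrArg₂ (· + ·) (congrArg₂ (· + ·) ?_ ?_) (congrArg₂ (· + ·) ?_ ?_) <;>
  · refine if_congr ?_ rfl rfl
    simp only [letterPos_inl, letterPos_inr, Function.comp_apply, Equiv.sumCongr_apply,
      Sum.map_inl, Sum.map_inr, Fin.lt_def, Fin.le_def]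
    omega

/-- Moving whole slots: each slot counts with its total parity. -/
lemma letterExp_diag {m n : ℕ} (e : Fin m ≃ Fin n) (d : Fin m ⊕ Fin m → ZMod 2) :
    letterExp e e d =
      koszulExp Fin.val (fun i => (e i).val) (fun t => d (.inl t) + d (.inr t)) := by
  rw [letterExp_sum]
  unfold koszulExp
  refine Finset.sum_congr rfl fun i _ => Finset.sum_congr rfl fun j _ => ?_
  by_cases hij : i = j
  · subst hij; simp
  have h : e i ≠ e j := e.injective.ne hij
  simp only [hij, h.symm, le_iff_lt_or_eq, or_false, ← Fin.lt_def]
  split_ifs <;> ring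

lemma letterExp_liftZero {m n : ℕ} (e₁ e₂ : Fin m ≃ Fin n)
    (d : Fin (m + 1) ⊕ Fin (m + 1) → ZMod 2) :
    letterExp (liftZero e₁) (liftZero e₂) d =
      letterExp e₁ e₂ (d ∘ Sum.map Fin.succ Fin.succ) := by
  simp only [letterExp_sum, Fin.sum_univ_succ]
  simp [Fin.succ_le_succ_iff, Fin.succ_pos]

/-- The sign of `permTensor` is the sign of moving only the letters `u`. -/
lemma permTensor_sign {n : ℕ} (σ : Equiv.Perm (Fin n)) (d : Fin n → ZMod 2) :
    (koszulSign σ d *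
        ∏ s, ∏ t, if s < t then sgn ((d (σ.symm t) + d t) * d s) else 1) =
      sgn (letterExp σ 1 (Sum.elim d d)) := by
  have h2 : (∏ s, ∏ t, if s < t then sgn ((d (σ.symm t) + d t) * d s) else 1) =
      sgn (∑ i, ∑ j, ((if j < σ i then d i * d j else 0) + if j < i then d i * d j else 0)) := by
    rw [Finset.sum_comm, sgn_sum]
    refine Finset.prod_congr rfl fun j _ => ?_
    rw [Finset.sum_add_distrib, ← σ.symm.sum_comp, ← Finset.sum_add_distrib, sgn_sum]
    refine Finset.prod_congr rfl fun t _ => ?_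
    simp only [Equiv.apply_symm_apply]
    split_ifs
    · rw [add_mul]
    · simp [sgn_zero]
  rw [h2, koszulSign_eq, ← sgn_add, letterExp_sum]
  congr 1
  unfold koszulExp
  have h3 : (∑ i, ∑ j : Fin n, if i < j ∧ σ j ≤ i then d i * d j else 0) =
      ∑ i, ∑ j : Fin n, if j < i ∧ σ i ≤ j then d i * d j else 0 := by
    rw [Finset.sum_comm]
    simp only [mul_comm]
  have h4 : (∑ i, ∑ j, ((if i < j ∧ σ j < σ i then d i * d j else 0) +
        (if i ≤ j ∧ j < σ i then d i * d j else 0) + (if i < j ∧ σ j ≤ i then d i * d j else 0) +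
        (if i < j ∧ j < i then d i * d j else 0))) =
      ∑ i, ∑ j, ((if i < j ∧ σ j < σ i then d i * d j else 0) +
        ((if i ≤ j ∧ j < σ i then d i * d j else 0) +
          (if j < i ∧ σ i ≤ j then d i * d j else 0))) := by
    have h5 : ∀ i j : Fin n, (if i < j ∧ j < i then d i * d j else 0) = 0 := fun i j =>
      if_neg (by omega)
    simp only [h5, Finset.sum_add_distrib, h3, add_zero, add_assoc]
  refine Eq.trans ?_ h4.symm
  rw [← Finset.sum_add_distrib]
  refine Finset.sum_congr rfl fun i _ => ?_
  rw [← Finset.sum_add_distrib]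
  refine Finset.sum_congr rfl fun j _ => ?_
  congr 1
  have hx : d i * d j + d i * d j = 0 := CharTwo.add_self_eq_zero _
  by_cases h : j < i <;> by_cases h' : j < σ i <;>
    simp [h, h', not_lt.1, ← not_lt, hx]

/-! ### Values of relabellings -/

section Values

variable {l m m' n n' : ℕ}

/-- The bijection `e` is given on values by the function `φ`. Equalities between composite
relabellings thus become equalities between piecewise linear functions on `ℕ`. -/
def HasVal (e : Fin m ≃ Fin n) (φ : ℕ → ℕ) : Prop := ∀ x, (e x).val = φ x.val

namespace HasVal

lemma trans {e : Fin l ≃ Fin m} {f : Fin m ≃ Fin n} {φ ψ : ℕ → ℕ} (he : HasVal e φ)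
    (hf : HasVal f ψ) : HasVal (e.trans f) fun x => ψ (φ x) := fun x => by
  rw [Equiv.trans_apply, hf, he]

lemma liftZero {e : Fin m ≃ Fin n} {φ : ℕ → ℕ} (he : HasVal e φ) :
    HasVal (liftZero e) fun x => if x = 0 then 0 else φ (x - 1) + 1 := fun x => by
  induction x using Fin.cases with
  | zero => simp
  | succ i => simp [he i]

lemma liftTwo {e : Fin m ≃ Fin n} {φ : ℕ → ℕ} (he : HasVal e φ) :
    HasVal (MatrixModular.liftZero (MatrixModular.liftZero e))
      fun x => if x < 2 then x else φ (x - 2) + 2 :=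
  fun x => by
    induction x using Fin.cases with
    | zero => simp
    | succ i =>
      induction i using Fin.cases with
      | zero => rw [liftZero_succ, liftZero_zero]; rfl
      | succ i => simp [he i]

lemma congr {e : Fin m ≃ Fin n} {φ ψ : ℕ → ℕ} (he : HasVal e φ) (h : ∀ x < m, φ x = ψ x) :
    HasVal e ψ := fun x => by rw [he x, h _ x.isLt]

lemma ext {e f : Fin m ≃ Fin n} {φ ψ : ℕ → ℕ} (he : HasVal e φ) (hf : HasVal f ψ)
    (h : ∀ x < m, φ x = ψ x) : e = f :=
  Equiv.ext fun x => Fin.ext (by rw [he, hf, h _ x.isLt])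

end HasVal

@[simp] lemma juxtapose_castAdd (e : Fin m ≃ Fin m') (f : Fin n ≃ Fin n') (i : Fin m) :
    juxtapose e f (Fin.castAdd n i) = Fin.castAdd n' (e i) := by
  simp [juxtapose]

@[simp] lemma juxtapose_natAdd (e : Fin m ≃ Fin m') (f : Fin n ≃ Fin n') (i : Fin n) :
    juxtapose e f (Fin.natAdd m i) = Fin.natAdd m' (f i) := by
  simp [juxtapose]

@[simp] lemma juxtapose_symm (e : Fin m ≃ Fin m') (f : Fin n ≃ Fin n') :
    (juxtapose e f).symm = juxtapose e.symm f.symm := rfl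

lemma juxtapose_one (m n : ℕ) :
    juxtapose (1 : Equiv.Perm (Fin m)) (1 : Equiv.Perm (Fin n)) = 1 := by
  ext x
  induction x using Fin.addCases <;> simp

lemma hasVal_juxtapose {e : Fin m ≃ Fin m'} {f : Fin n ≃ Fin n'} {φ ψ : ℕ → ℕ}
    (he : HasVal e φ) (hf : HasVal f ψ) :
    HasVal (juxtapose e f) fun x => if x < m then φ x else m' + ψ (x - m) := fun x => by
  induction x using Fin.addCases with
  | left i => simp [he i]
  | right i => simp [hf i]

lemma hasVal_refl (n : ℕ) : HasVal (Equiv.refl (Fin n)) id := fun _ => rfl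

lemma hasVal_finCongr (h : m = n) : HasVal (finCongr h) id := fun _ => rfl

lemma hasVal_pullLeft (m n r : ℕ) : HasVal (pullLeft m n r) id := fun _ => rfl

lemma hasVal_cycleRange (a : Fin n) :
    HasVal (Fin.cycleRange a)
      fun x => if x < a.val then x + 1 else if x = a.val then 0 else x := fun x => by
  have : NeZero n := ⟨by have := a.isLt; omega⟩
  dsimp only
  rcases lt_trichotomy x.val a.val with h | h | h
  · rw [if_pos h, Fin.coe_cycleRange_of_lt (Fin.lt_def.2 h)]
  · rw [if_neg (by omega), if_pos h, Fin.cycleRange_of_eq (Fin.ext h)]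
    rfl
  · rw [if_neg (by omega), if_neg (by omega), Fin.cycleRange_of_gt (Fin.lt_def.2 h)]

lemma hasVal_pullRight (m n : ℕ) :
    HasVal (pullRight m n) fun x => if x < m then x + 1 else if x = m then 0 else x :=
  hasVal_cycleRange (⟨m, by omega⟩ : Fin (m + n + 1))

lemma hasVal_bringFront (m n : ℕ) :
    HasVal (bringFront m n) fun x => if x = 0 then 0 else if x < m + 1 then x + 1 else
        if x = m + 1 then 1 else x := fun x => by
  refine ((hasVal_pullLeft m (n + 1) 1).trans (hasVal_pullRight m n).liftZero x).trans ?_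
  simp only [id]
  grind

lemma hasVal_finAddFlip (m n : ℕ) :
    HasVal (finAddFlip : Fin (m + n) ≃ Fin (n + m))
      fun x => if x < m then n + x else x - m := fun x => by
  induction x using Fin.addCases <;> simp

lemma hasVal_swap (a b : Fin n) :
    HasVal (Equiv.swap a b)
      fun x => if x = a.val then b.val else if x = b.val then a.val else x := fun x => by
  rw [Equiv.swap_apply_def]
  simp only [Fin.ext_iff]
  split_ifs <;> rfl

lemma hasVal_swap_zero_one (n : ℕ) :
    HasVal (Equiv.swap 0 1 : Equiv.Perm (Fin (n + 2)))
      fun x => if x = 0 then 1 else if x = 1 then 0 else x :=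
  hasVal_swap 0 1

/-- The exchange of the labels `0`, `1` with the labels `2`, `3`. -/
def swapPairs (n : ℕ) : Equiv.Perm (Fin (n + 2 + 2)) := Equiv.swap 0 2 * Equiv.swap 1 3

lemma hasVal_swapPairs (n : ℕ) :
    HasVal (swapPairs n)
      fun x => if x = 0 then 2 else if x = 1 then 3 else if x = 2 then 0 else
        if x = 3 then 1 else x := fun x => by
  rw [swapPairs, Equiv.Perm.mul_apply, hasVal_swap _ _ _, hasVal_swap _ _ _]
  simp only [show (0 : Fin (n + 2 + 2)).val = 0 from rfl,
    show (1 : Fin (n + 2 + 2)).val = 1 from rfl, show (2 : Fin (n + 2 + 2)).val = 2 from rfl,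
    show (3 : Fin (n + 2 + 2)).val = 3 from rfl]
  grind

lemma hasVal_cycleRange_two (n : ℕ) :
    HasVal (Fin.cycleRange (2 : Fin (n + 3)))
      fun x => if x < 2 then x + 1 else if x = 2 then 0 else x :=
  hasVal_cycleRange 2

end Values

/-! ### Relabellings that occur in the axioms -/

section Relabellings

/-- In a row of `m` labels followed by `n + 2` labels, bring the first two labels of the second
block to the front. -/
def pullRightTwo (m n : ℕ) : Fin (m + (n + 2)) ≃ Fin (m + n + 2) :=
  (pullRight m (n + 1)).trans (liftZero (pullRight m n))

lemma hasVal_pullRightTwo (m n : ℕ) :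
    HasVal (pullRightTwo m n) fun x => if x < m then x + 2 else
      if x < m + 2 then x - m else x := fun x => by
  refine ((hasVal_pullRight m (n + 1)).trans (hasVal_pullRight m n).liftZero x).trans ?_
  dsimp only
  grind

@[simp] lemma bringFront_left_zero (m n : ℕ) : bringFront m n (Fin.castAdd (n + 1) 0) = 0 :=
  Fin.ext (by simp [hasVal_bringFront m n _])

@[simp] lemma bringFront_left_succ (m n : ℕ) (i : Fin m) :
    bringFront m n (Fin.castAdd (n + 1) i.succ) = (Fin.castAdd n i).succ.succ :=
  Fin.ext (by simp [hasVal_bringFront m n _])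

@[simp] lemma bringFront_right_zero (m n : ℕ) :
    bringFront m n (Fin.natAdd (m + 1) 0) = Fin.succ 0 :=
  Fin.ext (by simp [hasVal_bringFront m n _])

@[simp] lemma bringFront_right_succ (m n : ℕ) (i : Fin n) :
    bringFront m n (Fin.natAdd (m + 1) i.succ) = (Fin.natAdd m i).succ.succ :=
  Fin.ext (by
    simp only [hasVal_bringFront m n _, Fin.val_natAdd, Fin.val_succ]
    grind)

lemma juxtapose_liftZero_bringFront {m m' n n' : ℕ} (e : Fin m ≃ Fin m') (f : Fin n ≃ Fin n') :
    (juxtapose (liftZero e) (liftZero f)).trans (bringFront m' n') =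
      (bringFront m n).trans (liftZero (liftZero (juxtapose e f))) := by
  ext x
  rw [Equiv.trans_apply, Equiv.trans_apply]
  induction x using Fin.addCases with
  | left x => induction x using Fin.cases <;> simp
  | right x =>
    induction x using Fin.cases with
    | zero =>
      rw [juxtapose_natAdd, bringFront_right_zero, liftZero_zero, liftZero_succ, liftZero_zero,
        bringFront_right_zero]
    | succ i => simp

lemma finAddFlip_bringFront (m n : ℕ) :
    finAddFlip.trans (bringFront n m) =
      ((bringFront m n).trans (liftZero (liftZero finAddFlip))).trans (Equiv.swap 0 1) := by
  have a : HasVal ((bringFront m n).trans (liftZero (liftZero (finAddFlip : Fin (m + n) ≃ _))))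
      fun x => if x = 0 then 0 else if x = m + 1 then 1 else
        if x < m + 1 then n + (x - 1) + 2 else x - m :=
    ((hasVal_bringFront m n).trans (hasVal_finAddFlip m n).liftTwo).congr
      fun x hx => by grind
  refine ((hasVal_finAddFlip (m + 1) (n + 1)).trans (hasVal_bringFront n m)).ext
    (a.trans (hasVal_swap_zero_one (n + m))) fun x hx => ?_
  grind

/-- With two edges between two vertices, exchanging the roles of the edges exchanges the two pairs
of labels that are contracted. -/
lemma bringFront_double (m n : ℕ) :
    ((juxtapose (Equiv.swap 0 1) (Equiv.swap 0 1)).trans (bringFront (m + 1) (n + 1))).trans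
        (liftZero (liftZero (bringFront m n))) =
      ((bringFront (m + 1) (n + 1)).trans (liftZero (liftZero (bringFront m n)))).trans
        (swapPairs _) := by
  have a : HasVal (liftZero (liftZero (bringFront m n)))
      fun x => if x < 3 then x else if x < m + 3 then x + 1 else if x = m + 3 then 3 else x :=
    (hasVal_bringFront m n).liftTwo.congr fun x hx => by grind
  have b : HasVal ((bringFront (m + 1) (n + 1)).trans (liftZero (liftZero (bringFront m n))))
      fun x => if x = 0 then 0 else if x = 1 then 2 else if x < m + 2 then x + 2 else
        if x = m + 2 then 1 else if x = m + 3 then 3 else x :=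
    ((hasVal_bringFront (m + 1) (n + 1)).trans a).congr fun x hx => by grind
  have c : HasVal (juxtapose (Equiv.swap 0 1 : Equiv.Perm (Fin (m + 2)))
      (Equiv.swap 0 1 : Equiv.Perm (Fin (n + 2))))
      fun x => if x = 0 then 1 else if x = 1 then 0 else if x = m + 2 then m + 3 else
        if x = m + 3 then m + 2 else x :=
    (hasVal_juxtapose (hasVal_swap_zero_one m) (hasVal_swap_zero_one n)).congr
      fun x hx => by grind
  rw [Equiv.trans_assoc]
  refine (c.trans b).ext (b.trans (hasVal_swapPairs (m + n))) fun x hx => ?_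
  grind

/-- With a loop and an edge, contracting them in the other order exchanges the two pairs of labels
that are contracted. -/
lemma bringFront_loop (m n : ℕ) :
    ((juxtapose (Fin.cycleRange 2) (Equiv.refl (Fin (n + 1)))).trans (bringFront (m + 2) n)).trans
        (liftZero (liftZero (pullLeft m n 2))) =
      ((pullLeft (m + 1) (n + 1) 2).trans (liftZero (liftZero (bringFront m n)))).trans
        (swapPairs _) := by
  have a : HasVal (liftZero (liftZero (bringFront m n)))
      fun x => if x < 3 then x else if x < m + 3 then x + 1 else if x = m + 3 then 3 else x :=
    (hasVal_bringFront m n).liftTwo.congr fun x hx => by grind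
  have b : HasVal (liftZero (liftZero (pullLeft m n 2))) id :=
    (hasVal_pullLeft m n 2).liftTwo.congr fun x hx => by simp only [id]; grind
  have c : HasVal (juxtapose (Fin.cycleRange (2 : Fin (m + 3))) (Equiv.refl (Fin (n + 1))))
      fun x => if x < 2 then x + 1 else if x = 2 then 0 else x :=
    (hasVal_juxtapose (hasVal_cycleRange_two m) (hasVal_refl (n + 1))).congr
      fun x hx => by simp only [id]; grind
  refine ((c.trans (hasVal_bringFront (m + 2) n)).trans b).ext
    (((hasVal_pullLeft (m + 1) (n + 1) 2).trans a).trans (hasVal_swapPairs (m + n)))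
    fun x hx => ?_
  simp only [id]
  grind

/-- The two ways of bringing the four labels of a path of two edges to the front differ by the
exchange of the two pairs of labels that are contracted. -/
lemma bringFront_path (l m n : ℕ) :
    ((((juxtapose ((bringFront l (m + 1)).trans (liftZero (liftZero (pullRight l m))))
      (Equiv.refl (Fin (n + 1)))).trans (pullLeft (l + m + 1) (n + 1) 2)).trans
        (liftZero (liftZero (bringFront (l + m) n)))).trans
          (liftZero (liftZero (liftZero (liftZero (finCongr (add_assoc l m n))))))) =
      ((((finCongr (add_assoc (l + 1) (m + 2) (n + 1))).trans
        (juxtapose (Equiv.refl (Fin (l + 1)))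
          (((juxtapose (Equiv.swap 0 1) (Equiv.refl (Fin (n + 1)))).trans
            (bringFront (m + 1) n)).trans (liftZero (liftZero (pullLeft m n 1)))))).trans
              (pullRightTwo (l + 1) (m + n + 1))).trans
                (liftZero (liftZero (bringFront l (m + n))))).trans
                  (swapPairs _) := by
  have a₁ : HasVal ((bringFront l (m + 1)).trans (liftZero (liftZero (pullRight l m))))
      fun x => if x = 0 then 0 else if x < l + 1 then x + 2 else if x = l + 1 then 1 else
        if x = l + 2 then 2 else x :=
    ((hasVal_bringFront l (m + 1)).trans (hasVal_pullRight l m).liftTwo).congr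
      fun x hx => by grind
  have a₂ : HasVal (juxtapose ((bringFront l (m + 1)).trans (liftZero (liftZero (pullRight l m))))
      (Equiv.refl (Fin (n + 1))))
      fun x => if x = 0 then 0 else if x < l + 1 then x + 2 else if x = l + 1 then 1 else
        if x = l + 2 then 2 else x :=
    (hasVal_juxtapose a₁ (hasVal_refl (n + 1))).congr
      fun x hx => by simp only [id]; grind
  have a₃ : HasVal (liftZero (liftZero (bringFront (l + m) n)))
      fun x => if x < 3 then x else if x < l + m + 3 then x + 1 else
        if x = l + m + 3 then 3 else x :=
    (hasVal_bringFront (l + m) n).liftTwo.congr fun x hx => by grind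
  have a₄ : HasVal (liftZero (liftZero (liftZero (liftZero (finCongr (add_assoc l m n)))))) id :=
    (hasVal_finCongr (add_assoc l m n)).liftTwo.liftTwo.congr
      fun x hx => by simp only [id]; grind
  have b₁ : HasVal (liftZero (liftZero (pullLeft m n 1))) id :=
    (hasVal_pullLeft m n 1).liftTwo.congr fun x hx => by simp only [id]; grind
  have b₂ : HasVal (juxtapose (Equiv.swap 0 1 : Equiv.Perm (Fin (m + 2)))
      (Equiv.refl (Fin (n + 1))))
      fun x => if x = 0 then 1 else if x = 1 then 0 else x :=
    (hasVal_juxtapose (hasVal_swap_zero_one m) (hasVal_refl (n + 1))).congr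
      fun x hx => by simp only [id]; grind
  have b₃ : HasVal (((juxtapose (Equiv.swap 0 1) (Equiv.refl (Fin (n + 1)))).trans
      (bringFront (m + 1) n)).trans (liftZero (liftZero (pullLeft m n 1))))
      fun x => if x = 0 then 2 else if x = 1 then 0 else if x < m + 2 then x + 1 else
        if x = m + 2 then 1 else x :=
    ((b₂.trans (hasVal_bringFront (m + 1) n)).trans b₁).congr
      fun x hx => by simp only [id]; grind
  have b₄ : HasVal ((finCongr (add_assoc (l + 1) (m + 2) (n + 1))).trans
      (juxtapose (Equiv.refl (Fin (l + 1))) (((juxtapose (Equiv.swap 0 1)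
        (Equiv.refl (Fin (n + 1)))).trans (bringFront (m + 1) n)).trans
          (liftZero (liftZero (pullLeft m n 1))))))
      fun x => if x < l + 1 then x else if x = l + 1 then l + 3 else if x = l + 2 then l + 1 else
        if x < l + m + 3 then x + 1 else if x = l + m + 3 then l + 2 else x :=
    ((hasVal_finCongr (add_assoc (l + 1) (m + 2) (n + 1))).trans
      (hasVal_juxtapose (hasVal_refl (l + 1)) b₃)).congr
      fun x hx => by simp only [id]; grind
  have b₅ : HasVal (liftZero (liftZero (bringFront l (m + n))))
      fun x => if x < 3 then x else if x < l + 3 then x + 1 else if x = l + 3 then 3 else x :=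
    (hasVal_bringFront l (m + n)).liftTwo.congr fun x hx => by grind
  have b₆ := (b₄.trans (hasVal_pullRightTwo (l + 1) (m + n + 1))).congr
    (ψ := fun x => if x < l + 1 then x + 2 else if x = l + 1 then l + 3 else
      if x = l + 2 then 0 else if x < l + m + 3 then x + 1 else if x = l + m + 3 then 1 else x)
    fun x hx => by grind
  have b₇ := (b₆.trans b₅).congr
    (ψ := fun x => if x = 0 then 2 else if x < l + 1 then x + 3 else if x = l + 1 then 3 else
      if x = l + 2 then 0 else if x < l + m + 3 then x + 1 else if x = l + m + 3 then 1 else x)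
    fun x hx => by grind
  have a₅ := ((a₂.trans (hasVal_pullLeft (l + m + 1) (n + 1) 2)).trans a₃).congr
    (ψ := fun x => if x = 0 then 0 else if x < l + 1 then x + 3 else
      if x = l + 1 then 1 else if x = l + 2 then 2 else if x < l + m + 3 then x + 1 else
        if x = l + m + 3 then 3 else x)
    fun x hx => by simp only [id]; grind
  refine (a₅.trans a₄).ext (b₇.trans (hasVal_swapPairs (l + (m + n)))) fun x hx => ?_
  simp only [id]
  grind

end Relabellings

/-! ### The structure maps on tensor words -/

section Words

variable (k : Type u) [Field k] {p q : ℕ}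

/-- The parities of the letters of a word of elementary matrices. -/
def letterPar {n : ℕ} (a : Fin n → Idx p q × Idx p q) : Fin n ⊕ Fin n → ZMod 2 :=
  Sum.elim (fun t => par (a t).1) (fun t => par (a t).2)

/-- The word in which the letters `u` have been moved by `e₁` and the dual letters by `e₂`. -/
def moveLetters {m n : ℕ} (e₁ e₂ : Fin m ≃ Fin n) (a : Fin m → Idx p q × Idx p q) :
    Fin n → Idx p q × Idx p q :=
  fun t => ((a (e₁.symm t)).1, (a (e₂.symm t)).2)

lemma letterPar_moveLetters {m n : ℕ} (e₁ e₂ : Fin m ≃ Fin n) (a : Fin m → Idx p q × Idx p q) :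
    letterPar (moveLetters e₁ e₂ a) = letterPar a ∘ (Equiv.sumCongr e₁ e₂).symm := by
  ext (i | i) <;> rfl

variable (p q)

/-- The operator `End(U)^{⊗ m} → End(U)^{⊗ n}` that moves the letters `u` by `e₁` and the dual
letters by `e₂`, with the Koszul sign. -/
def letterAct {m n : ℕ} (e₁ e₂ : Fin m ≃ Fin n) : EndPow k p q m →ₗ[k] EndPow k p q n :=
  (elemBasis k p q m).constr k fun a =>
    (sgn (letterExp e₁ e₂ (letterPar a)) : k) • elemBasis k p q n (moveLetters e₁ e₂ a)

/-- The supertrace of the first tensor factor. -/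
def firstTrace (n : ℕ) : EndPow k p q (n + 1) →ₗ[k] EndPow k p q n :=
  (elemBasis k p q (n + 1)).constr k fun a =>
    superTrace (elem k (a 0)) • elemBasis k p q n (fun i => a i.succ)

/-- The identity of `U^{⊗ n}`, as an element of `End(U)^{⊗ n}`. -/
def idTensor (n : ℕ) : EndPow k p q n :=
  ∑ α : Fin n → Idx p q, elemBasis k p q n fun t => (α t, α t)

variable {k p q}

lemma letterAct_basis {m n : ℕ} (e₁ e₂ : Fin m ≃ Fin n) (a : Fin m → Idx p q × Idx p q) :
    letterAct k p q e₁ e₂ (elemBasis k p q m a) =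
      (sgn (letterExp e₁ e₂ (letterPar a)) : k) • elemBasis k p q n (moveLetters e₁ e₂ a) :=
  Basis.constr_basis ..

lemma firstTrace_basis {n : ℕ} (a : Fin (n + 1) → Idx p q × Idx p q) :
    firstTrace k p q n (elemBasis k p q (n + 1) a) =
      superTrace (elem k (a 0)) • elemBasis k p q n (fun i => a i.succ) :=
  Basis.constr_basis ..

lemma endAct_basis {m n : ℕ} (e : Fin m ≃ Fin n) (a : Fin m → Idx p q × Idx p q) :
    endAct k p q e (elemBasis k p q m a) =
      (koszulSign e (fun i => parE (a i)) : k) • elemBasis k p q n (fun i => a (e.symm i)) := by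
  rw [endAct, Basis.constr_basis]
  exact (Int.cast_smul_eq_zsmul k _ _).symm

lemma endContr_basis {n : ℕ} (a : Fin (n + 2) → Idx p q × Idx p q) :
    endContr k p q n (elemBasis k p q (n + 2) a) =
      superTrace (elem k (a 0) * elem k (a 1)) • elemBasis k p q n (fun i => a i.succ.succ) :=
  Basis.constr_basis ..

lemma endProd_basis {m n : ℕ} (a : Fin m → Idx p q × Idx p q) (b : Fin n → Idx p q × Idx p q) :
    endProd k p q m n (elemBasis k p q m a) (elemBasis k p q n b) =
      elemBasis k p q (m + n) (Fin.append a b) := by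
  unfold endProd
  rw [Basis.constr_basis, Basis.constr_basis]

lemma permTensor_single {n : ℕ} (σ : Equiv.Perm (Fin n)) :
    permTensor k p q n (MonoidAlgebra.single σ 1) =
      ∑ α : Fin n → Idx p q, (sgn (letterExp σ 1 (Sum.elim (fun t => par (α t))
        (fun t => par (α t)))) : k) • elemBasis k p q n (fun t => (α (σ.symm t), α t)) := by
  have h : MonoidAlgebra.single σ (1 : k) = MonoidAlgebra.basis (Equiv.Perm (Fin n)) k σ := by
    simp
  rw [h, permTensor, Basis.constr_basis]
  refine Finset.sum_congr rfl fun α _ => ?_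
  rw [permTensor_sign σ fun t => par (α t)]
  exact (Int.cast_smul_eq_zsmul k _ _).symm

lemma superTrace_elem (a : Idx p q × Idx p q) :
    superTrace (elem k a) = if a.1 = a.2 then (sgn (par a.1) : k) else 0 := by
  obtain ⟨i, j⟩ := a
  unfold superTrace elem
  rw [Matrix.stdBasis_eq_single]
  simp only [Matrix.single_apply]
  by_cases h : i = j
  · subst h
    simp
  · rw [if_neg h]
    refine Finset.sum_eq_zero fun l _ => ?_
    rw [if_neg (fun hl => h (hl.1.trans hl.2.symm)), mul_zero]

lemma superTrace_elem_mul (a b : Idx p q × Idx p q) :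
    superTrace (elem k a * elem k b) =
      if a.2 = b.1 ∧ a.1 = b.2 then (sgn (par a.1) : k) else 0 := by
  obtain ⟨i, j⟩ := a
  obtain ⟨i', j'⟩ := b
  by_cases h : j = i'
  · subst h
    have h : elem k (i, j) * elem k (j, j') = elem k (i, j') := by
      unfold elem
      rw [Matrix.stdBasis_eq_single, Matrix.stdBasis_eq_single, Matrix.stdBasis_eq_single,
        Matrix.single_mul_single_same, one_mul]
    rw [h, superTrace_elem]
    simp
  · have h' : elem k (i, j) * elem k (i', j') = 0 := by
      unfold elem
      rw [Matrix.stdBasis_eq_single, Matrix.stdBasis_eq_single,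
        Matrix.single_mul_single_of_ne _ _ _ _ h]
    rw [h', if_neg (fun hh => h hh.1)]
    simp [superTrace]

/-- The pairing `str(E_a E_b)` vanishes unless `E_a` and `E_b` have the same parity. -/
lemma parE_add_of_superTrace_ne_zero {a b : Idx p q × Idx p q}
    (h : superTrace (elem k a * elem k b) ≠ 0) : parE a + parE b = 0 := by
  rw [superTrace_elem_mul] at h
  split_ifs at h with h'
  · unfold parE
    rw [h'.1, h'.2, add_comm (par b.2), CharTwo.add_self_eq_zero]
  · exact absurd rfl h

/-- Supersymmetry of the supertrace pairing. -/
lemma superTrace_elem_mul_comm (a b : Idx p q × Idx p q) :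
    superTrace (elem k b * elem k a) =
      (sgn (parE a * parE b) : k) * superTrace (elem k a * elem k b) := by
  simp only [superTrace_elem_mul]
  by_cases h : a.2 = b.1 ∧ a.1 = b.2
  · rw [if_pos h, if_pos ⟨h.2.symm, h.1.symm⟩, ← Int.cast_mul, ← sgn_add]
    congr 2
    unfold parE
    rw [h.1, h.2]
    generalize par b.1 = x
    generalize par b.2 = y
    revert x y
    decide
  · rw [if_neg h, if_neg (fun h' => h ⟨h'.2.symm, h'.1.symm⟩), mul_zero]

/-- Relabelling moves both letters of a slot together: since the letters of a slot are adjacent, the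
Koszul signs agree. -/
lemma endAct_eq_letterAct {m n : ℕ} (e : Fin m ≃ Fin n) :
    endAct k p q e = letterAct k p q e e := by
  refine (elemBasis k p q m).ext fun a => ?_
  rw [endAct_basis, letterAct_basis, letterExp_diag, koszulSign_eq]
  rfl

lemma letterAct_refl {n : ℕ} (x : EndPow k p q n) :
    letterAct k p q (Equiv.refl _) (Equiv.refl _) x = x := by
  suffices h : letterAct k p q (Equiv.refl (Fin n)) (Equiv.refl _) = LinearMap.id by
    rw [h, LinearMap.id_apply]
  refine (elemBasis k p q n).ext fun a => ?_
  rw [letterAct_basis, letterExp_refl, sgn_zero, Int.cast_one, one_smul]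
  rfl

lemma letterAct_trans {l m n : ℕ} (e₁ e₂ : Fin l ≃ Fin m) (f₁ f₂ : Fin m ≃ Fin n)
    (x : EndPow k p q l) :
    letterAct k p q (e₁.trans f₁) (e₂.trans f₂) x =
      letterAct k p q f₁ f₂ (letterAct k p q e₁ e₂ x) := by
  suffices h : letterAct k p q (e₁.trans f₁) (e₂.trans f₂) =
      letterAct k p q f₁ f₂ ∘ₗ letterAct k p q e₁ e₂ by
    rw [h, LinearMap.comp_apply]
  refine (elemBasis k p q l).ext fun a => ?_
  rw [LinearMap.comp_apply, letterAct_basis, letterAct_basis, map_smul, letterAct_basis,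
    letterExp_trans, sgn_add, Int.cast_mul, mul_smul, letterPar_moveLetters]
  rfl

/-- The tensor `μ(σ)` arises from the identity by moving only the letters `u`. -/
lemma permTensor_eq_letterAct {n : ℕ} (σ : Equiv.Perm (Fin n)) :
    permTensor k p q n (MonoidAlgebra.single σ 1) = letterAct k p q σ 1 (idTensor k p q n) := by
  rw [permTensor_single, idTensor, map_sum]
  refine Finset.sum_congr rfl fun α _ => ?_
  rw [letterAct_basis]
  rfl

/-- The supertrace of the first slot commutes with permutations of the letters of the other
slots. -/
lemma letterAct_liftZero {m n : ℕ} (e₁ e₂ : Fin m ≃ Fin n) (x : EndPow k p q (m + 1)) :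
    firstTrace k p q n (letterAct k p q (liftZero e₁) (liftZero e₂) x) =
      letterAct k p q e₁ e₂ (firstTrace k p q m x) := by
  suffices h : firstTrace k p q n ∘ₗ letterAct k p q (liftZero e₁) (liftZero e₂) =
      letterAct k p q e₁ e₂ ∘ₗ firstTrace k p q m from LinearMap.congr_fun h x
  refine (elemBasis k p q (m + 1)).ext fun a => ?_
  have h₀ : moveLetters (liftZero e₁) (liftZero e₂) a 0 = a 0 := by simp [moveLetters]
  have h₁ : (fun i : Fin n => moveLetters (liftZero e₁) (liftZero e₂) a i.succ) =
      moveLetters e₁ e₂ fun i => a i.succ := by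
    ext t <;> simp [moveLetters]
  have h₂ : letterPar a ∘ Sum.map Fin.succ Fin.succ = letterPar fun i : Fin m => a i.succ := by
    ext (i | i) <;> rfl
  simp only [LinearMap.comp_apply, letterAct_basis, firstTrace_basis, map_smul,
    letterExp_liftZero, h₀, h₁, h₂]
  rw [smul_comm]

lemma letterExp_swap_one {n : ℕ} (d : Fin (n + 2) ⊕ Fin (n + 2) → ZMod 2) :
    letterExp (Equiv.swap 0 1) 1 d =
      d (.inl 0) * d (.inl 1) + d (.inl 0) * d (.inr 0) + d (.inr 0) * d (.inl 1) := by
  have h10 : ¬ (1 : Fin (n + 2)) < 0 := Fin.not_lt_zero _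
  have h01 : (0 : Fin (n + 2)) < 1 := Fin.mk_lt_mk.2 (by simp)
  have h0 : ∀ i : Fin n, (0 : Fin (n + 2)) < i.succ.succ := fun i => Fin.succ_pos _
  have h1 : ∀ i : Fin n, (1 : Fin (n + 2)) < i.succ.succ := fun i => by
    simp [Fin.lt_def]
  have hl : ∀ i j : Fin n, ¬ (i < j ∧ j < i) := fun i j => by omega
  have hl' : ∀ i j : Fin n, ¬ (i ≤ j ∧ j < i) := fun i j => by omega
  have hl'' : ∀ i j : Fin n, ¬ (i < j ∧ j ≤ i) := fun i j => by omega
  simp only [letterExp_sum, Fin.sum_univ_succ, Fin.succ_zero_eq_one, Equiv.swap_apply_left,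
    Equiv.swap_apply_right, swap_zero_one_succ_succ, Equiv.Perm.one_apply]
  simp [h10, h01, h0, h1, (h0 _).not_gt, (h1 _).not_gt, (h0 _).not_ge, (h1 _).not_ge, h01.not_ge,
    hl, hl', hl'']
  ring

/-- The contraction is the double supertrace after the transposition of the letters `u` of the
slots `0` and `1`. -/
lemma endContr_eq {n : ℕ} (x : EndPow k p q (n + 2)) :
    endContr k p q n x =
      firstTrace k p q n (firstTrace k p q (n + 1) (letterAct k p q (Equiv.swap 0 1) 1 x)) := by
  suffices h : endContr k p q n =
      firstTrace k p q n ∘ₗ firstTrace k p q (n + 1) ∘ₗ letterAct k p q (Equiv.swap 0 1) 1 from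
    LinearMap.congr_fun h x
  refine (elemBasis k p q (n + 2)).ext fun a => ?_
  have ht : (fun i : Fin n => moveLetters (Equiv.swap 0 1) 1 a i.succ.succ) =
      fun i => a i.succ.succ := by
    ext i <;> simp [moveLetters, swap_zero_one_succ_succ, Equiv.Perm.one_def]
  simp only [LinearMap.comp_apply, endContr_basis, letterAct_basis, firstTrace_basis, map_smul, ht,
    letterExp_swap_one, superTrace_elem, superTrace_elem_mul]
  rw [smul_smul, smul_smul]
  congr 1
  simp only [moveLetters, letterPar, Sum.elim_inl, Sum.elim_inr, Equiv.symm_swap,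
    Equiv.swap_apply_left, Equiv.swap_apply_right, Fin.succ_zero_eq_one, Equiv.Perm.one_def,
    Equiv.refl_symm, Equiv.refl_apply]
  by_cases h : (a 0).2 = (a 1).1 ∧ (a 0).1 = (a 1).2
  · rw [if_pos h, if_pos h.1.symm, if_pos h.2, h.1, h.2, ← Int.cast_mul, ← Int.cast_mul, ← sgn_add,
      ← sgn_add]
    congr 2
    generalize par (a 1).1 = x
    generalize par (a 1).2 = y
    revert x y
    decide
  · rw [if_neg h]
    by_cases h' : (a 0).2 = (a 1).1
    · rw [if_neg fun h'' => h ⟨h', h''⟩, mul_zero]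
    · rw [if_neg (fun h'' => h' h''.symm), mul_zero, zero_mul]

end Words

/-! ### Relabelling, contraction and product of tensor words -/

section EndOperad

variable {k : Type u} [Field k] {p q : ℕ}

lemma koszulSign_of_hasVal {m n : ℕ} {e : Fin m ≃ Fin n} {φ : ℕ → ℕ} (h : HasVal e φ)
    (d : Fin m → ZMod 2) :
    koszulSign e d = sgn (∑ i : Fin m, ∑ j : Fin m,
      if i.val < j.val ∧ φ j.val < φ i.val then d i * d j else 0) := by
  rw [koszulSign_eq]
  unfold koszulExp
  simp only [h _]

lemma koszulSign_of_monotone {m n : ℕ} {e : Fin m ≃ Fin n} (h : HasVal e id)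
    (d : Fin m → ZMod 2) : koszulSign e d = 1 := by
  rw [koszulSign_of_hasVal h, Finset.sum_eq_zero, sgn_zero]
  intro i _
  refine Finset.sum_eq_zero fun j _ => if_neg ?_
  simp only [id]
  omega

lemma koszulSign_swap_zero_one {n : ℕ} (d : Fin (n + 2) → ZMod 2) :
    koszulSign (Equiv.swap 0 1) d = sgn (d 0 * d 1) := by
  rw [koszulSign_of_hasVal (hasVal_swap_zero_one n)]
  congr 1
  simp only [Fin.sum_univ_succ, Fin.val_zero, Fin.val_succ]
  have hl : ∀ i j : Fin n, ¬ (i < j ∧ j < i) := fun i j => by omega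
  simp [hl]

lemma koszulSign_swapPairs {n : ℕ} (d : Fin (n + 2 + 2) → ZMod 2) :
    koszulSign (swapPairs n) d =
      sgn ((d 0 + d 1) * (d 2 + d 3)) := by
  rw [koszulSign_of_hasVal (hasVal_swapPairs n)]
  congr 1
  simp only [Fin.sum_univ_succ, Fin.val_zero, Fin.val_succ]
  have hl : ∀ i j : Fin n, ¬ (i < j ∧ j < i) := fun i j => by omega
  have h3 : (Fin.succ (2 : Fin (n + 3))) = 3 := rfl
  have hx : ∀ x : Fin n, ¬ (x.val + 1 + 1 + 1 + 1 < 3) := fun x => by omega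
  simp [hl, h3, hx]
  ring

lemma koszulSign_finAddFlip {m n : ℕ} (d : Fin m → ZMod 2) (d' : Fin n → ZMod 2) :
    koszulSign (finAddFlip : Fin (m + n) ≃ Fin (n + m)) (Fin.append d d') =
      sgn ((∑ i, d i) * ∑ j, d' j) := by
  rw [koszulSign_of_hasVal (hasVal_finAddFlip m n)]
  congr 1
  simp only [Fin.sum_univ_add, Fin.val_castAdd, Fin.val_natAdd, Fin.append_left, Fin.append_right,
    Fin.is_lt, if_true]
  have h1 : ∀ i j : Fin m, ¬ (i.val < j.val ∧ n + j.val < n + i.val) := fun i j => by omega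
  have h2 : ∀ (i : Fin m) (j : Fin n), (i.val < m + j.val ∧
      (if m + j.val < m then n + (m + j.val) else m + j.val - m) < n + i.val) := fun i j => by
    rw [if_neg (by omega)]; omega
  have h3 : ∀ (i : Fin n) (j : Fin m), ¬ (m + i.val < j.val ∧
      n + j.val < if m + i.val < m then n + (m + i.val) else m + i.val - m) := fun i j => by omega
  have h4 : ∀ i j : Fin n, ¬ (m + i.val < m + j.val ∧
      (if m + j.val < m then n + (m + j.val) else m + j.val - m) <
        if m + i.val < m then n + (m + i.val) else m + i.val - m) := fun i j => by
    rw [if_neg (by omega), if_neg (by omega)]; omega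
  simp only [if_neg (h1 _ _), if_pos (h2 _ _), if_neg (h3 _ _), if_neg (h4 _ _),
    Finset.sum_const_zero, zero_add, add_zero]
  rw [Finset.sum_mul_sum]

lemma koszulSign_pullRightTwo {m n : ℕ} (d : Fin m → ZMod 2) (d' : Fin (n + 2) → ZMod 2) :
    koszulSign (pullRightTwo m n) (Fin.append d d') = sgn ((∑ i, d i) * (d' 0 + d' 1)) := by
  rw [koszulSign_of_hasVal (hasVal_pullRightTwo m n)]
  congr 1
  rw [Fin.sum_univ_add, Finset.sum_mul]
  refine (add_eq_left.2 (Finset.sum_eq_zero fun i _ => Finset.sum_eq_zero fun j _ =>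
    if_neg ?_)).trans (Finset.sum_congr rfl fun i _ => ?_)
  · simp only [Fin.val_natAdd]
    grind
  · have h₁ : ∀ j : Fin m, ¬ ((Fin.castAdd (n + 2) i).val < (Fin.castAdd (n + 2) j).val ∧
        (fun x => if x < m then x + 2 else if x < m + 2 then x - m else x)
          (Fin.castAdd (n + 2) j).val <
        (fun x => if x < m then x + 2 else if x < m + 2 then x - m else x)
          (Fin.castAdd (n + 2) i).val) := fun j => by
      simp only [Fin.val_castAdd]
      grind
    have h₂ : ∀ j : Fin n, ¬ ((Fin.castAdd (n + 2) i).val < (Fin.natAdd m j.succ.succ).val ∧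
        (fun x => if x < m then x + 2 else if x < m + 2 then x - m else x)
          (Fin.natAdd m j.succ.succ).val <
        (fun x => if x < m then x + 2 else if x < m + 2 then x - m else x)
          (Fin.castAdd (n + 2) i).val) := fun j => by
      simp only [Fin.val_castAdd, Fin.val_natAdd, Fin.val_succ]
      grind
    rw [Fin.sum_univ_add, Finset.sum_eq_zero fun j _ => if_neg (h₁ j), zero_add,
      Fin.sum_univ_succ, Fin.sum_univ_succ, Finset.sum_eq_zero fun j _ => if_neg (h₂ j), add_zero]
    have hi := i.isLt
    simp [mul_add]

lemma endAct_refl {n : ℕ} (x : EndPow k p q n) : endAct k p q (Equiv.refl _) x = x := by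
  rw [endAct_eq_letterAct, letterAct_refl]

lemma endAct_trans {l m n : ℕ} (e : Fin l ≃ Fin m) (f : Fin m ≃ Fin n) (x : EndPow k p q l) :
    endAct k p q (e.trans f) x = endAct k p q f (endAct k p q e x) := by
  rw [endAct_eq_letterAct, endAct_eq_letterAct, endAct_eq_letterAct, letterAct_trans]

lemma endContr_liftZero {m n : ℕ} (e : Fin m ≃ Fin n) (x : EndPow k p q (m + 2)) :
    endContr k p q n (endAct k p q (liftZero (liftZero e)) x) =
      endAct k p q e (endContr k p q m x) := by
  simp only [endContr_eq, endAct_eq_letterAct]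
  rw [← letterAct_liftZero, ← letterAct_liftZero, ← letterAct_trans, ← letterAct_trans]
  refine congrArg _ (congrArg _ (congrArg (fun e => letterAct k p q e _ x) ?_))
  ext i
  induction i using Fin.cases with
  | zero =>
    simp only [Equiv.trans_apply, Equiv.swap_apply_left, liftZero_zero]
    rw [← Fin.succ_zero_eq_one, ← Fin.succ_zero_eq_one, liftZero_succ, liftZero_zero]
  | succ i =>
    induction i using Fin.cases with
    | zero =>
      rw [Fin.succ_zero_eq_one]
      simp only [Equiv.trans_apply, Equiv.swap_apply_right, liftZero_zero]
      have h : liftZero (liftZero e) 1 = 1 := by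
        rw [← Fin.succ_zero_eq_one, liftZero_succ, liftZero_zero, Fin.succ_zero_eq_one]
      rw [h, Equiv.swap_apply_right]
    | succ i =>
      simp [swap_zero_one_succ_succ]

lemma endContr_swap {n : ℕ} (x : EndPow k p q (n + 2)) :
    endContr k p q n (endAct k p q (Equiv.swap 0 1) x) = endContr k p q n x := by
  suffices h : endContr k p q n ∘ₗ endAct k p q (Equiv.swap 0 1) = endContr k p q n from
    LinearMap.congr_fun h x
  refine (elemBasis k p q (n + 2)).ext fun a => ?_
  simp only [LinearMap.comp_apply, endAct_basis, map_smul, endContr_basis, Equiv.symm_swap,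
    Equiv.swap_apply_left, Equiv.swap_apply_right, swap_zero_one_succ_succ,
    koszulSign_swap_zero_one]
  rw [superTrace_elem_mul_comm (a 0) (a 1), smul_smul, ← mul_assoc,
    ← Int.cast_mul, sgn_mul_self, Int.cast_one, one_mul]

/-- Contractions of two disjoint pairs of labels commute, without sign since a pair contributes
only if it is even. -/
lemma endContr_endContr {n : ℕ} (x : EndPow k p q (n + 2 + 2)) :
    endContr k p q n (endContr k p q (n + 2) (endAct k p q (swapPairs n) x)) =
      endContr k p q n (endContr k p q (n + 2) x) := by
  have hv := hasVal_swapPairs n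
  have hsign : ∀ a : Fin (n + 2 + 2) → Idx p q × Idx p q, _ :=
    fun a => koszulSign_swapPairs fun i => parE (a i)
  generalize swapPairs n = ρ at *
  suffices h : endContr k p q n ∘ₗ endContr k p q (n + 2) ∘ₗ endAct k p q ρ =
        endContr k p q n ∘ₗ endContr k p q (n + 2) from LinearMap.congr_fun h x
  refine (elemBasis k p q (n + 2 + 2)).ext fun a => ?_
  have v0 : (0 : Fin (n + 2 + 2)).val = 0 := rfl
  have v1 : (1 : Fin (n + 2 + 2)).val = 1 := rfl
  have v2 : (2 : Fin (n + 2 + 2)).val = 2 := rfl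
  have v3 : (3 : Fin (n + 2 + 2)).val = 3 := rfl
  have h0 : ρ.symm 0 = 2 := (Equiv.symm_apply_eq _).2 (Fin.ext (by rw [hv, v0, v2]; rfl))
  have h1 : ρ.symm 1 = 3 := (Equiv.symm_apply_eq _).2 (Fin.ext (by rw [hv, v1, v3]; rfl))
  have h2 : ρ.symm 2 = 0 := (Equiv.symm_apply_eq _).2 (Fin.ext (by rw [hv, v2, v0]; rfl))
  have h3 : ρ.symm 3 = 1 := (Equiv.symm_apply_eq _).2 (Fin.ext (by rw [hv, v3, v1]; rfl))
  have h4 : ∀ i : Fin n, ρ.symm i.succ.succ.succ.succ = i.succ.succ.succ.succ := fun i =>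
    (Equiv.symm_apply_eq _).2 (Fin.ext (by rw [hv]; simp))
  have e2 : (Fin.succ (Fin.succ (0 : Fin (n + 2)))) = 2 := rfl
  have e3 : (Fin.succ (Fin.succ (1 : Fin (n + 2)))) = 3 := rfl
  simp only [LinearMap.comp_apply, endAct_basis, map_smul, endContr_basis, h4, e2, e3,
    h0, h1, h2, h3, hsign]
  by_cases h : superTrace (elem k (a 0) * elem k (a 1)) = 0
  · simp [h]
  · rw [parE_add_of_superTrace_ne_zero h, zero_mul, sgn_zero, Int.cast_one, one_smul, smul_comm]

lemma letterPar_append {m n : ℕ} (a : Fin m → Idx p q × Idx p q) (b : Fin n → Idx p q × Idx p q) :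
    letterPar (Fin.append a b) = Sum.elim (Fin.append (fun t => par (a t).1) (fun t => par (b t).1))
      (Fin.append (fun t => par (a t).2) (fun t => par (b t).2)) := by
  ext (i | i) <;> induction i using Fin.addCases <;> simp [letterPar]

lemma endProd_letterAct {m m' n n' : ℕ} (e₁ e₂ : Fin m ≃ Fin m') (f₁ f₂ : Fin n ≃ Fin n')
    (x : EndPow k p q m) (y : EndPow k p q n) :
    endProd k p q m' n' (letterAct k p q e₁ e₂ x) (letterAct k p q f₁ f₂ y) =
      letterAct k p q (juxtapose e₁ f₁) (juxtapose e₂ f₂) (endProd k p q m n x y) := by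
  suffices h : (endProd k p q m' n').compl₁₂ (letterAct k p q e₁ e₂) (letterAct k p q f₁ f₂) =
      (endProd k p q m n).compr₂ (letterAct k p q (juxtapose e₁ f₁) (juxtapose e₂ f₂)) from
    LinearMap.congr_fun₂ h x y
  refine (elemBasis k p q m).ext fun a => (elemBasis k p q n).ext fun b => ?_
  have h₁ : moveLetters (juxtapose e₁ f₁) (juxtapose e₂ f₂) (Fin.append a b) =
      Fin.append (moveLetters e₁ e₂ a) (moveLetters f₁ f₂ b) := by
    ext t <;> induction t using Fin.addCases <;> simp [moveLetters]
  have h₂ : letterExp (juxtapose e₁ f₁) (juxtapose e₂ f₂) (letterPar (Fin.append a b)) =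
      letterExp e₁ e₂ (letterPar a) + letterExp f₁ f₂ (letterPar b) := by
    have c₁ : ∀ {m n : ℕ} (i : Fin m) (j : Fin n), Fin.castAdd n i < Fin.natAdd m j := fun i j =>
      Fin.lt_def.2 (by simp; omega)
    rw [letterPar_append]
    simp only [letterExp_sum, Fin.sum_univ_add, juxtapose_castAdd, juxtapose_natAdd, Sum.elim_inl,
      Sum.elim_inr, Fin.append_left, Fin.append_right, c₁, (c₁ _ _).not_gt, (c₁ _ _).not_ge,
      (c₁ _ _).le, and_false, false_and, if_false, add_zero, Finset.sum_const_zero,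
      zero_add, letterPar]
    simp only [Fin.lt_def, Fin.le_def, Fin.val_castAdd, Fin.val_natAdd, Nat.add_lt_add_iff_left,
      Nat.add_le_add_iff_left]
  simp only [LinearMap.compl₁₂_apply, LinearMap.compr₂_apply, letterAct_basis, map_smul,
    LinearMap.smul_apply, endProd_basis, h₁, h₂]
  rw [sgn_add, Int.cast_mul, mul_smul, smul_comm]

lemma endProd_endAct {m m' n n' : ℕ} (e : Fin m ≃ Fin m') (f : Fin n ≃ Fin n')
    (x : EndPow k p q m) (y : EndPow k p q n) :
    endProd k p q m' n' (endAct k p q e x) (endAct k p q f y) =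
      endAct k p q (juxtapose e f) (endProd k p q m n x y) := by
  simp only [endAct_eq_letterAct, endProd_letterAct]

variable (k p q) in
/-- The homogeneous tensors of parity `i`. -/
def endGr (n : ℕ) (i : ZMod 2) : Submodule k (EndPow k p q n) :=
  Submodule.span k {x | ∃ a : Fin n → Idx p q × Idx p q, ∑ t, parE (a t) = i ∧
    x = elemBasis k p q n a}

lemma elemBasis_mem_endGr {n : ℕ} (a : Fin n → Idx p q × Idx p q) :
    elemBasis k p q n a ∈ endGr k p q n (∑ t, parE (a t)) :=
  Submodule.subset_span ⟨a, rfl, rfl⟩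

lemma endGr_le {n : ℕ} {i : ZMod 2} {S : Submodule k (EndPow k p q n)}
    (h : ∀ a : Fin n → Idx p q × Idx p q, ∑ t, parE (a t) = i → elemBasis k p q n a ∈ S) :
    endGr k p q n i ≤ S := by
  refine Submodule.span_le.2 ?_
  rintro _ ⟨a, ha, rfl⟩
  exact h a ha

/-- Supercommutativity of the tensor product. -/
lemma endProd_comm {m n : ℕ} (i j : ZMod 2) (x : EndPow k p q m) (y : EndPow k p q n)
    (hx : x ∈ endGr k p q m i) (hy : y ∈ endGr k p q n j) :
    endProd k p q n m y x =
      (sgn (i * j) : k) • endAct k p q finAddFlip (endProd k p q m n x y) := by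
  induction hx using Submodule.span_induction with
  | zero => simp
  | add x x' _ _ hx hx' => simp only [map_add, LinearMap.add_apply, hx, hx', smul_add]
  | smul c x _ hx => simp only [map_smul, LinearMap.smul_apply, hx]; rw [smul_comm]
  | mem x hx =>
    obtain ⟨a, rfl, rfl⟩ := hx
    induction hy using Submodule.span_induction with
    | zero => simp
    | add x x' _ _ hx hx' => simp only [map_add, LinearMap.add_apply, hx, hx', smul_add]
    | smul c x _ hx => simp only [map_smul, LinearMap.smul_apply, hx]; rw [smul_comm]
    | mem y hy =>
      obtain ⟨b, rfl, rfl⟩ := hy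
      have h : (fun i => parE (Fin.append a b i)) =
          Fin.append (fun i => parE (a i)) (fun i => parE (b i)) := by
        ext t; induction t using Fin.addCases <;> simp
      rw [endProd_basis, endProd_basis, endAct_basis, h, koszulSign_finAddFlip, smul_smul,
        ← Int.cast_mul, sgn_mul_self, Int.cast_one, one_smul]
      congr 1
      funext t
      induction t using Fin.addCases with
      | left t =>
        rw [(Equiv.symm_apply_eq finAddFlip (y := Fin.natAdd m t)).2 (by simp)]
        simp
      | right t =>
        rw [(Equiv.symm_apply_eq finAddFlip (y := Fin.castAdd n t)).2 (by simp)]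
        simp

lemma endProd_assoc {l m n : ℕ} (x : EndPow k p q l) (y : EndPow k p q m) (z : EndPow k p q n) :
    endProd k p q l (m + n) x (endProd k p q m n y z) =
      endAct k p q (finCongr (add_assoc l m n))
        (endProd k p q (l + m) n (endProd k p q l m x y) z) := by
  suffices h : ((endProd k p q l (m + n)).compl₂ (endProd k p q m n y)) =
      (((endProd k p q (l + m) n).comp ((endProd k p q l m).flip y)).compr₂
        (endAct k p q (finCongr (add_assoc l m n)))) from LinearMap.congr_fun₂ h x z
  refine (elemBasis k p q l).ext fun a => (elemBasis k p q n).ext fun c => ?_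
  suffices h : (endProd k p q l (m + n) (elemBasis k p q l a)) ∘ₗ
      (endProd k p q m n).flip (elemBasis k p q n c) =
      endAct k p q (finCongr (add_assoc l m n)) ∘ₗ (endProd k p q (l + m) n).flip
        (elemBasis k p q n c) ∘ₗ endProd k p q l m (elemBasis k p q l a) from
    LinearMap.congr_fun h y
  refine (elemBasis k p q m).ext fun b => ?_
  simp only [LinearMap.comp_apply, LinearMap.flip_apply, endProd_basis, endAct_basis,
    koszulSign_of_monotone (hasVal_finCongr (add_assoc l m n)), Int.cast_one, one_smul]
  congr 1
  rw [Fin.append_assoc]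
  rfl

lemma endProd_endContr_left {m n : ℕ} (x : EndPow k p q (m + 2)) (y : EndPow k p q n) :
    endProd k p q m n (endContr k p q m x) y =
      endContr k p q (m + n) (endAct k p q (pullLeft m n 2) (endProd k p q (m + 2) n x y)) := by
  suffices h : (endProd k p q m n).comp (endContr k p q m) =
      (endProd k p q (m + 2) n).compr₂
        (endContr k p q (m + n) ∘ₗ endAct k p q (pullLeft m n 2)) from
    LinearMap.congr_fun₂ h x y
  refine (elemBasis k p q (m + 2)).ext fun a => (elemBasis k p q n).ext fun b => ?_
  simp only [LinearMap.comp_apply, LinearMap.compr₂_apply, endContr_basis, endProd_basis,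
    endAct_basis, map_smul, LinearMap.smul_apply,
    koszulSign_of_monotone (hasVal_pullLeft m n 2), Int.cast_one, one_smul]
  have h0 : (pullLeft m n 2).symm 0 = Fin.castAdd n 0 := (Equiv.symm_apply_eq _).2 rfl
  have h1 : (pullLeft m n 2).symm 1 = Fin.castAdd n 1 := (Equiv.symm_apply_eq _).2 rfl
  have h2 : (fun i : Fin (m + n) => Fin.append a b ((pullLeft m n 2).symm i.succ.succ)) =
      Fin.append (fun i => a i.succ.succ) b := by
    funext i
    induction i using Fin.addCases with
    | left i =>
      rw [show (pullLeft m n 2).symm (Fin.castAdd n i).succ.succ = Fin.castAdd n i.succ.succ from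
        (Equiv.symm_apply_eq _).2 rfl]
      simp
    | right i =>
      rw [show (pullLeft m n 2).symm (Fin.natAdd m i).succ.succ = Fin.natAdd (m + 2) i from
        (Equiv.symm_apply_eq _).2 (Fin.ext (by simp [hasVal_pullLeft m n 2 _]; omega))]
      simp
  rw [h0, h1, h2, Fin.append_left, Fin.append_left]

lemma endProd_endContr_right {m n : ℕ} (x : EndPow k p q m) (y : EndPow k p q (n + 2)) :
    endProd k p q m n x (endContr k p q n y) =
      endContr k p q (m + n) (endAct k p q (pullRightTwo m n) (endProd k p q m (n + 2) x y)) := by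
  suffices h : (endProd k p q m n).compl₂ (endContr k p q n) =
      (endProd k p q m (n + 2)).compr₂
        (endContr k p q (m + n) ∘ₗ endAct k p q (pullRightTwo m n)) from
    LinearMap.congr_fun₂ h x y
  refine (elemBasis k p q m).ext fun a => (elemBasis k p q (n + 2)).ext fun b => ?_
  have hp : (fun i => parE (Fin.append a b i)) =
      Fin.append (fun i => parE (a i)) (fun i => parE (b i)) := by
    funext t; induction t using Fin.addCases <;> simp
  have hv := hasVal_pullRightTwo m n
  have h0 : (pullRightTwo m n).symm 0 = Fin.natAdd m 0 :=
    (Equiv.symm_apply_eq _).2 (Fin.ext (by simp [hv _]))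
  have h1 : (pullRightTwo m n).symm 1 = Fin.natAdd m 1 :=
    (Equiv.symm_apply_eq _).2 (Fin.ext (by simp [hv _]))
  have h2 : (fun i : Fin (m + n) => Fin.append a b ((pullRightTwo m n).symm i.succ.succ)) =
      Fin.append a (fun i => b i.succ.succ) := by
    funext i
    induction i using Fin.addCases with
    | left i =>
      rw [(Equiv.symm_apply_eq (pullRightTwo m n) (y := Fin.castAdd (n + 2) i)).2
        (Fin.ext (by simp [hv _]))]
      simp
    | right i =>
      rw [(Equiv.symm_apply_eq (pullRightTwo m n) (y := Fin.natAdd m i.succ.succ)).2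
        (Fin.ext (by simp [hv _]; omega))]
      simp
  simp only [LinearMap.compl₂_apply, LinearMap.comp_apply, LinearMap.compr₂_apply, endContr_basis,
    endProd_basis, endAct_basis, map_smul, hp, koszulSign_pullRightTwo, h0, h1, h2,
    Fin.append_right]
  by_cases h : superTrace (elem k (b 0) * elem k (b 1)) = 0
  · simp [h]
  · rw [parE_add_of_superTrace_ne_zero h, mul_zero, sgn_zero, Int.cast_one, one_smul]

/-! ### The endomorphism modular operad -/

lemma isInternal_iff_isCompl {M : Type*} [AddCommGroup M] [Module k M]
    (A : ZMod 2 → Submodule k M) : DirectSum.IsInternal A ↔ IsCompl (A 0) (A 1) :=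
  DirectSum.isInternal_submodule_iff_isCompl A zero_ne_one (by ext i; revert i; decide)

lemma isInternal_span_basis {ι M : Type*} [AddCommGroup M] [Module k M] (b : Basis ι k M)
    (d : ι → ZMod 2) :
    DirectSum.IsInternal fun i : ZMod 2 => Submodule.span k {x | ∃ a, d a = i ∧ x = b a} := by
  have himg : ∀ i, {x | ∃ a, d a = i ∧ x = b a} = b '' {a | d a = i} := fun i => by
    ext x
    simp only [Set.mem_ofPred_eq, Set.mem_image]
    exact exists_congr fun a => and_congr_right fun _ => eq_comm
  rw [isInternal_iff_isCompl]
  constructor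
  · rw [himg, himg]
    refine b.linearIndependent.disjoint_span_image (Set.disjoint_left.2 fun a h₀ h₁ => ?_)
    rw [Set.mem_ofPred_eq] at h₀ h₁
    exact absurd (h₀.symm.trans h₁) (by decide)
  · rw [codisjoint_iff, ← Submodule.span_union, himg, himg, ← Set.image_union, eq_top_iff,
      ← b.span_eq]
    refine Submodule.span_mono ?_
    rintro _ ⟨a, rfl⟩
    exact ⟨a, zmod_two_cases _, rfl⟩

lemma endAct_mem_gr {m n : ℕ} (e : Fin m ≃ Fin n) (i : ZMod 2) (x : EndPow k p q m)
    (hx : x ∈ endGr k p q m i) : endAct k p q e x ∈ endGr k p q n i := by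
  refine endGr_le (S := (endGr k p q n i).comap (endAct k p q e)) ?_ hx
  rintro a rfl
  rw [Submodule.mem_comap, endAct_basis, ← e.symm.sum_comp]
  exact Submodule.smul_mem _ _ (elemBasis_mem_endGr _)

lemma endContr_mem_gr {n : ℕ} (i : ZMod 2) (x : EndPow k p q (n + 2))
    (hx : x ∈ endGr k p q (n + 2) i) : endContr k p q n x ∈ endGr k p q n i := by
  refine endGr_le (S := (endGr k p q n i).comap (endContr k p q n)) ?_ hx
  rintro a rfl
  rw [Submodule.mem_comap, endContr_basis]
  by_cases h : superTrace (elem k (a 0) * elem k (a 1)) = 0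
  · rw [h, zero_smul]
    exact zero_mem _
  · rw [Fin.sum_univ_succ, Fin.sum_univ_succ, ← add_assoc, Fin.succ_zero_eq_one,
      parE_add_of_superTrace_ne_zero h, zero_add]
    exact Submodule.smul_mem _ _ (elemBasis_mem_endGr _)

lemma endProd_mem_gr {m n : ℕ} (i j : ZMod 2) (x : EndPow k p q m) (y : EndPow k p q n)
    (hx : x ∈ endGr k p q m i) (hy : y ∈ endGr k p q n j) :
    endProd k p q m n x y ∈ endGr k p q (m + n) (i + j) := by
  refine endGr_le (S := (endGr k p q (m + n) (i + j)).comap ((endProd k p q m n).flip y)) ?_ hx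
  rintro a rfl
  refine endGr_le (S := (endGr k p q (m + n) (∑ t, parE (a t) + j)).comap
    (endProd k p q m n (elemBasis k p q m a))) ?_ hy
  rintro b rfl
  rw [Submodule.mem_comap, endProd_basis]
  have h := elemBasis_mem_endGr (k := k) (Fin.append a b)
  rw [Fin.sum_univ_add] at h
  simpa using h

variable (k p q) in
/-- The composition along an edge in the endomorphism modular operad. -/
def endComp (m n : ℕ) (x : EndPow k p q (m + 1)) (y : EndPow k p q (n + 1)) :
    EndPow k p q (m + n) :=
  endContr k p q (m + n) (endAct k p q (bringFront m n) (endProd k p q (m + 1) (n + 1) x y))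

lemma endComp_endAct {m m' n n' : ℕ} (e : Fin m ≃ Fin m') (f : Fin n ≃ Fin n')
    (x : EndPow k p q (m + 1)) (y : EndPow k p q (n + 1)) :
    endComp k p q m' n' (endAct k p q (liftZero e) x) (endAct k p q (liftZero f) y) =
      endAct k p q (juxtapose e f) (endComp k p q m n x y) := by
  unfold endComp
  rw [endProd_endAct, ← endAct_trans, juxtapose_liftZero_bringFront, endAct_trans,
    endContr_liftZero]

lemma endComp_comm {m n : ℕ} (i j : ZMod 2) (x : EndPow k p q (m + 1)) (y : EndPow k p q (n + 1))
    (hx : x ∈ endGr k p q (m + 1) i) (hy : y ∈ endGr k p q (n + 1) j) :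
    endComp k p q n m y x =
      (sgn (i * j) : k) • endAct k p q finAddFlip (endComp k p q m n x y) := by
  unfold endComp
  rw [endProd_comm i j x y hx hy, map_smul, map_smul, ← endAct_trans, finAddFlip_bringFront,
    endAct_trans, endContr_swap, endAct_trans, endContr_liftZero]

lemma endContr_endComp {m n : ℕ} (x : EndPow k p q (m + 2)) (y : EndPow k p q (n + 2)) :
    endContr k p q (m + n) (endAct k p q (bringFront m n)
        (endComp k p q (m + 1) (n + 1) (endAct k p q (Equiv.swap 0 1) x)
          (endAct k p q (Equiv.swap 0 1) y))) =
      endContr k p q (m + n) (endAct k p q (bringFront m n)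
        (endComp k p q (m + 1) (n + 1) x y)) := by
  unfold endComp
  rw [endProd_endAct, ← endContr_liftZero, ← endContr_liftZero, ← endAct_trans, ← endAct_trans,
    ← endAct_trans, ← Equiv.trans_assoc, bringFront_double, endAct_trans]
  generalize (endAct k p q ((bringFront (m + 1) (n + 1)).trans
    (liftZero (liftZero (bringFront m n))))) (endProd k p q (m + 1 + 1) (n + 1 + 1) x y) = w
  exact endContr_endContr w

lemma endContr_endComp_left {m n : ℕ} (x : EndPow k p q (m + 3)) (y : EndPow k p q (n + 1)) :
    endContr k p q (m + n) (endAct k p q (pullLeft m n 2)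
        (endComp k p q (m + 2) n (endAct k p q (Fin.cycleRange 2) x) y)) =
      endComp k p q m n (endContr k p q (m + 1) x) y := by
  unfold endComp
  have h := endProd_endAct (Fin.cycleRange (2 : Fin (m + 3))) (Equiv.refl (Fin (n + 1))) x y
  rw [endAct_refl] at h
  rw [endProd_endContr_left, ← endContr_liftZero, ← endContr_liftZero, ← endAct_trans, h,
    ← endAct_trans, ← endAct_trans, ← Equiv.trans_assoc, bringFront_loop, endAct_trans]
  generalize (endAct k p q ((pullLeft (m + 1) (n + 1) 2).trans
    (liftZero (liftZero (bringFront m n))))) (endProd k p q (m + 3) (n + 1) x y) = w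
  exact endContr_endContr w

lemma endComp_assoc {l m n : ℕ} (x : EndPow k p q (l + 1)) (y : EndPow k p q (m + 2))
    (z : EndPow k p q (n + 1)) :
    endAct k p q (finCongr (add_assoc l m n))
        (endComp k p q (l + m) n (endAct k p q (pullRight l m) (endComp k p q l (m + 1) x y)) z) =
      endComp k p q l (m + n) x (endAct k p q (pullLeft m n 1)
        (endComp k p q (m + 1) n (endAct k p q (Equiv.swap 0 1) y) z)) := by
  unfold endComp
  have h₁ := endProd_endAct ((bringFront l (m + 1)).trans (liftZero (liftZero (pullRight l m))))
    (Equiv.refl (Fin (n + 1))) (endProd k p q _ _ x y) z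
  have h₂ := endProd_endAct (Equiv.swap 0 1) (Equiv.refl (Fin (n + 1))) y z
  have h₃ := endProd_endAct (Equiv.refl (Fin (l + 1)))
    (((juxtapose (Equiv.swap 0 1) (Equiv.refl (Fin (n + 1)))).trans
          (bringFront (m + 1) n)).trans (liftZero (liftZero (pullLeft m n 1)))) x
    (endProd k p q _ _ y z)
  rw [endAct_refl] at h₁ h₂ h₃
  rw [← endContr_liftZero (pullRight l m), ← endAct_trans, endProd_endContr_left, h₁,
    ← endAct_trans, ← endContr_liftZero (bringFront (l + m) n), ← endAct_trans,
    ← endContr_liftZero (finCongr (add_assoc l m n)),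
    ← endContr_liftZero (liftZero (liftZero (finCongr (add_assoc l m n)))), ← endAct_trans, h₂,
    ← endContr_liftZero (pullLeft m n 1), ← endAct_trans, ← endAct_trans, endProd_endContr_right,
    ← Equiv.trans_assoc, h₃, ← endAct_trans, ← endContr_liftZero (bringFront l (m + n)),
    ← endAct_trans, endProd_assoc, ← endAct_trans, bringFront_path, endAct_trans,
    ← Equiv.trans_assoc, ← Equiv.trans_assoc]
  generalize (endAct k p q _) (endProd k p q (l + 1 + (m + 1 + 1)) (n + 1)
    (endProd k p q (l + 1) (m + 1 + 1) x y) z) = w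
  exact endContr_endContr w

set_option maxRecDepth 2000 in
theorem endOperad_isModularOperad : (endOperad k p q).IsModularOperad where
  gr_internal n := isInternal_span_basis (elemBasis k p q n) fun a => ∑ t, parE (a t)
  act_even e i x := endAct_mem_gr e i x
  contr_even n i x := endContr_mem_gr i x
  comp_even m n i j x y hx hy :=
    endContr_mem_gr _ _ (endAct_mem_gr _ _ _ (endProd_mem_gr i j x y hx hy))
  act_refl n x := endAct_refl x
  act_trans e f x := endAct_trans e f x
  contr_act e x := endContr_liftZero e x
  contr_swap n x := endContr_swap x
  comp_act e f x y := endComp_endAct e f x y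
  comp_comm m n i j x y hx hy := by
    rw [← Int.cast_smul_eq_zsmul k]
    exact endComp_comm i j x y hx hy
  contr_contr n x := endContr_endContr x
  contr_comp m n x y := endContr_endComp x y
  contr_comp_left m n x y := endContr_endComp_left x y
  comp_assoc l m n x y z := endComp_assoc x y z

end EndOperad

/-! ### Reordering products in supercommutative algebras -/

section Supercommutative

variable {k : Type u} [Field k] {A : Type u} [Ring A] [Algebra k A] {𝒜 : ZMod 2 → Submodule k A}

/-- In a supercommutative algebra, a product of homogeneous elements changes by the Koszul sign
when its factors are reordered. -/
lemma IsSupercommutative.list_prod_reorder [GradedAlgebra 𝒜] (hA : IsSupercommutative 𝒜)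
    {ι : Type*} {c : ι → A} {d : ι → ZMod 2} (hc : ∀ i, c i ∈ 𝒜 (d i)) {r s : ι → ℕ}
    {l₁ l₂ : List ι} (h₁ : l₁.Pairwise (r · < r ·)) (h₂ : l₂.Pairwise (s · < s ·))
    (h : l₁.Perm l₂) :
    (l₁.map c).prod =
      sgn (l₁.map fun i =>
          (l₁.map fun j => if r i < r j ∧ s j < s i then d i * d j else 0).sum).sum •
        (l₂.map c).prod := by
  induction l₁ generalizing l₂ with
  | nil =>
    rw [← h.nil_eq]
    simp [sgn_zero]
  | cons x l ih =>
    obtain ⟨p, q, rfl⟩ := List.append_of_mem (h.subset List.mem_cons_self)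
    have hpq : l.Perm (p ++ q) := (h.trans List.perm_middle).cons_inv
    rw [List.pairwise_cons] at h₁
    have h₂' : (p ++ q).Pairwise (s · < s ·) :=
      h₂.sublist (List.Sublist.append_left (List.sublist_cons_self x q) p)
    rw [List.pairwise_append] at h₂
    have hp : ∀ j ∈ p, s j < s x := fun j hj => h₂.2.2 j hj x List.mem_cons_self
    have hq : ∀ j ∈ q, s x < s j := fun j hj => (List.pairwise_cons.1 h₂.2.1).1 j hj
    have hrow : (l.map fun j => if r x < r j ∧ s j < s x then d x * d j else 0).sum =
        (p.map d).sum * d x := by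
      rw [(hpq.map _).sum_eq, List.map_append, List.sum_append, List.map_congr_left (l := p)
        (g := fun j => d j * d x), List.map_congr_left (l := q) (g := fun _ => 0)]
      · simp [List.sum_map_mul_right]
      · intro j hj
        exact if_neg fun h' => (hq j hj).not_gt h'.2
      · intro j hj
        rw [if_pos ⟨h₁.1 j (hpq.symm.subset (List.mem_append_left _ hj)), hp j hj⟩, mul_comm]
    have hcol : (l.map fun i => (if r i < r x ∧ s x < s i then d i * d x else 0) +
        (l.map fun j => if r i < r j ∧ s j < s i then d i * d j else 0).sum) =
        l.map fun i => (l.map fun j => if r i < r j ∧ s j < s i then d i * d j else 0).sum := by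
      refine List.map_congr_left fun i hi => ?_
      rw [if_neg fun h' => (h₁.1 i hi).not_gt h'.1, zero_add]
    have hx : (p.map c).prod * c x = sgn ((p.map d).sum * d x) • (c x * (p.map c).prod) :=
      hA _ _ _ _ (SetLike.list_prod_map_mem_graded p d c fun i _ => hc i) (hc x)
    simp only [List.map_cons, List.sum_cons, List.prod_cons, lt_irrefl, false_and, if_false,
      zero_add, hrow, hcol, List.map_append, List.prod_append]
    rw [ih h₁.2 h₂' hpq, ← mul_assoc (p.map c).prod, hx, List.map_append, List.prod_append,
      mul_smul_comm, smul_mul_assoc, mul_assoc, smul_smul, ← sgn_add]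
    congr 2
    rw [add_right_comm, CharTwo.add_self_eq_zero, zero_add]

/-- The inverse of an even matrix is even. -/
lemma IsGLPoint.inv [GradedAlgebra 𝒜] {p q : ℕ} {g : (Matrix (Idx p q) (Idx p q) A)ˣ}
    (hg : IsGLPoint 𝒜 g) : IsGLPoint 𝒜 g⁻¹ := by
  obtain ⟨h, hh⟩ : ∃ h : Matrix (Idx p q) (Idx p q) A, h = ↑(g⁻¹) := ⟨_, rfl⟩
  -- the even part of the inverse is a right inverse, too
  let h' : Matrix (Idx p q) (Idx p q) A := fun i j =>
    (DirectSum.decompose 𝒜 (h i j) (par i + par j) : A)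
  have h1 : (g : Matrix (Idx p q) (Idx p q) A) * h' = 1 := by
    ext i l
    have hgh : (g : Matrix (Idx p q) (Idx p q) A) * h = 1 := by rw [hh]; simp
    have hil : ∀ j, (g : Matrix (Idx p q) (Idx p q) A) i j * h' j l =
        GradedRing.proj 𝒜 (par i + par l) ((g : Matrix (Idx p q) (Idx p q) A) i j * h j l) := by
      intro j
      have hd : par i + par l = (par i + par j) + (par j + par l) := by
        rw [add_assoc, ← add_assoc (par j), CharTwo.add_self_eq_zero, zero_add]
      rw [GradedRing.proj_apply, hd, DirectSum.coe_decompose_mul_add_of_left_mem 𝒜 (hg i j)]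
    rw [Matrix.mul_apply, Finset.sum_congr rfl fun j _ => hil j, ← map_sum, ← Matrix.mul_apply, hgh,
      GradedRing.proj_apply, Matrix.one_apply]
    split_ifs with hij
    · subst hij
      rw [CharTwo.add_self_eq_zero]
      exact DirectSum.decompose_of_mem_same 𝒜 SetLike.GradedOne.one_mem
    · rw [DirectSum.decompose_zero]
      rfl
  have h2 : h = h' := by
    calc h = h * ((g : Matrix (Idx p q) (Idx p q) A) * h') := by rw [h1, mul_one]
      _ = h' := by rw [← mul_assoc, hh, Units.inv_mul, one_mul]
  intro i j
  rw [← hh, h2]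
  exact SetLike.coe_mem _

end Supercommutative

/-! ### The matrix coefficients of the action of `GL(U)` -/

section Coefficients

variable {k : Type u} [Field k] {A : Type u} [Ring A] [Algebra k A] {𝒜 : ZMod 2 → Submodule k A}
  {p q : ℕ}

/-- The coefficient of `E_b` in the image of `E_a` under `g`. -/
def glCoeff {n : ℕ} (g : (Matrix (Idx p q) (Idx p q) A)ˣ) (a b : Fin n → Idx p q × Idx p q) : A :=
  (∏ s, ∏ t, if s < t then sgn ((parE (a s) + parE (b s)) * parE (b t)) else 1) •
    (List.ofFn fun t => adCoeff g (a t) (b t)).prod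

lemma glAction_basis {n : ℕ} (g : (Matrix (Idx p q) (Idx p q) A)ˣ)
    (a : Fin n → Idx p q × Idx p q) :
    glAction g (elemBasis k p q n a) =
      ∑ b : Fin n → Idx p q × Idx p q, elemBasis k p q n b ⊗ₜ[k] glCoeff g a b :=
  Basis.constr_basis ..

/-- The letters in their standard order. -/
def letterList (n : ℕ) : List (Fin n ⊕ Fin n) :=
  (List.finRange n).flatMap fun t => [Sum.inl t, Sum.inr t]

lemma letterList_pairwise (n : ℕ) :
    (letterList n).Pairwise (letterPos n · < letterPos n ·) := by
  unfold letterList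
  rw [List.pairwise_flatMap]
  refine ⟨fun t _ => by simp, (List.pairwise_lt_finRange n).imp fun {s t} hst => ?_⟩
  have := Fin.lt_def.1 hst
  simp
  omega

lemma mem_letterList {n : ℕ} (i : Fin n ⊕ Fin n) : i ∈ letterList n := by
  unfold letterList
  rw [List.mem_flatMap]
  rcases i with t | t <;> exact ⟨t, List.mem_finRange t, by simp⟩

lemma letterList_nodup (n : ℕ) : (letterList n).Nodup :=
  (letterList_pairwise n).imp fun h h' => by simp [h'] at h

lemma sum_letterList {n : ℕ} {M : Type*} [AddCommMonoid M] (f : Fin n ⊕ Fin n → M) :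
    ((letterList n).map f).sum = ∑ i, f i := by
  classical
  rw [← List.sum_toFinset f (letterList_nodup n)]
  congr 1
  ext i
  simp [mem_letterList]

lemma prod_letterList {n : ℕ} {M : Type*} [Monoid M] (f : Fin n ⊕ Fin n → M) :
    ((letterList n).map f).prod = (List.ofFn fun t => f (.inl t) * f (.inr t)).prod := by
  unfold letterList
  rw [List.ofFn_eq_map]
  induction List.finRange n with
  | nil => rfl
  | cons t l ih => simp [ih, mul_assoc]

/-- The coefficients that the letters of `E_a` contribute to `E_b`. -/
def letterCoeff {n : ℕ} (g : (Matrix (Idx p q) (Idx p q) A)ˣ) (a b : Fin n → Idx p q × Idx p q) :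
    Fin n ⊕ Fin n → A :=
  Sum.elim (fun t => (g : Matrix (Idx p q) (Idx p q) A) (b t).1 (a t).1)
    (fun t => (↑g⁻¹ : Matrix (Idx p q) (Idx p q) A) (a t).2 (b t).2)

lemma letterCoeff_mem [GradedAlgebra 𝒜] {n : ℕ} {g : (Matrix (Idx p q) (Idx p q) A)ˣ}
    (hg : IsGLPoint 𝒜 g) (a b : Fin n → Idx p q × Idx p q) (i : Fin n ⊕ Fin n) :
    letterCoeff g a b i ∈ 𝒜 (letterPar a i + letterPar b i) := by
  rcases i with t | t
  · rw [add_comm]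
    exact hg _ _
  · exact hg.inv _ _

/-- The sign exponent of moving coefficients of parity `a + b` to the right of letters of parity
`b`, if the letters are ordered by `r`. -/
def crossExp {ι : Type*} [Fintype ι] (r : ι → ℕ) (a b : ι → ZMod 2) : ZMod 2 :=
  ∑ i, ∑ j, if r i < r j then (a i + b i) * b j else 0

lemma crossExp_comp_equiv {ι κ : Type*} [Fintype ι] [Fintype κ] (e : κ ≃ ι) (r : ι → ℕ)
    (a b : ι → ZMod 2) : crossExp (r ∘ e) (a ∘ e) (b ∘ e) = crossExp r a b := by
  unfold crossExp
  rw [← e.sum_comp]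
  refine Finset.sum_congr rfl fun i _ => ?_
  rw [← e.sum_comp]
  rfl

/-- The compatibility of signs behind the equivariance of the action of `GL(U)`: reordering the
letters `a`, replacing them by letters `b` with coefficients of parity `a + b`, and collecting the
coefficients, the order of these steps does not matter. -/
lemma crossExp_add_koszulExp {ι : Type*} [Fintype ι] {r s : ι → ℕ} (hr : Function.Injective r)
    (hs : Function.Injective s) (a b : ι → ZMod 2) :
    koszulExp r s a + (crossExp s a b + koszulExp r s fun i => a i + b i) =
      koszulExp r s b + crossExp r a b := by
  have hflip : ∑ i, ∑ j, (if s i < s j ∧ r j < r i then (a i + b i) * b j else 0) =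
      ∑ i, ∑ j, (if r i < r j ∧ s j < s i then (a j + b j) * b i else 0) := by
    rw [Finset.sum_comm]
    simp only [and_comm]
  have hdiff : crossExp r a b + crossExp s a b =
      ∑ i, ∑ j, if r i < r j ∧ s j < s i then (a i + b i) * b j + (a j + b j) * b i else 0 := by
    have h : ∀ i j, (if r i < r j ∧ s j < s i then (a i + b i) * b j + (a j + b j) * b i else 0) =
        (if r i < r j ∧ s j < s i then (a i + b i) * b j else 0) +
          (if r i < r j ∧ s j < s i then (a j + b j) * b i else 0) := fun i j => by
      split_ifs <;> simp
    simp only [h, Finset.sum_add_distrib]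
    rw [← hflip]
    unfold crossExp
    simp only [← Finset.sum_add_distrib]
    refine Finset.sum_congr rfl fun i _ => Finset.sum_congr rfl fun j _ => ?_
    by_cases hij : i = j
    · subst hij; simp
    have h1 := hr.ne hij
    have h2 := hs.ne hij
    generalize (a i + b i) * b j = x
    have hx : x + x = 0 := CharTwo.add_self_eq_zero x
    rcases lt_or_gt_of_ne h1 with h1 | h1 <;> rcases lt_or_gt_of_ne h2 with h2 | h2 <;>
      simp [h1, h2, h1.not_gt, h2.not_gt, hx]
  have hK : koszulExp r s a + koszulExp r s (fun i => a i + b i) + koszulExp r s b =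
      crossExp r a b + crossExp s a b := by
    rw [hdiff]
    unfold koszulExp
    simp only [← Finset.sum_add_distrib]
    refine Finset.sum_congr rfl fun i _ => Finset.sum_congr rfl fun j _ => ?_
    split_ifs
    · generalize a i = w
      generalize a j = x
      generalize b i = y
      generalize b j = z
      revert w x y z
      decide
    · simp
  have h2 : ∀ x : ZMod 2, x + x = 0 := CharTwo.add_self_eq_zero
  linear_combination hK + h2 (crossExp s a b) - h2 (koszulExp r s b)

lemma list_prod_zsmul {ι R : Type*} [Ring R] (l : List ι) (z : ι → ℤ) (x : ι → R) :
    (l.map fun i => z i • x i).prod = (l.map z).prod • (l.map x).prod := by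
  induction l with
  | nil => simp
  | cons i l ih =>
    simp only [List.map_cons, List.prod_cons, ih, smul_mul_assoc, mul_smul_comm, smul_smul]
    rw [mul_comm]

lemma glCoeff_eq_crossExp {n : ℕ} (g : (Matrix (Idx p q) (Idx p q) A)ˣ)
    (a b : Fin n → Idx p q × Idx p q) :
    glCoeff g a b = sgn (crossExp Fin.val (fun t => parE (a t)) fun t => parE (b t)) •
      (List.ofFn fun t => adCoeff g (a t) (b t)).prod := by
  unfold glCoeff crossExp
  congr 1
  rw [sgn_sum]
  refine Finset.prod_congr rfl fun s _ => ?_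
  rw [sgn_sum]
  refine Finset.prod_congr rfl fun t _ => ?_
  simp only [← Fin.lt_def]
  split_ifs <;> simp [sgn_zero]

/-- The coefficients of the action in terms of the letters. -/
lemma glCoeff_eq {n : ℕ} (g : (Matrix (Idx p q) (Idx p q) A)ˣ) (a b : Fin n → Idx p q × Idx p q) :
    glCoeff g a b = sgn (crossExp (letterPos n) (letterPar a) (letterPar b) +
      ∑ t, (par (a t).2 + par (b t).2) * par (b t).2) •
        ((letterList n).map (letterCoeff g a b)).prod := by
  have h1 : (List.ofFn fun t => adCoeff g (a t) (b t)).prod =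
      sgn (∑ t, (parE (a t) + parE (b t)) * par (b t).2) •
        (List.ofFn fun t => letterCoeff g a b (.inl t) * letterCoeff g a b (.inr t)).prod := by
    rw [List.ofFn_eq_map, List.ofFn_eq_map, sgn_sum, ← List.prod_ofFn, List.ofFn_eq_map]
    exact list_prod_zsmul _ _ _
  rw [glCoeff_eq_crossExp, h1, prod_letterList, smul_smul, ← sgn_add]
  congr 2
  unfold crossExp
  simp only [Fintype.sum_sum_type, ← Finset.sum_add_distrib]
  refine Finset.sum_congr rfl fun s _ => ?_
  have hd : (parE (a s) + parE (b s)) * par (b s).2 = ∑ t, if s = t then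
      (par (a s).1 + par (b s).1) * par (b t).2 + (par (a s).2 + par (b s).2) * par (b t).2
      else 0 := by
    rw [Finset.sum_ite_eq, if_pos (Finset.mem_univ _)]
    unfold parE
    ring
  have hd' : (par (a s).2 + par (b s).2) * par (b s).2 = ∑ t, if s = t then
      (par (a s).2 + par (b s).2) * par (b t).2 else 0 := by
    rw [Finset.sum_ite_eq, if_pos (Finset.mem_univ _)]
  rw [hd, hd', ← Finset.sum_add_distrib, ← Finset.sum_add_distrib]
  refine Finset.sum_congr rfl fun t _ => ?_
  have hll : letterPos n (.inl s) < letterPos n (.inl t) ↔ s < t := by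
    rw [letterPos_inl, letterPos_inl, Fin.lt_def]; omega
  have hrr : letterPos n (.inr s) < letterPos n (.inr t) ↔ s < t := by
    rw [letterPos_inr, letterPos_inr, Fin.lt_def]; omega
  have hlr : letterPos n (.inl s) < letterPos n (.inr t) ↔ s < t ∨ s = t := by
    rw [letterPos_inl, letterPos_inr, Fin.lt_def, Fin.ext_iff]; omega
  have hrl : letterPos n (.inr s) < letterPos n (.inl t) ↔ s < t := by
    rw [letterPos_inr, letterPos_inl, Fin.lt_def]; omega
  simp only [hll, hrr, hlr, hrl, letterPar, Sum.elim_inl, Sum.elim_inr, parE, ← Fin.lt_def]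
  rcases lt_trichotomy s t with h | h | h
  · simp only [h, h.ne, true_or, if_true, if_false]
    ring
  · subst h
    simp
  · simp [h.not_gt, h.ne']

/-- The action of `GL(U)` commutes with permutations of the letters. -/
lemma glCoeff_moveLetters [GradedAlgebra 𝒜] (hA : IsSupercommutative 𝒜) {m n : ℕ}
    {g : (Matrix (Idx p q) (Idx p q) A)ˣ} (hg : IsGLPoint 𝒜 g) (e₁ e₂ : Fin m ≃ Fin n)
    (a b : Fin m → Idx p q × Idx p q) :
    sgn (letterExp e₁ e₂ (letterPar a)) • glCoeff g (moveLetters e₁ e₂ a) (moveLetters e₁ e₂ b) =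
      sgn (letterExp e₁ e₂ (letterPar b)) • glCoeff g a b := by
  obtain ⟨σ, hσ⟩ : ∃ σ, σ = Equiv.sumCongr e₁ e₂ := ⟨_, rfl⟩
  have hpos : Function.Injective (letterPos n ∘ σ) :=
    (letterPos_injective n).comp σ.injective
  have hcoeff : letterCoeff g (moveLetters e₁ e₂ a) (moveLetters e₁ e₂ b) =
      letterCoeff g a b ∘ σ.symm := by
    subst hσ
    ext (i | i) <;> rfl
  have hcross : crossExp (letterPos n) (letterPar a ∘ σ.symm) (letterPar b ∘ σ.symm) =
      crossExp (letterPos n ∘ σ) (letterPar a) (letterPar b) := by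
    rw [← crossExp_comp_equiv σ]
    congr 1 <;> ext i <;> simp
  have hdiag : ∑ t, (par (moveLetters e₁ e₂ a t).2 + par (moveLetters e₁ e₂ b t).2) *
      par (moveLetters e₁ e₂ b t).2 = ∑ t, (par (a t).2 + par (b t).2) * par (b t).2 := by
    rw [← e₂.sum_comp]
    simp [moveLetters]
  have hsorted : ((letterList n).map σ.symm).Pairwise
      ((letterPos n ∘ σ) · < (letterPos n ∘ σ) ·) := by
    rw [List.pairwise_map]
    simpa using letterList_pairwise n
  have hperm : (letterList m).Perm ((letterList n).map σ.symm) := by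
    refine (List.perm_ext_iff_of_nodup (letterList_nodup m)
      ((letterList_nodup n).map σ.symm.injective)).2 fun i => ?_
    refine ⟨fun _ => List.mem_map.2 ⟨σ i, mem_letterList _, by simp⟩, fun _ => mem_letterList _⟩
  have hreorder := hA.list_prod_reorder (letterCoeff_mem hg a b) (letterList_pairwise m) hsorted
    hperm
  simp only [sum_letterList, List.map_map] at hreorder
  have hK : letterExp e₁ e₂ = koszulExp (letterPos m) (letterPos n ∘ σ) := by
    subst hσ
    rfl
  have key := crossExp_add_koszulExp (letterPos_injective m) hpos (letterPar a) (letterPar b)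
  rw [glCoeff_eq, glCoeff_eq g a b, hcoeff, hreorder, letterPar_moveLetters, letterPar_moveLetters,
    hdiag, ← hσ, hcross, smul_smul, smul_smul, smul_smul, ← sgn_add, ← sgn_add, ← sgn_add, hK]
  congr 2
  change _ = _ + koszulExp (letterPos m) (letterPos n ∘ σ) fun i => letterPar a i + letterPar b i
  have h2 : ∀ x : ZMod 2, x + x = 0 := CharTwo.add_self_eq_zero
  linear_combination key - h2 (koszulExp (letterPos m) (letterPos n ∘ σ) fun i =>
    letterPar a i + letterPar b i)

end Coefficients

/-! ### Equivariance of the structure maps under `GL(U)` -/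

section Equivariance

variable {k : Type u} [Field k] {A : Type u} [Ring A] [Algebra k A] {𝒜 : ZMod 2 → Submodule k A}
  {p q : ℕ}

lemma intCast_smul_tmul {M : Type*} [AddCommGroup M] [Module k M] (z : ℤ) (x : M) (c : A) :
    ((z : k) • x) ⊗ₜ[k] c = x ⊗ₜ[k] (z • c) := by
  rw [TensorProduct.smul_tmul, Int.cast_smul_eq_zsmul]

lemma glAction_letterAct [GradedAlgebra 𝒜] (hA : IsSupercommutative 𝒜) {m n : ℕ}
    {g : (Matrix (Idx p q) (Idx p q) A)ˣ} (hg : IsGLPoint 𝒜 g) (e₁ e₂ : Fin m ≃ Fin n)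
    (x : EndPow k p q m) :
    glAction g (letterAct k p q e₁ e₂ x) = (letterAct k p q e₁ e₂).rTensor A (glAction g x) := by
  suffices h : glAction g ∘ₗ letterAct k p q e₁ e₂ =
      (letterAct k p q e₁ e₂).rTensor A ∘ₗ glAction g from LinearMap.congr_fun h x
  refine (elemBasis k p q m).ext fun a => ?_
  simp only [LinearMap.comp_apply, letterAct_basis, map_smul, glAction_basis, map_sum,
    LinearMap.rTensor_tmul]
  let φ : (Fin m → Idx p q × Idx p q) ≃ (Fin n → Idx p q × Idx p q) :=
    ⟨moveLetters e₁ e₂, moveLetters e₁.symm e₂.symm, fun a => by ext <;> simp [moveLetters],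
      fun a => by ext <;> simp [moveLetters]⟩
  rw [← φ.sum_comp, Finset.smul_sum]
  refine Finset.sum_congr rfl fun b _ => ?_
  change _ • (elemBasis k p q n (moveLetters e₁ e₂ b) ⊗ₜ[k] glCoeff g _ (moveLetters e₁ e₂ b)) = _
  rw [TensorProduct.smul_tmul', intCast_smul_tmul, intCast_smul_tmul, glCoeff_moveLetters hA hg]

lemma glCoeff_cons {n : ℕ} (g : (Matrix (Idx p q) (Idx p q) A)ˣ)
    (a : Fin (n + 1) → Idx p q × Idx p q) (b₀ : Idx p q × Idx p q)
    (b : Fin n → Idx p q × Idx p q) :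
    glCoeff g a (Fin.cons b₀ b) = sgn ((parE (a 0) + parE b₀) * ∑ t, parE (b t)) •
      (adCoeff g (a 0) b₀ * glCoeff g (fun t => a t.succ) b) := by
  rw [glCoeff_eq_crossExp, glCoeff_eq_crossExp, List.ofFn_succ, List.prod_cons, mul_smul_comm,
    smul_smul, ← sgn_add]
  simp only [Fin.cons_zero, Fin.cons_succ]
  congr 2
  simp [crossExp, Fin.sum_univ_succ, Finset.mul_sum]

/-- The supertrace is invariant under conjugation. -/
lemma sum_superTrace_adCoeff [GradedAlgebra 𝒜] (hA : IsSupercommutative 𝒜)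
    {g : (Matrix (Idx p q) (Idx p q) A)ˣ} (hg : IsGLPoint 𝒜 g) (a : Idx p q × Idx p q) :
    ∑ b, superTrace (elem k b) • adCoeff g a b = superTrace (elem k a) • (1 : A) := by
  obtain ⟨h, hh⟩ : ∃ h : Matrix (Idx p q) (Idx p q) A, h = ↑(g⁻¹) := ⟨_, rfl⟩
  have hinv : h * (g : Matrix (Idx p q) (Idx p q) A) = 1 := by rw [hh]; simp
  have hterm : ∀ i, superTrace (elem k (i, i)) • adCoeff g a (i, i) =
      sgn (par a.1 * par a.2) • (h a.2 i * (g : Matrix (Idx p q) (Idx p q) A) i a.1) := by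
    intro i
    have hi := hg.inv a.2 i
    rw [← hh] at hi
    rw [superTrace_elem, if_pos rfl, Int.cast_smul_eq_zsmul, adCoeff, ← hh,
      hA _ _ _ _ (hg i a.1) hi,
      smul_smul, smul_smul, ← sgn_add, ← sgn_add]
    congr 2
    simp only [parE]
    generalize par a.1 = x
    generalize par a.2 = y
    generalize par i = z
    revert x y z
    decide
  rw [Fintype.sum_prod_type]
  have hrow : ∀ i, ∑ j, superTrace (elem k (i, j)) • adCoeff g a (i, j) =
      superTrace (elem k (i, i)) • adCoeff g a (i, i) := by
    intro i
    refine Finset.sum_eq_single i (fun j _ hj => ?_) (by simp)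
    rw [superTrace_elem, if_neg (Ne.symm hj), zero_smul]
  rw [Finset.sum_congr rfl fun i _ => (hrow i).trans (hterm i), ← Finset.smul_sum,
    ← Matrix.mul_apply, hinv, superTrace_elem, Matrix.one_apply]
  by_cases h12 : a.1 = a.2
  · rw [if_pos h12, if_pos h12.symm, h12, Int.cast_smul_eq_zsmul]
    congr 2
    generalize par a.2 = x
    revert x
    decide
  · rw [if_neg h12, if_neg (Ne.symm h12), smul_zero, zero_smul]

lemma glAction_firstTrace [GradedAlgebra 𝒜] (hA : IsSupercommutative 𝒜) {n : ℕ}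
    {g : (Matrix (Idx p q) (Idx p q) A)ˣ} (hg : IsGLPoint 𝒜 g) (x : EndPow k p q (n + 1)) :
    glAction g (firstTrace k p q n x) = (firstTrace k p q n).rTensor A (glAction g x) := by
  suffices h : glAction g ∘ₗ firstTrace k p q n = (firstTrace k p q n).rTensor A ∘ₗ glAction g from
    LinearMap.congr_fun h x
  refine (elemBasis k p q (n + 1)).ext fun a => ?_
  simp only [LinearMap.comp_apply, firstTrace_basis, map_smul, glAction_basis, map_sum,
    LinearMap.rTensor_tmul]
  rw [← (Fin.consEquiv fun _ : Fin (n + 1) => Idx p q × Idx p q).sum_comp, Fintype.sum_prod_type,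
    Finset.sum_comm, Finset.smul_sum]
  refine Finset.sum_congr rfl fun b _ => ?_
  simp only [Fin.consEquiv, Equiv.coe_fn_mk, Fin.cons_zero, Fin.cons_succ]
  have hterm : ∀ b₀, (superTrace (elem k b₀) • elemBasis k p q n b) ⊗ₜ[k]
      glCoeff g a (Fin.cons b₀ b) = elemBasis k p q n b ⊗ₜ[k]
      (sgn (parE (a 0) * ∑ t, parE (b t)) •
        (superTrace (elem k b₀) • adCoeff g (a 0) b₀ * glCoeff g (fun t => a t.succ) b)) := by
    intro b₀
    rw [TensorProduct.smul_tmul, superTrace_elem]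
    split_ifs with h
    · have h0 : parE b₀ = 0 := by rw [parE, h, CharTwo.add_self_eq_zero]
      rw [glCoeff_cons, h0, add_zero, smul_mul_assoc, smul_comm]
    · simp
  rw [Finset.sum_congr rfl fun b₀ _ => hterm b₀, ← TensorProduct.tmul_sum, ← Finset.smul_sum,
    ← Finset.sum_mul, sum_superTrace_adCoeff hA hg, superTrace_elem, ← TensorProduct.tmul_smul]
  split_ifs with h
  · have h0 : parE (a 0) = 0 := by rw [parE, h, CharTwo.add_self_eq_zero]
    rw [h0, zero_mul, sgn_zero, one_smul, smul_mul_assoc, one_mul]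
  · simp

/-- The action on a tensor product, up to the sign of moving the coefficients of the first factor
past the second factor. -/
lemma glCoeff_append {m n : ℕ} (g : (Matrix (Idx p q) (Idx p q) A)ˣ)
    (a b : Fin m → Idx p q × Idx p q) (a' b' : Fin n → Idx p q × Idx p q) :
    glCoeff g (Fin.append a a') (Fin.append b b') =
      sgn ((∑ t, parE (a t) + ∑ t, parE (b t)) * ∑ t, parE (b' t)) •
        (glCoeff g a b * glCoeff g a' b') := by
  have hl : (fun t => adCoeff g (Fin.append a a' t) (Fin.append b b' t)) =
      Fin.append (fun t => adCoeff g (a t) (b t)) (fun t => adCoeff g (a' t) (b' t)) := by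
    ext t
    induction t using Fin.addCases <;> simp
  rw [glCoeff_eq_crossExp, glCoeff_eq_crossExp, glCoeff_eq_crossExp, hl, List.ofFn_fin_append,
    List.prod_append, mul_smul_comm, smul_mul_assoc, smul_smul, smul_smul, ← sgn_add, ← sgn_add]
  congr 2
  have h1 : ∀ (i : Fin m) (j : Fin n), i.val < m + j.val := fun i j => by omega
  have h2 : ∀ (i : Fin m) (j : Fin n), ¬ m + j.val < i.val := fun i j => by omega
  simp only [crossExp, Fin.sum_univ_add, Fin.append_left, Fin.append_right, Fin.val_castAdd,
    Fin.val_natAdd, Nat.add_lt_add_iff_left, h1, h2, if_true, if_false, Finset.sum_const_zero,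
    Finset.sum_add_distrib, ← Finset.mul_sum, ← Finset.sum_mul]
  ring

/-- The invariance of a tensor under `g`, in coordinates. -/
lemma glAction_eq_iff {n : ℕ} (g : (Matrix (Idx p q) (Idx p q) A)ˣ) (x : EndPow k p q n) :
    glAction g x = x ⊗ₜ[k] (1 : A) ↔ ∀ b,
      ∑ a, (elemBasis k p q n).repr x a • glCoeff g a b = (elemBasis k p q n).repr x b • 1 := by
  have hx : glAction g x = ∑ b, elemBasis k p q n b ⊗ₜ[k]
      ∑ a, (elemBasis k p q n).repr x a • glCoeff g a b := by
    conv_lhs => rw [← (elemBasis k p q n).sum_repr x]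
    simp only [map_sum, map_smul, glAction_basis, TensorProduct.tmul_sum, Finset.smul_sum,
      TensorProduct.tmul_smul]
    exact Finset.sum_comm
  have hc : ∀ (f : (Fin n → Idx p q × Idx p q) → A) b,
      TensorProduct.equivFinsuppOfBasisLeft (elemBasis k p q n)
        (∑ b, elemBasis k p q n b ⊗ₜ[k] f b) b = f b := by
    intro f b
    rw [map_sum, Finsupp.finsetSum_apply]
    simp [Finsupp.single_apply]
  rw [← (TensorProduct.equivFinsuppOfBasisLeft (elemBasis k p q n)).injective.eq_iff,
    DFunLike.ext_iff, hx]
  refine forall_congr' fun b => ?_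
  rw [hc, TensorProduct.equivFinsuppOfBasisLeft_apply_tmul_apply]

end Equivariance

/-! ### Closure properties of the invariants -/

section Invariants

variable {k : Type u} [Field k] {p q : ℕ}

lemma letterAct_mem_glInvariants {m n : ℕ} (e₁ e₂ : Fin m ≃ Fin n) {x : EndPow k p q m}
    (hx : x ∈ glInvariants k p q m) : letterAct k p q e₁ e₂ x ∈ glInvariants k p q n := by
  intro A _ _ 𝒜 _ hA g hg
  rw [glAction_letterAct hA hg, hx A 𝒜 hA g hg, LinearMap.rTensor_tmul]

lemma firstTrace_mem_glInvariants {n : ℕ} {x : EndPow k p q (n + 1)}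
    (hx : x ∈ glInvariants k p q (n + 1)) : firstTrace k p q n x ∈ glInvariants k p q n := by
  intro A _ _ 𝒜 _ hA g hg
  rw [glAction_firstTrace hA hg, hx A 𝒜 hA g hg, LinearMap.rTensor_tmul]

lemma endAct_mem_glInvariants {m n : ℕ} (e : Fin m ≃ Fin n) {x : EndPow k p q m}
    (hx : x ∈ glInvariants k p q m) : endAct k p q e x ∈ glInvariants k p q n := by
  rw [endAct_eq_letterAct]
  exact letterAct_mem_glInvariants e e hx

lemma endContr_mem_glInvariants {n : ℕ} {x : EndPow k p q (n + 2)}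
    (hx : x ∈ glInvariants k p q (n + 2)) : endContr k p q n x ∈ glInvariants k p q n := by
  rw [endContr_eq]
  exact firstTrace_mem_glInvariants
    (firstTrace_mem_glInvariants (letterAct_mem_glInvariants _ _ hx))

variable (k) in
/-- The grading of the dual numbers `k[ε]` in which `ε` is odd. -/
def dualGr (i : ZMod 2) : Submodule k (DualNumber k) where
  carrier := {x | if i = 0 then x.snd = 0 else x.fst = 0}
  zero_mem' := by simp
  add_mem' {x y} hx hy := by
    simp only [Set.mem_ofPred_eq] at *
    split_ifs at * <;> simp [hx, hy]
  smul_mem' c x hx := by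
    simp only [Set.mem_ofPred_eq] at *
    split_ifs at * <;> simp [hx]

lemma mem_dualGr_zero {x : DualNumber k} : x ∈ dualGr k 0 ↔ x.snd = 0 := by
  change (if (0 : ZMod 2) = 0 then x.snd = 0 else x.fst = 0) ↔ _
  rw [if_pos rfl]

lemma mem_dualGr_one {x : DualNumber k} : x ∈ dualGr k 1 ↔ x.fst = 0 := by
  change (if (1 : ZMod 2) = 0 then x.snd = 0 else x.fst = 0) ↔ _
  rw [if_neg one_ne_zero]

instance : SetLike.GradedMonoid (dualGr k) where
  one_mem := by simp [mem_dualGr_zero]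
  mul_mem i j x y hx hy := by
    rcases zmod_two_cases i with rfl | rfl <;> rcases zmod_two_cases j with rfl | rfl <;>
      simp_all [mem_dualGr_zero, mem_dualGr_one, CharTwo.add_self_eq_zero]

variable (k) in
/-- The even part of a dual number. -/
def dualEven : DualNumber k →ₗ[k] dualGr k 0 where
  toFun x := ⟨TrivSqZeroExt.inl x.fst, by simp [mem_dualGr_zero]⟩
  map_add' x y := by ext <;> simp
  map_smul' c x := by ext <;> simp

variable (k) in
/-- The odd part of a dual number. -/
def dualOdd : DualNumber k →ₗ[k] dualGr k 1 where
  toFun x := ⟨TrivSqZeroExt.inr x.snd, by simp [mem_dualGr_one]⟩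
  map_add' x y := by ext <;> simp
  map_smul' c x := by ext <;> simp

instance : GradedAlgebra (dualGr k) where
  toDecomposition := DirectSum.Decomposition.ofLinearMap (dualGr k)
    (DirectSum.lof k (ZMod 2) (fun i => dualGr k i) 0 ∘ₗ dualEven k +
      DirectSum.lof k (ZMod 2) (fun i => dualGr k i) 1 ∘ₗ dualOdd k)
    (by
      refine LinearMap.ext fun x => ?_
      simp only [LinearMap.comp_apply, LinearMap.add_apply, map_add, DirectSum.coeLinearMap_lof]
      exact TrivSqZeroExt.inl_fst_add_inr_snd_eq x)
    (by
      refine DirectSum.linearMap_ext k fun i => LinearMap.ext fun x => ?_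
      simp only [LinearMap.comp_apply, LinearMap.add_apply, DirectSum.coeLinearMap_lof]
      obtain ⟨x, hx⟩ := x
      rcases zmod_two_cases i with rfl | rfl
      · have h0 : dualEven k x = ⟨x, hx⟩ := Subtype.ext (by
          rw [mem_dualGr_zero] at hx
          ext <;> simp [dualEven, hx])
        have h1 : dualOdd k x = 0 := Subtype.ext (by
          rw [mem_dualGr_zero] at hx
          ext <;> simp [dualOdd, hx])
        rw [h0, h1, map_zero, add_zero]
        rfl
      · have h0 : dualEven k x = 0 := Subtype.ext (by
          rw [mem_dualGr_one] at hx
          ext <;> simp [dualEven, hx])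
        have h1 : dualOdd k x = ⟨x, hx⟩ := Subtype.ext (by
          rw [mem_dualGr_one] at hx
          ext <;> simp [dualOdd, hx])
        rw [h0, h1, map_zero, zero_add]
        rfl)

lemma dualGr_isSupercommutative : IsSupercommutative (dualGr k) := by
  intro i j x y hx hy
  rcases zmod_two_cases i with rfl | rfl <;> rcases zmod_two_cases j with rfl | rfl
  · simp [sgn_zero, mul_comm]
  · simp [sgn_zero, mul_comm]
  · simp [sgn_zero, mul_comm]
  · rw [mem_dualGr_one] at hx hy
    have h : ∀ x y : DualNumber k, x.fst = 0 → y.fst = 0 → x * y = 0 := fun x y hx hy => by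
      ext <;> simp [hx, hy]
    rw [h x y hx hy, h y x hy hx, smul_zero]

section Torus

variable {A : Type u} [Ring A] [Algebra k A] {𝒜 : ZMod 2 → Submodule k A}

variable (A) in
/-- The diagonal matrix with entries `c` as a point of `GL(U)`. -/
def torusPoint (c : Idx p q → kˣ) : (Matrix (Idx p q) (Idx p q) A)ˣ where
  val := Matrix.diagonal fun i => algebraMap k A (c i)
  inv := Matrix.diagonal fun i => algebraMap k A ↑(c i)⁻¹
  val_inv := by
    rw [Matrix.diagonal_mul_diagonal, ← Matrix.diagonal_one]
    congr 1
    ext i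
    rw [← map_mul, Units.mul_inv, map_one]
  inv_val := by
    rw [Matrix.diagonal_mul_diagonal, ← Matrix.diagonal_one]
    congr 1
    ext i
    rw [← map_mul, Units.inv_mul, map_one]

lemma torusPoint_isGLPoint [GradedAlgebra 𝒜] (c : Idx p q → kˣ) :
    IsGLPoint 𝒜 (torusPoint A c) := by
  intro i j
  change Matrix.diagonal (fun i => algebraMap k A (c i)) i j ∈ _
  by_cases h : i = j
  · subst h
    rw [Matrix.diagonal_apply_eq, CharTwo.add_self_eq_zero]
    exact SetLike.algebraMap_mem_graded _ _
  · rw [Matrix.diagonal_apply_ne _ h]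
    exact zero_mem _

lemma adCoeff_torusPoint (c : Idx p q → kˣ) (a b : Idx p q × Idx p q) :
    adCoeff (torusPoint A c) a b =
      algebraMap k A (if a = b then (c b.1 : k) * (↑(c b.2)⁻¹ : k) else 0) := by
  have hval : (↑(torusPoint A c) : Matrix (Idx p q) (Idx p q) A) =
    Matrix.diagonal fun i => algebraMap k A (c i) := rfl
  have hinv : (↑(torusPoint A c)⁻¹ : Matrix (Idx p q) (Idx p q) A) =
    Matrix.diagonal fun i => algebraMap k A ↑(c i)⁻¹ := rfl
  rw [adCoeff, hval, hinv]
  split_ifs with h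
  · rw [h, CharTwo.add_self_eq_zero, zero_mul, sgn_zero, one_smul, Matrix.diagonal_apply_eq,
      Matrix.diagonal_apply_eq, map_mul]
  · rw [map_zero]
    by_cases h1 : b.1 = a.1
    · rw [Matrix.diagonal_apply_ne _ (fun h2 => h (Prod.ext h1.symm h2)), mul_zero, smul_zero]
    · rw [Matrix.diagonal_apply_ne _ h1, zero_mul, smul_zero]

lemma glCoeff_torusPoint {n : ℕ} (c : Idx p q → kˣ) (a b : Fin n → Idx p q × Idx p q) :
    glCoeff (torusPoint A c) a b =
      algebraMap k A (if a = b then ∏ t, (c (b t).1 : k) * (↑(c (b t).2)⁻¹ : k) else 0) := by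
  have hl : (List.ofFn fun t => adCoeff (torusPoint A c) (a t) (b t)) =
      (List.ofFn fun t => if a t = b t then (c (b t).1 : k) * (↑(c (b t).2)⁻¹ : k) else 0).map
        (algebraMap k A) := by
    rw [List.map_ofFn]
    simp only [adCoeff_torusPoint]
    rfl
  rw [glCoeff_eq_crossExp, hl, ← map_list_prod, List.prod_ofFn]
  split_ifs with h
  · subst h
    have h0 : crossExp Fin.val (fun t => parE (a t)) (fun t => parE (a t)) = 0 := by
      unfold crossExp
      simp [CharTwo.add_self_eq_zero]
    rw [h0, sgn_zero, one_smul]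
    simp
  · obtain ⟨t, ht⟩ := Function.ne_iff.1 h
    rw [Finset.prod_eq_zero (Finset.mem_univ t) (if_neg ht), map_zero, smul_zero]

end Torus

/-- The coordinates of an invariant are supported on words of weight zero for the diagonal torus. -/
lemma prod_torus_eq {n : ℕ} {x : EndPow k p q n} (hx : x ∈ glInvariants k p q n)
    (c : Idx p q → kˣ) {b : Fin n → Idx p q × Idx p q} (hb : (elemBasis k p q n).repr x b ≠ 0) :
    ∏ t, c (b t).1 = ∏ t, c (b t).2 := by
  have h := (glAction_eq_iff _ x).1
    (hx _ _ (dualGr_isSupercommutative (k := k)) _ (torusPoint_isGLPoint c)) b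
  simp only [glCoeff_torusPoint, Algebra.smul_def, ← map_mul, ← map_sum, mul_one] at h
  have h' := (algebraMap k (DualNumber k)).injective h
  rw [Finset.sum_eq_single b (fun a _ hab => by rw [if_neg hab, mul_zero]) (by simp),
    if_pos rfl] at h'
  have h'' := (mul_eq_left₀ hb).1 h'
  rw [← mul_inv_eq_one, ← Finset.prod_inv_distrib, ← Finset.prod_mul_distrib]
  ext
  rw [Units.coe_prod, Units.val_one, ← h'']
  rfl

/-- Invariants are even: the parity automorphism `diag(1, -1)` of `U` belongs to the torus. -/
lemma glInvariants_even [CharZero k] {n : ℕ} {x : EndPow k p q n}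
    (hx : x ∈ glInvariants k p q n) {a : Fin n → Idx p q × Idx p q}
    (ha : (elemBasis k p q n).repr x a ≠ 0) : ∑ t, parE (a t) = 0 := by
  let c : Idx p q → kˣ := fun i => if par i = 0 then 1 else -1
  have hc : ∀ i, (c i : k) = (sgn (par i) : k) := fun i => by
    simp only [c, sgn]
    split_ifs <;> simp
  have h := congrArg (Units.val) (prod_torus_eq hx c ha)
  simp only [Units.coe_prod, hc, ← Int.cast_prod, ← sgn_sum] at h
  have h' := Int.cast_injective h
  unfold parE
  rw [Finset.sum_add_distrib]
  revert h'
  generalize ∑ t, par (a t).1 = x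
  generalize ∑ t, par (a t).2 = y
  revert x y
  decide

lemma repr_endProd {m n : ℕ} (x : EndPow k p q m) (y : EndPow k p q n)
    (a : Fin m → Idx p q × Idx p q) (a' : Fin n → Idx p q × Idx p q) :
    (elemBasis k p q (m + n)).repr (endProd k p q m n x y) (Fin.append a a') =
      (elemBasis k p q m).repr x a * (elemBasis k p q n).repr y a' := by
  suffices h : (endProd k p q m n).compr₂ ((elemBasis k p q (m + n)).coord (Fin.append a a')) =
      (LinearMap.mul k k).compl₁₂ ((elemBasis k p q m).coord a) ((elemBasis k p q n).coord a') from
    LinearMap.congr_fun₂ h x y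
  refine (elemBasis k p q m).ext fun b => (elemBasis k p q n).ext fun b' => ?_
  have hi : Fin.append b b' = Fin.append a a' ↔ b = a ∧ b' = a' :=
    ((Fin.appendEquiv m n).injective.eq_iff (a := (b, b')) (b := (a, a'))).trans Prod.mk_inj
  simp only [LinearMap.compr₂_apply, LinearMap.compl₁₂_apply, endProd_basis, Basis.coord_apply,
    Basis.repr_self, Finsupp.single_apply, hi, LinearMap.mul_apply']
  split_ifs <;> simp_all

/-- Since invariants are even, the coefficients in `A` of the first factor pass the second factor
without sign. -/
lemma endProd_mem_glInvariants [CharZero k] {m n : ℕ} {x : EndPow k p q m} {y : EndPow k p q n}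
    (hx : x ∈ glInvariants k p q m) (hy : y ∈ glInvariants k p q n) :
    endProd k p q m n x y ∈ glInvariants k p q (m + n) := by
  intro A _ _ 𝒜 _ hA g hg
  rw [glAction_eq_iff]
  intro b
  obtain ⟨⟨b, b'⟩, rfl⟩ := (Fin.appendEquiv m n).surjective b
  have h₁ := (glAction_eq_iff g x).1 (hx A 𝒜 hA g hg) b
  have h₂ := (glAction_eq_iff g y).1 (hy A 𝒜 hA g hg) b'
  change _ = (elemBasis k p q (m + n)).repr _ (Fin.append b b') • 1
  rw [← (Fin.appendEquiv m n).sum_comp, Fintype.sum_prod_type, repr_endProd]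
  have hterm : ∀ a a', (elemBasis k p q (m + n)).repr (endProd k p q m n x y)
      (Fin.appendEquiv m n (a, a')) • glCoeff g (Fin.appendEquiv m n (a, a'))
        (Fin.appendEquiv m n (b, b')) =
      sgn ((∑ t, parE (b t)) * ∑ t, parE (b' t)) •
        (((elemBasis k p q m).repr x a • glCoeff g a b) *
          ((elemBasis k p q n).repr y a' • glCoeff g a' b')) := by
    intro a a'
    change (elemBasis k p q (m + n)).repr _ (Fin.append a a') •
      glCoeff g (Fin.append a a') (Fin.append b b') = _
    rw [repr_endProd, glCoeff_append]
    by_cases ha : (elemBasis k p q m).repr x a = 0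
    · simp [ha]
    · rw [glInvariants_even hx ha, zero_add, smul_comm, smul_mul_smul_comm]
  simp only [hterm, ← Finset.smul_sum, ← Finset.mul_sum, h₂]
  rw [← Finset.sum_mul, h₁]
  by_cases hb : (elemBasis k p q m).repr x b = 0
  · simp [hb]
  · rw [glInvariants_even hx hb, zero_mul, sgn_zero, one_smul, smul_mul_smul_comm, one_mul]

lemma endProd_idTensor (m n : ℕ) :
    endProd k p q m n (idTensor k p q m) (idTensor k p q n) = idTensor k p q (m + n) := by
  unfold idTensor
  simp only [map_sum, LinearMap.sum_apply, endProd_basis]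
  rw [← (Fin.appendEquiv m n).sum_comp, Fintype.sum_prod_type, Finset.sum_comm]
  refine Finset.sum_congr rfl fun α _ => Finset.sum_congr rfl fun β _ => ?_
  congr 1
  ext t <;> induction t using Fin.addCases <;> simp [Fin.appendEquiv]

lemma idTensor_zero_mem_glInvariants : idTensor k p q 0 ∈ glInvariants k p q 0 := by
  intro A _ _ 𝒜 _ hA g hg
  rw [idTensor, Fintype.sum_unique, glAction_basis, Fintype.sum_unique]
  have h1 : ∀ a b : Fin 0 → Idx p q × Idx p q, glCoeff g a b = 1 := fun a b => by simp [glCoeff]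
  rw [h1]
  congr 2
  exact Subsingleton.elim _ _

lemma idTensor_one_mem_glInvariants : idTensor k p q 1 ∈ glInvariants k p q 1 := by
  intro A _ _ 𝒜 _ hA g hg
  have hcoeff : ∀ a b : Fin 1 → Idx p q × Idx p q, glCoeff g a b = adCoeff g (a 0) (b 0) := by
    intro a b
    simp [glCoeff]
  have hsum : ∀ b : Idx p q × Idx p q, ∑ i, adCoeff g (i, i) b = if b.1 = b.2 then 1 else 0 := by
    intro b
    have hinv : (g : Matrix (Idx p q) (Idx p q) A) * (↑g⁻¹ : Matrix (Idx p q) (Idx p q) A) = 1 := by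
      simp
    have h0 : ∀ i : Idx p q, parE (i, i) = 0 := fun i => CharTwo.add_self_eq_zero _
    simp only [adCoeff, h0, zero_add]
    rw [← Finset.smul_sum, ← Matrix.mul_apply, hinv, Matrix.one_apply]
    split_ifs with h
    · rw [parE, h, CharTwo.add_self_eq_zero, zero_mul, sgn_zero, one_smul]
    · rw [smul_zero]
  have hid : idTensor k p q 1 = ∑ b : Fin 1 → Idx p q × Idx p q,
      if (b 0).1 = (b 0).2 then elemBasis k p q 1 b else 0 := by
    rw [idTensor, ← (Equiv.funUnique (Fin 1) _).symm.sum_comp,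
      ← (Equiv.funUnique (Fin 1) _).symm.sum_comp, Fintype.sum_prod_type]
    refine Finset.sum_congr rfl fun i _ => ?_
    rw [Finset.sum_eq_single i]
    · exact (if_pos rfl).symm
    · intro j _ hj
      exact if_neg (Ne.symm hj)
    · simp
  conv_lhs => rw [idTensor]
  simp only [map_sum, glAction_basis, hcoeff]
  rw [Finset.sum_comm, hid, TensorProduct.sum_tmul]
  refine Finset.sum_congr rfl fun b _ => ?_
  rw [← TensorProduct.tmul_sum, ← (Equiv.funUnique (Fin 1) _).symm.sum_comp]
  change elemBasis k p q 1 b ⊗ₜ[k] ∑ i, adCoeff g (i, i) (b 0) = _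
  rw [hsum]
  split_ifs <;> simp

lemma idTensor_mem_glInvariants [CharZero k] (n : ℕ) : idTensor k p q n ∈ glInvariants k p q n := by
  induction n with
  | zero => exact idTensor_zero_mem_glInvariants
  | succ n ih =>
    rw [← endProd_idTensor]
    exact endProd_mem_glInvariants ih idTensor_one_mem_glInvariants

lemma permTensor_mem_glInvariants [CharZero k] {n : ℕ} (x : MonoidAlgebra k (Equiv.Perm (Fin n))) :
    permTensor k p q n x ∈ glInvariants k p q n := by
  suffices h : LinearMap.range (permTensor k p q n) ≤ glInvariants k p q n from h ⟨x, rfl⟩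
  rw [LinearMap.range_eq_map, ← (MonoidAlgebra.basis (Equiv.Perm (Fin n)) k).span_eq,
    Submodule.map_span_le]
  rintro _ ⟨σ, rfl⟩
  rw [MonoidAlgebra.basis_apply, permTensor_eq_letterAct]
  exact letterAct_mem_glInvariants _ _ (idTensor_mem_glInvariants n)

end Invariants

/-! ### The structure maps on the tensors of permutations -/

section PermTensor

variable {k : Type u} [Field k] {p q : ℕ}

/-- The identity is even in each slot, so its slots are permuted without sign. -/
lemma letterAct_diag_idTensor {m n : ℕ} (e : Fin m ≃ Fin n) :
    letterAct k p q e e (idTensor k p q m) = idTensor k p q n := by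
  unfold idTensor
  rw [map_sum, ← (e.arrowCongr (Equiv.refl (Idx p q))).sum_comp]
  refine Finset.sum_congr rfl fun α _ => ?_
  rw [letterAct_basis, letterExp_diag]
  have h0 : koszulExp Fin.val (fun i => (e i).val)
      (fun t => letterPar (fun t => (α t, α t)) (.inl t)
      + letterPar (fun t => (α t, α t)) (.inr t)) = 0 := by
    simp [koszulExp, letterPar, CharTwo.add_self_eq_zero]
  rw [h0, sgn_zero, Int.cast_one, one_smul]
  rfl

lemma permTensor_act {m n : ℕ} (e : Fin m ≃ Fin n) (x : MonoidAlgebra k (Equiv.Perm (Fin m))) :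
    permTensor k p q n (permAct k e x) = endAct k p q e (permTensor k p q m x) := by
  suffices h : permTensor k p q n ∘ₗ permAct k e = endAct k p q e ∘ₗ permTensor k p q m from
    LinearMap.congr_fun h x
  refine (MonoidAlgebra.basis (Equiv.Perm (Fin m)) k).ext fun σ => ?_
  rw [LinearMap.comp_apply, LinearMap.comp_apply, permAct, Basis.constr_basis,
    MonoidAlgebra.basis_apply, permTensor_eq_letterAct, permTensor_eq_letterAct,
    endAct_eq_letterAct, ← letterAct_diag_idTensor e, ← letterAct_trans, ← letterAct_trans]
  congr 2
  ext i
  simp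

lemma permTensor_prod {m n : ℕ} (x : MonoidAlgebra k (Equiv.Perm (Fin m)))
    (y : MonoidAlgebra k (Equiv.Perm (Fin n))) :
    permTensor k p q (m + n) (permProd k m n x y) =
      endProd k p q m n (permTensor k p q m x) (permTensor k p q n y) := by
  suffices h : (permProd k m n).compr₂ (permTensor k p q (m + n)) =
      (endProd k p q m n).compl₁₂ (permTensor k p q m) (permTensor k p q n) from
    LinearMap.congr_fun₂ h x y
  refine (MonoidAlgebra.basis _ k).ext fun σ => (MonoidAlgebra.basis _ k).ext fun τ => ?_
  rw [LinearMap.compr₂_apply, LinearMap.compl₁₂_apply, permProd, Basis.constr_basis,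
    Basis.constr_basis, MonoidAlgebra.basis_apply, MonoidAlgebra.basis_apply,
    permTensor_eq_letterAct, permTensor_eq_letterAct, permTensor_eq_letterAct, endProd_letterAct,
    endProd_idTensor, juxtapose_one]

/-- Erase the label `0` from the cycles of a permutation. -/
def dropZero {n : ℕ} (σ : Equiv.Perm (Fin (n + 1))) : Equiv.Perm (Fin n) :=
  Equiv.removeNone ((finSuccEquiv n).permCongr σ)

lemma liftZero_dropZero {n : ℕ} (σ : Equiv.Perm (Fin (n + 1))) :
    liftZero (dropZero σ) = Equiv.swap 0 (σ 0) * σ := by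
  have h := map_equiv_removeNone ((finSuccEquiv n).permCongr σ)
  unfold liftZero dropZero
  rw [h]
  ext i
  have h0 : ((finSuccEquiv n).permCongr σ) none = finSuccEquiv n (σ 0) := by
    rw [Equiv.permCongr_apply, finSuccEquiv_symm_none]
  rw [h0, ← finSuccEquiv_zero (n := n)]
  simp [← (finSuccEquiv n).injective.map_swap, -finSuccEquiv_zero]

lemma eq_liftZero_dropZero_mul {n : ℕ} (σ : Equiv.Perm (Fin (n + 1))) :
    σ = liftZero (dropZero σ) * Equiv.swap (σ⁻¹ 0) 0 := by
  have h : σ⁻¹ (σ 0) = 0 := by simp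
  rw [liftZero_dropZero, Equiv.swap_mul_eq_mul_swap, h, mul_assoc, Equiv.swap_mul_self, mul_one]

lemma firstTrace_idTensor (n : ℕ) :
    firstTrace k p q n (idTensor k p q (n + 1)) = ((p : k) - q) • idTensor k p q n := by
  unfold idTensor
  rw [map_sum, ← (Fin.consEquiv fun _ : Fin (n + 1) => Idx p q).sum_comp, Fintype.sum_prod_type,
    Finset.sum_comm, Finset.smul_sum]
  refine Finset.sum_congr rfl fun α _ => ?_
  have h : ∀ i, firstTrace k p q n (elemBasis k p q (n + 1) fun t =>
      (Fin.consEquiv (fun _ : Fin (n + 1) => Idx p q) (i, α) t,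
        Fin.consEquiv (fun _ : Fin (n + 1) => Idx p q) (i, α) t)) =
      (sgn (par i) : k) • elemBasis k p q n fun t => (α t, α t) := by
    intro i
    rw [firstTrace_basis, superTrace_elem]
    simp [Fin.consEquiv]
  rw [Finset.sum_congr rfl fun i _ => h i, ← Finset.sum_smul]
  congr 1
  simp [Fintype.sum_sum_type, par, sgn_zero, sgn_one, sub_eq_add_neg]

/-- Tracing out the slot `0` of the transposition of the slots `0` and `1`. -/
lemma firstTrace_swap_one_idTensor (n : ℕ) :
    firstTrace k p q (n + 1) (letterAct k p q (Equiv.swap 0 1) 1 (idTensor k p q (n + 2))) =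
      idTensor k p q (n + 1) := by
  conv_lhs => unfold idTensor
  conv_rhs => unfold idTensor
  simp only [map_sum]
  rw [← (Fin.consEquiv fun _ : Fin (n + 2) => Idx p q).sum_comp, Fintype.sum_prod_type,
    Finset.sum_comm]
  refine Finset.sum_congr rfl fun α _ => ?_
  rw [Finset.sum_eq_single (α 0)]
  · rw [letterAct_basis, map_smul, firstTrace_basis, letterExp_swap_one, superTrace_elem]
    have h1 : (Fin.consEquiv (fun _ : Fin (n + 2) => Idx p q)) (α 0, α) 1 = α 0 := rfl
    have h0 : (Fin.consEquiv (fun _ : Fin (n + 2) => Idx p q)) (α 0, α) 0 = α 0 := rfl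
    simp only [letterPar, Sum.elim_inl, Sum.elim_inr, h0, h1, moveLetters, Equiv.symm_swap,
      Equiv.swap_apply_left, Equiv.Perm.one_def, Equiv.refl_symm, Equiv.refl_apply, if_true]
    rw [smul_smul, ← Int.cast_mul, ← sgn_add]
    have h2 : par (α 0) * par (α 0) + par (α 0) * par (α 0) + par (α 0) * par (α 0) +
        par (α 0) = 0 := by
      generalize par (α 0) = x
      revert x
      decide
    rw [h2, sgn_zero, Int.cast_one, one_smul]
    congr 1
    ext t
    · refine Fin.cases ?_ (fun t => ?_) t
      · simp [h0]
      · simp only [swap_zero_one_succ_succ]; rfl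
    · rfl
  · intro i _ hi
    rw [letterAct_basis, map_smul, firstTrace_basis, superTrace_elem, if_neg, zero_smul, smul_zero]
    have h1 : (Fin.consEquiv (fun _ : Fin (n + 2) => Idx p q)) (i, α) 1 = α 0 := rfl
    have h0 : (Fin.consEquiv (fun _ : Fin (n + 2) => Idx p q)) (i, α) 0 = i := rfl
    simp only [moveLetters, Equiv.symm_swap, Equiv.swap_apply_left, Equiv.Perm.one_def,
      Equiv.refl_symm, Equiv.refl_apply, h0, h1]
    exact Ne.symm hi
  · simp

lemma firstTrace_swap_idTensor (n : ℕ) (j : Fin n) :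
    firstTrace k p q n (letterAct k p q (Equiv.swap 0 j.succ) 1 (idTensor k p q (n + 1))) =
      idTensor k p q n := by
  obtain _ | n := n
  · exact j.elim0
  have h : Equiv.swap 0 j.succ = ((liftZero (Equiv.swap 0 j)).symm.trans
      (Equiv.swap (0 : Fin (n + 2)) 1)).trans (liftZero (Equiv.swap 0 j)) := by
    rw [Equiv.symm_trans_swap_trans, liftZero_zero, ← Fin.succ_zero_eq_one, liftZero_succ,
      Equiv.swap_apply_left]
  have h1 : (1 : Equiv.Perm (Fin (n + 2))) = ((liftZero (Equiv.swap 0 j)).symm.trans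
      (Equiv.refl (Fin (n + 2)))).trans (liftZero (Equiv.swap 0 j)) :=
    (Equiv.symm_trans_self _).symm
  rw [h, h1, letterAct_trans, letterAct_trans, liftZero_symm, letterAct_liftZero, ← liftZero_symm,
    letterAct_diag_idTensor]
  exact (congrArg _ (firstTrace_swap_one_idTensor n)).trans (letterAct_diag_idTensor _)

/-- The supertrace of the first tensor factor of `μ(σ)` erases the label `0` from the cycles of
`σ`; a fixed point `0` gives the superdimension. -/
lemma firstTrace_permTensor {n : ℕ} (σ : Equiv.Perm (Fin (n + 1))) :
    firstTrace k p q n (permTensor k p q (n + 1) (MonoidAlgebra.single σ 1)) =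
      ((p : k) - q) ^ (if σ 0 = 0 then 1 else 0) •
        permTensor k p q n (MonoidAlgebra.single (dropZero σ) 1) := by
  have h : letterAct k p q σ 1 (idTensor k p q (n + 1)) =
      letterAct k p q (liftZero (dropZero σ)) (liftZero 1)
        (letterAct k p q (Equiv.swap (σ⁻¹ 0) 0) 1 (idTensor k p q (n + 1))) := by
    rw [← letterAct_trans]
    congr 2
    · exact eq_liftZero_dropZero_mul σ
    · rw [liftZero_one]
      rfl
  suffices h' : firstTrace k p q n
      (letterAct k p q (Equiv.swap (σ⁻¹ 0) 0) 1 (idTensor k p q (n + 1))) =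
      ((p : k) - q) ^ (if σ 0 = 0 then 1 else 0) • idTensor k p q n by
    rw [permTensor_eq_letterAct, permTensor_eq_letterAct, h, letterAct_liftZero, h', map_smul]
  have hσ : σ 0 = 0 ↔ σ⁻¹ 0 = 0 := by
    rw [Equiv.Perm.inv_eq_iff_eq, eq_comm]
  simp only [hσ]
  generalize σ⁻¹ 0 = i
  refine Fin.cases ?_ (fun j => ?_) i
  · rw [if_pos rfl, pow_one, Equiv.swap_self, ← firstTrace_idTensor]
    exact congrArg _ (letterAct_refl _)
  · rw [if_neg (Fin.succ_ne_zero j), pow_zero, one_smul, Equiv.swap_comm,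
      firstTrace_swap_idTensor]

lemma removeNone_permCongr {α β : Type*} (e : α ≃ β) (ρ : Equiv.Perm (Option α)) :
    Equiv.removeNone (e.optionCongr.permCongr ρ) = e.permCongr (Equiv.removeNone ρ) := by
  ext x
  apply Option.some_injective
  obtain ⟨x, rfl⟩ := e.surjective x
  have hx : e.optionCongr.permCongr ρ (some (e x)) = (ρ (some x)).map e := by
    change (ρ (some (e.symm (e x)))).map e = _
    rw [Equiv.symm_apply_apply]
  have hn : e.optionCongr.permCongr ρ none = (ρ none).map e := rfl
  rw [Equiv.permCongr_apply, Equiv.symm_apply_apply]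
  rcases h : ρ (some x) with _ | y
  · rw [Equiv.removeNone_none _ (by rw [hx, h]; rfl), hn, ← Equiv.removeNone_none _ h]
    rfl
  · rw [Equiv.removeNone_some _ ⟨e y, by rw [hx, h]; rfl⟩, hx, ← Equiv.removeNone_some _ ⟨y, h⟩]
    rfl

lemma reglue_splitPerm {n : ℕ} (σ : Equiv.Perm (Fin (n + 2))) :
    reglue (splitPerm σ) = splitPerm (Equiv.swap 0 1 * σ) := by
  have h0 : finTwoEquiv n 0 = none := rfl
  have h1 : finTwoEquiv n 1 = some none := rfl
  unfold reglue splitPerm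
  rw [← h1, ← h0]
  ext1 x
  simp [← (finTwoEquiv n).injective.map_swap]

lemma removeNone_splitPerm {n : ℕ} (σ : Equiv.Perm (Fin (n + 2))) :
    Equiv.removeNone (splitPerm σ) = (finSuccEquiv n).permCongr (dropZero σ) := by
  rw [dropZero, ← removeNone_permCongr]
  rfl

lemma glue_splitPerm {n : ℕ} (σ : Equiv.Perm (Fin (n + 2))) :
    glue (splitPerm σ) = dropZero (dropZero (Equiv.swap 0 1 * σ)) := by
  rw [glue, reglue_splitPerm, removeNone_splitPerm]
  rfl

/-- Erasing `0` and then `1` from the cycles of the reglued permutation, an empty cycle arises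
each time the erased label is a fixed point. -/
lemma emptyCycles_splitPerm {n : ℕ} (σ : Equiv.Perm (Fin (n + 2))) :
    emptyCycles (splitPerm σ) =
      (if (Equiv.swap 0 1 * σ : Equiv.Perm (Fin (n + 2))) 0 = 0 then 1 else 0) +
      (if dropZero (Equiv.swap 0 1 * σ) 0 = 0 then 1 else 0) := by
  unfold emptyCycles
  rw [reglue_splitPerm]
  generalize Equiv.swap 0 1 * σ = τ
  have h0 : splitPerm τ none = none ↔ τ 0 = 0 := by
    have : splitPerm τ none = finTwoEquiv n (τ 0) := rfl
    rw [this, show (none : Option (Option (Fin n))) = finTwoEquiv n 0 from rfl,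
      (finTwoEquiv n).injective.eq_iff]
  have h1 : dropZero τ 0 = 0 ↔ splitPerm τ (some none) = some none ∨
      splitPerm τ (some none) = none ∧ splitPerm τ none = some none := by
    have h2 : dropZero τ 0 = 0 ↔ Equiv.removeNone (splitPerm τ) none = none := by
      rw [removeNone_splitPerm, Equiv.permCongr_apply, finSuccEquiv_symm_none,
        ← finSuccEquiv_zero, (finSuccEquiv n).injective.eq_iff]
    rw [h2, ← (Option.some_injective _).eq_iff]
    rcases h : splitPerm τ (some none) with _ | y
    · rw [Equiv.removeNone_none _ h]
      simp
    · rw [Equiv.removeNone_some _ ⟨y, h⟩, h]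
      simp
  simp only [← h0, h1]
  rcases splitPerm τ (some none) with _ | _ | y <;> simp

/-- The contraction of `μ(σ)`: the superdimension to the number of empty cycles, times `μ` of the
reglued permutation. -/
lemma endContr_permTensor_single {n : ℕ} (σ : Equiv.Perm (Fin (n + 2))) :
    endContr k p q n (permTensor k p q (n + 2) (MonoidAlgebra.single σ 1)) =
      ((p : k) - q) ^ emptyCycles (splitPerm σ) •
        permTensor k p q n (MonoidAlgebra.single (glue (splitPerm σ)) 1) := by
  have h : letterAct k p q (Equiv.swap 0 1) 1
      (permTensor k p q (n + 2) (MonoidAlgebra.single σ 1)) =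
      permTensor k p q (n + 2) (MonoidAlgebra.single (Equiv.swap 0 1 * σ) 1) := by
    rw [permTensor_eq_letterAct, permTensor_eq_letterAct, ← letterAct_trans]
    rfl
  rw [endContr_eq, h, firstTrace_permTensor, map_smul, firstTrace_permTensor, smul_smul, ← pow_add,
    emptyCycles_splitPerm, glue_splitPerm]

lemma permContr_single {n : ℕ} (σ : Equiv.Perm (Fin (n + 2))) :
    permContr k n (MonoidAlgebra.single σ 1) =
      if emptyCycles (splitPerm σ) = 0 then MonoidAlgebra.single (glue (splitPerm σ)) 1 else 0 := by
  rw [← MonoidAlgebra.basis_apply, permContr, Basis.constr_basis]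

/-- In superdimension zero the contraction of `𝒮` corresponds to the contraction of tensors. -/
lemma permTensor_contr {n : ℕ} (x : MonoidAlgebra k (Equiv.Perm (Fin (n + 2)))) :
    permTensor k p p n (permContr k n x) = endContr k p p n (permTensor k p p (n + 2) x) := by
  suffices h : permTensor k p p n ∘ₗ permContr k n =
      endContr k p p n ∘ₗ permTensor k p p (n + 2) from
    LinearMap.congr_fun h x
  refine (MonoidAlgebra.basis _ k).ext fun σ => ?_
  rw [LinearMap.comp_apply, LinearMap.comp_apply, MonoidAlgebra.basis_apply, permContr_single,
    endContr_permTensor_single, sub_self]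
  split_ifs with h
  · rw [h, pow_zero, one_smul]
  · rw [zero_pow h, zero_smul, map_zero]

lemma emptyCycles_pos {n : ℕ} {σ : Equiv.Perm (Fin (n + 2))} (h : σ 0 = 1 ∨ σ 1 = 0) :
    0 < emptyCycles (splitPerm σ) := by
  unfold emptyCycles
  rw [reglue_splitPerm]
  rcases h with h | h
  · have h0 : splitPerm (Equiv.swap 0 1 * σ) none = none := by
      change finTwoEquiv n ((Equiv.swap 0 1 * σ : Equiv.Perm (Fin (n + 2))) 0) = none
      rw [Equiv.Perm.mul_apply, h, Equiv.swap_apply_right]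
      rfl
    rw [if_pos h0]
    omega
  · have h0 : splitPerm (Equiv.swap 0 1 * σ) (some none) = some none := by
      change finTwoEquiv n ((Equiv.swap 0 1 * σ : Equiv.Perm (Fin (n + 2))) 1) = some none
      rw [Equiv.Perm.mul_apply, h, Equiv.swap_apply_left]
      rfl
    rw [if_pos h0]
    omega

end PermTensor

/-! ### The invariants are spanned by permutations -/

section Spanning

variable {k : Type u} [Field k] {p q : ℕ}

section ElementaryPoint

variable {A : Type u} [CommRing A] [Algebra k A] {𝒜 : ZMod 2 → Submodule k A}

/-- The elementary matrix `1 + ε E_{cd}` as a point of `GL(U)`. -/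
def elementaryPoint (ε : A) {c d : Idx p q} (hcd : c ≠ d) : (Matrix (Idx p q) (Idx p q) A)ˣ where
  val := 1 + Matrix.single c d ε
  inv := 1 - Matrix.single c d ε
  val_inv := by
    rw [mul_sub, mul_one, add_mul, one_mul, Matrix.single_mul_single_of_ne _ _ _ _ hcd.symm]
    abel
  inv_val := by
    rw [mul_add, mul_one, sub_mul, one_mul, Matrix.single_mul_single_of_ne _ _ _ _ hcd.symm]
    abel

variable {ε : A} {c d : Idx p q}

lemma elementaryPoint_isGLPoint [GradedAlgebra 𝒜] (hε : ε ∈ 𝒜 1) (hcd : par c + par d = 1)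
    (h : c ≠ d) : IsGLPoint 𝒜 (elementaryPoint ε h) := by
  intro i j
  change (1 + Matrix.single c d ε) i j ∈ _
  rw [Matrix.add_apply]
  refine add_mem ?_ ?_
  · rw [Matrix.one_apply]
    split_ifs with hij
    · rw [hij, CharTwo.add_self_eq_zero]
      exact SetLike.GradedOne.one_mem
    · exact zero_mem _
  · rw [Matrix.single_apply]
    split_ifs with hij
    · rw [← hij.1, ← hij.2, hcd]
      exact hε
    · exact zero_mem _

lemma adCoeff_elementaryPoint (h : c ≠ d) (a b : Idx p q × Idx p q) :
    adCoeff (elementaryPoint ε h) a b = sgn ((parE a + parE b) * par b.2) •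
      (((if b.1 = a.1 then 1 else 0) + if c = b.1 ∧ d = a.1 then ε else 0) *
        ((if a.2 = b.2 then 1 else 0) - if c = a.2 ∧ d = b.2 then ε else 0)) := by
  change _ • ((1 + Matrix.single c d ε) b.1 a.1 * (1 - Matrix.single c d ε) a.2 b.2) = _
  rw [Matrix.add_apply, Matrix.sub_apply, Matrix.one_apply, Matrix.one_apply, Matrix.single_apply,
    Matrix.single_apply]

lemma adCoeff_elementaryPoint_self (h : c ≠ d) (a : Idx p q × Idx p q) :
    adCoeff (elementaryPoint ε h) a a = 1 := by
  have h' : ∀ i, ¬ (c = i ∧ d = i) := fun i h' => h (h'.1.trans h'.2.symm)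
  rw [adCoeff_elementaryPoint, CharTwo.add_self_eq_zero, zero_mul, sgn_zero, if_neg (h' _),
    if_neg (h' _)]
  simp

lemma dvd_adCoeff_elementaryPoint (h : c ≠ d) {a b : Idx p q × Idx p q} (hab : a ≠ b) :
    ε ∣ adCoeff (elementaryPoint ε h) a b := by
  rw [adCoeff_elementaryPoint]
  refine dvd_smul_of_dvd _ ?_
  by_cases h2 : a.2 = b.2
  · refine Dvd.dvd.mul_right ?_ _
    rw [if_neg fun h1 => hab (Prod.ext h1.symm h2), zero_add]
    split_ifs <;> simp
  · refine Dvd.dvd.mul_left ?_ _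
    rw [if_neg h2, zero_sub, dvd_neg]
    split_ifs <;> simp

lemma adCoeff_elementaryPoint_of_ne (h : c ≠ d) (hε : ε * ε = 0) {a b : Idx p q × Idx p q}
    (hab : a.2 ≠ b.2) (h' : ¬ (a = (b.1, c) ∧ b.2 = d)) :
    adCoeff (elementaryPoint ε h) a b = 0 := by
  rw [adCoeff_elementaryPoint, if_neg hab]
  by_cases h1 : c = a.2 ∧ d = b.2
  · have h2 : b.1 ≠ a.1 := fun h2 => h' ⟨Prod.ext h2.symm h1.1.symm, h1.2.symm⟩
    rw [if_neg h2]
    split_ifs <;> simp [hε]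
  · simp [h1]

lemma glCoeff_eq_prod {n : ℕ} (g : (Matrix (Idx p q) (Idx p q) A)ˣ)
    (a b : Fin n → Idx p q × Idx p q) :
    glCoeff g a b = sgn (crossExp Fin.val (fun t => parE (a t)) fun t => parE (b t)) •
      ∏ t, adCoeff g (a t) (b t) := by
  rw [glCoeff_eq_crossExp, List.prod_ofFn]

end ElementaryPoint

/-- All coefficients of a tensor at the words with the dual letters `w` vanish. -/
def VanishesAt {n : ℕ} (z : EndPow k p q n) (w : Fin n → Idx p q) : Prop :=
  ∀ b : Fin n → Idx p q × Idx p q, (∀ t, (b t).2 = w t) → (elemBasis k p q n).repr z b = 0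

/-- If `z` is fixed by `1 + ε E_{cd}`, then the coefficient of `ε` at a word `b` gives a linear
relation between the coefficients of `z` at the words that arise from `b` by changing one letter
`c` into `d`, or one dual letter `d` into `c`. If the dual letters of `b` are `w`, and `d` occurs
only once in `w`, a single term remains. -/
lemma VanishesAt.update_of_fixed {A : Type u} [CommRing A] [Algebra k A] {ε : A} (hε : ε * ε = 0)
    (hε' : ε ≠ 0) {n : ℕ} {z : EndPow k p q n} {w : Fin n → Idx p q} (hw : VanishesAt z w)
    {t : Fin n} (ht : ∀ s, s ≠ t → w s ≠ w t) {c : Idx p q} (h : c ≠ w t)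
    (hz : glAction (elementaryPoint ε h) z = z ⊗ₜ[k] (1 : A)) :
    VanishesAt z (Function.update w t c) := by
  intro a ha
  have hat : (a t).2 = c := by rw [ha, Function.update_self]
  let b := Function.update a t ((a t).1, w t)
  have hbt : b t = ((a t).1, w t) := Function.update_self ..
  have hbs : ∀ s, s ≠ t → b s = a s := fun s hs => Function.update_of_ne hs _ _
  have hb : ∀ s, (b s).2 = w s := by
    intro s
    by_cases hs : s = t
    · rw [hs, hbt]
    · rw [hbs s hs, ha, Function.update_of_ne hs]
  have hrel := (glAction_eq_iff _ z).1 hz b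
  rw [hw b hb, zero_smul, Finset.sum_eq_single a] at hrel
  · have hprod : ∏ s, adCoeff (elementaryPoint ε h) (a s) (b s) =
        adCoeff (elementaryPoint ε h) (a t) (b t) := by
      refine Finset.prod_eq_single t (fun s _ hs => ?_) (by simp)
      rw [hbs s hs, adCoeff_elementaryPoint_self]
    rw [glCoeff_eq_prod, hprod, adCoeff_elementaryPoint, hbt, hat, if_pos rfl, if_neg h,
      if_neg (fun h1 => h (h1.1.trans h1.2.symm) : ¬ (c = (a t).1 ∧ w t = (a t).1)),
      if_pos ⟨rfl, rfl⟩] at hrel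
    by_contra hne
    rw [smul_eq_zero_iff_right hne, smul_smul, ← sgn_add, add_zero, one_mul, zero_sub] at hrel
    unfold sgn at hrel
    split_ifs at hrel <;> simp [hε'] at hrel
  · intro a' _ ha'
    by_cases hw' : ∀ s, (a' s).2 = w s
    · rw [hw a' hw', zero_smul]
    push Not at hw'
    obtain ⟨s, hs⟩ := hw'
    rw [← hb s] at hs
    suffices h0 : ∏ s, adCoeff (elementaryPoint ε h) (a' s) (b s) = 0 by
      rw [glCoeff_eq_prod, h0, smul_zero, smul_zero]
    by_cases h1 : a' s = ((b s).1, c) ∧ (b s).2 = w t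
    · have hst : s = t := by
        by_contra hst
        exact ht s hst ((hb s).symm.trans h1.2)
      subst hst
      obtain ⟨r, hr⟩ := Function.ne_iff.1 ha'
      have hrs : r ≠ s := by
        rintro rfl
        apply hr
        rw [h1.1, hbt]
        exact Prod.ext rfl hat.symm
      -- two of the factors are divisible by `ε`
      have hd1 := dvd_adCoeff_elementaryPoint (ε := ε) h (fun h2 => hs (congrArg Prod.snd h2))
      have hd2 : ε ∣ adCoeff (elementaryPoint ε h) (a' r) (b r) :=
        dvd_adCoeff_elementaryPoint h (by rwa [hbs r hrs])
      have hd := Finset.prod_dvd_prod_of_subset {s, r} Finset.univ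
        (fun s => adCoeff (elementaryPoint ε h) (a' s) (b s)) (Finset.subset_univ _)
      rw [Finset.prod_pair hrs.symm] at hd
      have hd' := (mul_dvd_mul hd1 hd2).trans hd
      rwa [hε, zero_dvd_iff] at hd'
    · exact Finset.prod_eq_zero (Finset.mem_univ s) (adCoeff_elementaryPoint_of_ne h hε hs h1)
  · simp

lemma ne_of_par_add_par {c d : Idx p q} (h : par c + par d = 1) : c ≠ d := by
  rintro rfl
  rw [CharTwo.add_self_eq_zero] at h
  exact zero_ne_one h

/-- A dual letter that occurs only once may be changed into any letter of the other parity. -/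
lemma VanishesAt.update {n : ℕ} {z : EndPow k p q n} (hz : z ∈ glInvariants k p q n)
    {w : Fin n → Idx p q} (hw : VanishesAt z w) {t : Fin n} (ht : ∀ s, s ≠ t → w s ≠ w t)
    {c : Idx p q} (hc : par c + par (w t) = 1) : VanishesAt z (Function.update w t c) := by
  have hε : (DualNumber.eps : DualNumber k) ∈ dualGr k 1 := by
    rw [mem_dualGr_one, DualNumber.fst_eps]
  have hε' : (DualNumber.eps : DualNumber k) ≠ 0 := fun h => by
    have h' := congrArg TrivSqZeroExt.snd h
    simp at h'
  exact hw.update_of_fixed DualNumber.eps_mul_eps hε' ht (ne_of_par_add_par hc)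
    (hz _ _ dualGr_isSupercommutative _ (elementaryPoint_isGLPoint hε hc _))

/-- Several dual letters of parity `i`, each of which occurs only once, may be changed into
letters of parity `i + 1`: the new letters do not interfere with those that are still to be
changed. -/
lemma VanishesAt.piecewise {n : ℕ} {z : EndPow k p q n} (hz : z ∈ glInvariants k p q n)
    {v : Fin n → Idx p q} (hv : VanishesAt z v) (u : Fin n → Idx p q) (S : Finset (Fin n))
    (i : ZMod 2) (hvi : ∀ t ∈ S, par (v t) = i) (hui : ∀ t ∈ S, par (u t) = i + 1)
    (h : ∀ t ∈ S, ∀ s, s ≠ t → v s ≠ v t) : VanishesAt z (S.piecewise u v) := by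
  induction S using Finset.induction_on with
  | empty => simpa using hv
  | insert t S ht ih =>
    have ih := ih (fun s hs => hvi s (Finset.mem_insert_of_mem hs))
      (fun s hs => hui s (Finset.mem_insert_of_mem hs))
      (fun s hs => h s (Finset.mem_insert_of_mem hs))
    have htS := Finset.mem_insert_self t S
    have hvt : S.piecewise u v t = v t := Finset.piecewise_eq_of_notMem _ _ _ ht
    have hp : par (u t) + par (v t) = 1 := by
      rw [hui t htS, hvi t htS, add_right_comm, CharTwo.add_self_eq_zero, zero_add]
    rw [Finset.piecewise_insert]
    refine ih.update hz (fun s hs => ?_) (by rwa [hvt])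
    rw [hvt]
    by_cases hsS : s ∈ S
    · rw [Finset.piecewise_eq_of_mem _ _ _ hsS]
      intro h'
      have h1 := hui s (Finset.mem_insert_of_mem hsS)
      rw [h', hvi t htS] at h1
      exact zero_ne_one (add_left_cancel ((add_zero i).trans h1))
    · rw [Finset.piecewise_eq_of_notMem _ _ _ hsS]
      exact h t htS s hs

/-- The word of the first `n` even labels. -/
def evenWord {n : ℕ} (h : n ≤ p) (t : Fin n) : Idx p q := Sum.inl (Fin.castLE h t)

lemma evenWord_injective {n : ℕ} (h : n ≤ p) :
    Function.Injective (evenWord h : Fin n → Idx p q) :=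
  Sum.inl_injective.comp (Fin.castLE_injective h)

lemma par_evenWord {n : ℕ} (h : n ≤ p) (t : Fin n) : par (evenWord h t : Idx p q) = 0 := rfl

/-- From the word of even labels, all words are reached by changing, one at a time, a label that
occurs only once into a label of the other parity. Slots with odd targets change directly; the
others pass through odd labels that occur nowhere else, which exist since `n ≤ q`. -/
lemma VanishesAt.of_evenWord {n : ℕ} (hp : n ≤ p) (hq : n ≤ q) {z : EndPow k p q n}
    (hz : z ∈ glInvariants k p q n) (h : VanishesAt z (evenWord hp)) (w : Fin n → Idx p q) :
    VanishesAt z w := by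
  classical
  obtain ⟨S, hS⟩ : ∃ S : Finset (Fin n), S = Finset.univ.filter fun t => par (w t) = 1 := ⟨_, rfl⟩
  have hS1 : ∀ t, t ∈ S → par (w t) = 1 := fun t ht => by simpa [hS] using ht
  have hS0 : ∀ t, t ∉ S → par (w t) = 0 := fun t ht =>
    (zmod_two_cases _).resolve_right (by simpa [hS] using ht)
  have h1 := h.piecewise hz w S 0 (fun t _ => par_evenWord hp t) (fun t ht => hS1 t ht)
    (fun t _ s hs => (evenWord_injective hp).ne hs)
  -- the odd labels in use, and the fresh ones
  obtain ⟨f, hf, hf'⟩ : ∃ f : Fin n → Fin q, (∀ t ∉ S, ∀ s ∉ S, f s = f t → s = t) ∧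
      ∀ t ∉ S, ∀ s ∈ S, w s ≠ Sum.inr (f t) := by
    let B : Finset (Fin q) := Finset.univ.filter fun j => ∃ s ∈ S, w s = Sum.inr j
    have hB : B.card ≤ S.card := by
      have hsub : B.image (Sum.inr : Fin q → Idx p q) ⊆ S.image w := by
        intro x hx
        obtain ⟨j, hj, rfl⟩ := Finset.mem_image.1 hx
        obtain ⟨s, hs, hsj⟩ := (Finset.mem_filter.1 hj).2
        exact Finset.mem_image.2 ⟨s, hs, hsj⟩
      have hc := (Finset.card_le_card hsub).trans Finset.card_image_le
      rwa [Finset.card_image_of_injective _ Sum.inr_injective] at hc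
    have hcard : Fintype.card {t // t ∈ Sᶜ} ≤ Fintype.card {j // j ∈ Bᶜ} := by
      rw [Fintype.card_coe, Fintype.card_coe, Finset.card_compl, Finset.card_compl,
        Fintype.card_fin, Fintype.card_fin]
      omega
    obtain ⟨φ⟩ := Function.Embedding.nonempty_of_card_le hcard
    refine ⟨fun t => if ht : t ∈ Sᶜ then φ ⟨t, ht⟩ else Fin.castLE hq t, ?_, ?_⟩
    · intro t ht s hs hst
      simp only [dif_pos (Finset.mem_compl.2 ht), dif_pos (Finset.mem_compl.2 hs)] at hst
      exact congrArg Subtype.val (φ.injective (Subtype.ext hst))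
    · intro t ht s hs hst
      simp only [dif_pos (Finset.mem_compl.2 ht)] at hst
      exact Finset.mem_compl.1 (φ ⟨t, _⟩).2 (Finset.mem_filter.2 ⟨Finset.mem_univ _, s, hs, hst⟩)
  have hv1 : ∀ t ∉ S, S.piecewise w (evenWord hp) t = evenWord hp t := fun t ht =>
    Finset.piecewise_eq_of_notMem _ _ _ ht
  have hv2 : ∀ t ∈ S, S.piecewise w (evenWord hp) t = w t := fun t ht =>
    Finset.piecewise_eq_of_mem _ _ _ ht
  have h2 := h1.piecewise hz (fun t => Sum.inr (f t)) Sᶜ 0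
    (fun t ht => by rw [hv1 t (Finset.mem_compl.1 ht)]; rfl) (fun t _ => rfl)
    (fun t ht s hs => by
      rw [hv1 t (Finset.mem_compl.1 ht)]
      by_cases hsS : s ∈ S
      · rw [hv2 s hsS]
        intro h'
        have := hS1 s hsS
        rw [h', par_evenWord] at this
        exact zero_ne_one this
      · rw [hv1 s hsS]
        exact (evenWord_injective hp).ne hs)
  have hu1 : ∀ t ∉ S, Sᶜ.piecewise (fun t => Sum.inr (f t)) (S.piecewise w (evenWord hp)) t =
      Sum.inr (f t) := fun t ht => Finset.piecewise_eq_of_mem _ _ _ (Finset.mem_compl.2 ht)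
  have hu2 : ∀ t ∈ S, Sᶜ.piecewise (fun t => Sum.inr (f t)) (S.piecewise w (evenWord hp)) t =
      w t := fun t ht => by
    rw [Finset.piecewise_eq_of_notMem _ _ _ (by simpa using ht), hv2 t ht]
  have h3 := h2.piecewise hz w Sᶜ 1
    (fun t ht => by rw [hu1 t (Finset.mem_compl.1 ht)]; rfl)
    (fun t ht => by rw [hS0 t (Finset.mem_compl.1 ht)]; decide)
    (fun t ht s hs => by
      rw [hu1 t (Finset.mem_compl.1 ht)]
      by_cases hsS : s ∈ S
      · rw [hu2 s hsS]
        exact hf' t (Finset.mem_compl.1 ht) s hsS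
      · rw [hu1 s hsS]
        exact fun h' => hs (hf t (Finset.mem_compl.1 ht) s hsS (Sum.inr_injective h')))
  convert h3 using 1
  ext1 t
  by_cases ht : t ∈ S
  · rw [Finset.piecewise_eq_of_notMem _ _ _ (by simpa using ht), hu2 t ht]
  · rw [Finset.piecewise_eq_of_mem _ _ _ (Finset.mem_compl.2 ht)]

lemma eq_zero_of_vanishesAt {n : ℕ} (hp : n ≤ p) (hq : n ≤ q) {z : EndPow k p q n}
    (hz : z ∈ glInvariants k p q n) (h : VanishesAt z (evenWord hp)) : z = 0 := by
  refine (elemBasis k p q n).ext_elem fun b => ?_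
  rw [map_zero, Finsupp.zero_apply]
  exact (h.of_evenWord hp hq hz fun t => (b t).2) b fun _ => rfl

/-- The coefficients of an invariant are supported on words whose two rows of letters have the
same content. -/
lemma card_filter_eq [CharZero k] {n : ℕ} {x : EndPow k p q n} (hx : x ∈ glInvariants k p q n)
    {b : Fin n → Idx p q × Idx p q} (hb : (elemBasis k p q n).repr x b ≠ 0) (i : Idx p q) :
    (Finset.univ.filter fun t => (b t).1 = i).card =
      (Finset.univ.filter fun t => (b t).2 = i).card := by
  let two : kˣ := Units.mk0 2 two_ne_zero
  have h := congrArg Units.val (prod_torus_eq hx (fun j => if j = i then two else 1) hb)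
  rw [Finset.prod_ite, Finset.prod_ite] at h
  simp only [Finset.prod_const, one_pow, mul_one, Units.val_pow_eq_pow_val] at h
  refine Nat.pow_right_injective le_rfl (Nat.cast_injective (R := k) ?_)
  simpa [two] using h

lemma exists_perm_of_repr_ne_zero [CharZero k] {n : ℕ} {x : EndPow k p q n}
    (hx : x ∈ glInvariants k p q n) {b : Fin n → Idx p q × Idx p q}
    (hb : (elemBasis k p q n).repr x b ≠ 0) (hinj : Function.Injective fun t => (b t).2) :
    ∃ σ : Equiv.Perm (Fin n), ∀ t, (b t).1 = (b (σ.symm t)).2 := by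
  have hcard := card_filter_eq hx hb
  have hle : ∀ i, (Finset.univ.filter fun t => (b t).1 = i).card ≤ 1 := by
    intro i
    rw [hcard, Finset.card_le_one]
    intro s hs t ht
    exact hinj ((Finset.mem_filter.1 hs).2.trans (Finset.mem_filter.1 ht).2.symm)
  have hex : ∀ t, ∃ s, (b t).1 = (b s).2 := by
    intro t
    have hpos : 0 < (Finset.univ.filter fun s => (b s).2 = (b t).1).card := by
      rw [← hcard, Finset.card_pos]
      exact ⟨t, Finset.mem_filter.2 ⟨Finset.mem_univ _, rfl⟩⟩
    obtain ⟨s, hs⟩ := Finset.card_pos.1 hpos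
    exact ⟨s, (Finset.mem_filter.1 hs).2.symm⟩
  choose f hf using hex
  have hfinj : Function.Injective f := by
    intro s t hst
    refine Finset.card_le_one.1 (hle (b s).1) s (by simp) t ?_
    rw [Finset.mem_filter, hf s, hf t, hst]
    exact ⟨Finset.mem_univ _, rfl⟩
  exact ⟨(Equiv.ofBijective f (Finite.injective_iff_bijective.1 hfinj)).symm, hf⟩

/-- The coefficients of `μ(x)` at words of even labels. -/
lemma repr_permTensor {n : ℕ} (hp : n ≤ p) (x : MonoidAlgebra k (Equiv.Perm (Fin n)))
    (σ : Equiv.Perm (Fin n)) :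
    (elemBasis k p q n).repr (permTensor k p q n x)
        (fun t => (evenWord hp (σ.symm t), evenWord hp t)) =
      (MonoidAlgebra.basis (Equiv.Perm (Fin n)) k).repr x σ := by
  suffices h : (elemBasis k p q n).coord (fun t => (evenWord hp (σ.symm t), evenWord hp t)) ∘ₗ
      permTensor k p q n = (MonoidAlgebra.basis (Equiv.Perm (Fin n)) k).coord σ from
    LinearMap.congr_fun h x
  refine (MonoidAlgebra.basis (Equiv.Perm (Fin n)) k).ext fun τ => ?_
  rw [LinearMap.comp_apply, Basis.coord_apply, Basis.coord_apply, Basis.repr_self,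
    MonoidAlgebra.basis_apply, permTensor_single, map_sum, Finsupp.finsetSum_apply,
    Finset.sum_eq_single (evenWord hp)]
  · have h0 : letterExp τ 1 (Sum.elim (fun t => par (evenWord hp t : Idx p q))
        (fun t => par (evenWord hp t : Idx p q))) = 0 := by
      simp [letterExp, koszulExp, par_evenWord]
    rw [h0, sgn_zero, Int.cast_one, one_smul, Basis.repr_self, Finsupp.single_apply,
      Finsupp.single_apply]
    refine if_congr ?_ rfl rfl
    constructor
    · intro h
      refine Equiv.symm_bijective.injective (Equiv.ext fun t => ?_)
      exact evenWord_injective hp (congrArg Prod.fst (congrFun h t))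
    · rintro rfl
      rfl
  · intro α _ hα
    rw [map_smul, Finsupp.smul_apply, Basis.repr_self, Finsupp.single_apply, if_neg, smul_zero]
    intro h
    exact hα (funext fun t => congrArg Prod.snd (congrFun h t))
  · simp

/-- The words of even labels `0, …, n - 1` separate the permutations. -/
lemma permTensor_injective {n : ℕ} (hp : n ≤ p) : Function.Injective (permTensor k p q n) := by
  intro x y h
  refine (MonoidAlgebra.basis (Equiv.Perm (Fin n)) k).ext_elem fun σ => ?_
  rw [← repr_permTensor (q := q) hp, ← repr_permTensor (q := q) hp, h]

/-- The first fundamental theorem of invariant theory for `GL(p|q)` in the stable range. -/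
lemma exists_permTensor_eq [CharZero k] {n : ℕ} (hp : n ≤ p) (hq : n ≤ q) {x : EndPow k p q n}
    (hx : x ∈ glInvariants k p q n) : ∃ y, permTensor k p q n y = x := by
  let y := ∑ σ : Equiv.Perm (Fin n), (elemBasis k p q n).repr x
    (fun t => (evenWord hp (σ.symm t), evenWord hp t)) •
      MonoidAlgebra.basis (Equiv.Perm (Fin n)) k σ
  have hy : ∀ σ, (MonoidAlgebra.basis (Equiv.Perm (Fin n)) k).repr y σ =
      (elemBasis k p q n).repr x (fun t => (evenWord hp (σ.symm t), evenWord hp t)) := by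
    intro σ
    rw [Basis.repr_sum_self]
  refine ⟨y, (sub_eq_zero.1 (eq_zero_of_vanishesAt hp hq
    (sub_mem hx (permTensor_mem_glInvariants y)) ?_)).symm⟩
  intro b hb
  by_contra hne
  obtain ⟨σ, hσ⟩ := exists_perm_of_repr_ne_zero (sub_mem hx (permTensor_mem_glInvariants y)) hne (by
    simp only [hb]
    exact evenWord_injective hp)
  have hbσ : b = fun t => (evenWord hp (σ.symm t), evenWord hp t) :=
    funext fun t => Prod.ext ((hσ t).trans (hb _)) (hb t)
  rw [hbσ, map_sub, Finsupp.sub_apply, repr_permTensor, hy, sub_self] at hne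
  exact hne rfl

end Spanning

/-! ### Transport of the axioms of a modular operad -/

namespace PreModularOperad

variable {k : Type u} [Field k]

/-- The axioms of a modular operad are equations between structure maps, so they may be checked
after a jointly injective family of morphisms to modular operads. -/
theorem IsModularOperad.of_jointly_injective {ι : Type*} {P : PreModularOperad k}
    {Q : ι → PreModularOperad k} (hQ : ∀ N, (Q N).IsModularOperad)
    (f : ∀ N n, P.V n →ₗ[k] (Q N).V n)
    (hf : ∀ (n : ℕ) (x y : P.V n), (∀ N, f N n x = f N n y) → x = y)
    (hgr : ∀ (n : ℕ) (i : ZMod 2) (x : P.V n), x ∈ P.gr n i ↔ ∀ N, f N n x ∈ (Q N).gr n i)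
    (hint : ∀ n, DirectSum.IsInternal (P.gr n))
    (hact : ∀ (N : ι) {m n : ℕ} (e : Fin m ≃ Fin n) (x : P.V m),
      f N n (P.act e x) = (Q N).act e (f N m x))
    (hcontr : ∀ (N : ι) (n : ℕ) (x : P.V (n + 2)),
      f N n (P.contr n x) = (Q N).contr n (f N (n + 2) x))
    (hcomp : ∀ (N : ι) (m n : ℕ) (x : P.V (m + 1)) (y : P.V (n + 1)),
      f N (m + n) (P.comp m n x y) = (Q N).comp m n (f N (m + 1) x) (f N (n + 1) y)) :
    P.IsModularOperad where
  gr_internal := hint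
  act_even e i x hx := (hgr _ _ _).2 fun N => by
    rw [hact]
    exact (hQ N).act_even e i _ ((hgr _ _ _).1 hx N)
  contr_even n i x hx := (hgr _ _ _).2 fun N => by
    rw [hcontr]
    exact (hQ N).contr_even n i _ ((hgr _ _ _).1 hx N)
  comp_even m n i j x y hx hy := (hgr _ _ _).2 fun N => by
    rw [hcomp]
    exact (hQ N).comp_even m n i j _ _ ((hgr _ _ _).1 hx N) ((hgr _ _ _).1 hy N)
  act_refl n x := hf _ _ _ fun N => by rw [hact, (hQ N).act_refl]
  act_trans e e' x := hf _ _ _ fun N => by simp only [hact, (hQ N).act_trans]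
  contr_act e x := hf _ _ _ fun N => by simp only [hact, hcontr, (hQ N).contr_act]
  contr_swap n x := hf _ _ _ fun N => by simp only [hact, hcontr, (hQ N).contr_swap]
  comp_act e e' x y := hf _ _ _ fun N => by simp only [hact, hcomp, (hQ N).comp_act]
  comp_comm m n i j x y hx hy := hf _ _ _ fun N => by
    rw [map_zsmul, hact, hcomp, hcomp]
    exact (hQ N).comp_comm m n i j _ _ ((hgr _ _ _).1 hx N) ((hgr _ _ _).1 hy N)
  contr_contr n x := hf _ _ _ fun N => by simp only [hact, hcontr, (hQ N).contr_contr]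
  contr_comp m n x y := hf _ _ _ fun N => by
    simp only [hact, hcontr, hcomp, (hQ N).contr_comp]
  contr_comp_left m n x y := hf _ _ _ fun N => by
    simp only [hact, hcontr, hcomp, (hQ N).contr_comp_left]
  comp_assoc l m n x y z := hf _ _ _ fun N => by
    simp only [hact, hcomp, (hQ N).comp_assoc]

theorem IsModularOperad.of_iso {P Q : PreModularOperad k} (hP : P.IsModularOperad) (Φ : Iso P Q) :
    Q.IsModularOperad := by
  refine .of_jointly_injective (ι := Unit) (fun _ => hP)
    (fun _ n => ((Φ.equiv n).symm : Q.V n →ₗ[k] P.V n))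
    (fun n x y h => (Φ.equiv n).symm.injective (h ()))
    (fun n i x => ?_) (fun n => ?_) (fun _ m n e x => ?_) (fun _ n x => ?_) (fun _ m n x y => ?_)
  · rw [← Φ.map_gr, Submodule.mem_map_equiv]
    exact ⟨fun h _ => h, fun h => h ()⟩
  · rw [isInternal_iff_isCompl, ← Φ.map_gr, ← Φ.map_gr]
    exact (Submodule.orderIsoMapComap (Φ.equiv n)).isCompl
      ((isInternal_iff_isCompl _).1 (hP.gr_internal n))
  · obtain ⟨x, rfl⟩ := (Φ.equiv m).surjective x
    rw [← Φ.map_act]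
    simp
  · obtain ⟨x, rfl⟩ := (Φ.equiv (n + 2)).surjective x
    rw [← Φ.map_contr]
    simp
  · obtain ⟨x, rfl⟩ := (Φ.equiv (m + 1)).surjective x
    obtain ⟨y, rfl⟩ := (Φ.equiv (n + 1)).surjective y
    rw [← Φ.map_comp]
    simp

end PreModularOperad

/-! ### The modular operads of permutations and of invariants -/

section Invariants

open PreModularOperad

variable {k : Type u} [Field k] {p q : ℕ}

lemma disjoint_endGr (n : ℕ) : Disjoint (endGr k p q n 0) (endGr k p q n 1) :=
  ((isInternal_iff_isCompl _).1 (endOperad_isModularOperad.gr_internal n)).disjoint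

lemma mem_endGr_zero_of_invariant [CharZero k] {n : ℕ} {x : EndPow k p q n}
    (hx : x ∈ glInvariants k p q n) : x ∈ endGr k p q n 0 := by
  rw [← (elemBasis k p q n).sum_repr x]
  refine sum_mem fun a _ => ?_
  by_cases ha : (elemBasis k p q n).repr x a = 0
  · rw [ha, zero_smul]
    exact zero_mem _
  · rw [← glInvariants_even hx ha]
    exact Submodule.smul_mem _ _ (elemBasis_mem_endGr a)

lemma eq_zero_of_invariant_of_odd [CharZero k] {n : ℕ} {x : EndPow k p q n}
    (hx : x ∈ glInvariants k p q n) (h : x ∈ endGr k p q n 1) : x = 0 :=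
  Submodule.disjoint_def.1 (disjoint_endGr n) x (mem_endGr_zero_of_invariant hx) h

lemma permTensor_comp {m n : ℕ} (x : MonoidAlgebra k (Equiv.Perm (Fin (m + 1))))
    (y : MonoidAlgebra k (Equiv.Perm (Fin (n + 1)))) :
    permTensor k p p (m + n) ((permOperad k).comp m n x y) =
      endComp k p p m n (permTensor k p p (m + 1) x) (permTensor k p p (n + 1) y) := by
  rw [endComp, ← permTensor_prod, ← permTensor_act, ← permTensor_contr]
  rfl

theorem permOperad_isModularOperad [CharZero k] : (permOperad k).IsModularOperad := by
  refine .of_jointly_injective (ι := ℕ) (Q := fun N => endOperad k N N)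
    (fun N => endOperad_isModularOperad) (fun N n => permTensor k N N n)
    (fun n x y h => permTensor_injective le_rfl (h n)) (fun n i x => ?_) (fun n => ?_)
    (fun N m n e x => permTensor_act e x) (fun N n x => permTensor_contr x)
    (fun N m n x y => permTensor_comp x y)
  · rcases zmod_two_cases i with rfl | rfl
    · exact ⟨fun _ N => mem_endGr_zero_of_invariant (permTensor_mem_glInvariants x), fun _ =>
        Submodule.mem_top (R := k) (M := MonoidAlgebra k (Equiv.Perm (Fin n))) (x := x)⟩
    · refine ⟨fun h N => ?_, fun h => ?_⟩
      · have hx : x = 0 := h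
        have h0 : permTensor k N N n 0 ∈ endGr k N N n 1 := by
          rw [map_zero]
          exact zero_mem _
        rw [hx]
        exact h0
      · have hx := eq_zero_of_invariant_of_odd (permTensor_mem_glInvariants x) (h n)
        exact permTensor_injective (p := n) le_rfl (hx.trans (map_zero _).symm)
  · rw [isInternal_iff_isCompl]
    exact isCompl_top_bot

variable (k p q) in
/-- The suboperad of the invariants of `GL(U)`. -/
def invariantSuboperad [CharZero k] : (endOperad k p q).Suboperad where
  carrier n := glInvariants k p q n
  act_mem e _ hx := endAct_mem_glInvariants e hx
  contr_mem _ _ hx := endContr_mem_glInvariants hx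
  comp_mem _ _ _ _ hx hy :=
    endContr_mem_glInvariants (endAct_mem_glInvariants _ (endProd_mem_glInvariants hx hy))

theorem invariantSuboperad_isModularOperad [CharZero k] :
    (invariantSuboperad k p q).toPre.IsModularOperad := by
  refine .of_jointly_injective (ι := Unit) (Q := fun _ => endOperad k p q)
    (fun N => endOperad_isModularOperad) (fun _ n => (glInvariants k p q n).subtype)
    (fun n x y h => Subtype.ext (h ())) (fun n i x => ⟨fun h _ => h, fun h => h ()⟩) (fun n => ?_)
    (fun N m n e x => rfl) (fun N n x => rfl) (fun N m n x y => rfl)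
  have h0 : (invariantSuboperad k p q).toPre.gr n 0 = ⊤ :=
    eq_top_iff.2 fun x _ => mem_endGr_zero_of_invariant x.2
  have h1 : (invariantSuboperad k p q).toPre.gr n 1 = ⊥ :=
    eq_bot_iff.2 fun x hx => Subtype.ext (eq_zero_of_invariant_of_odd x.2 hx)
  rw [isInternal_iff_isCompl, h0, h1]
  exact isCompl_top_bot

end Invariants

/-! ### Compressions and the stable limit -/

section Stable

open PreModularOperad

variable {k : Type u} [Field k]

/-- The inclusion of the labels of `k^{N|N}` into those of `k^{N+1|N+1}`. -/
def idxSucc {N : ℕ} : Idx N N → Idx (N + 1) (N + 1) := Sum.map Fin.castSucc Fin.castSucc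

lemma idxSucc_injective {N : ℕ} : Function.Injective (idxSucc : Idx N N → _) :=
  (Fin.castSucc_injective _).sumMap (Fin.castSucc_injective _)

lemma par_idxSucc {N : ℕ} (i : Idx N N) : par (idxSucc i) = par i := by
  rcases i with i | i <;> rfl

/-- In coordinates, the compression restricts to the words in the labels of `k^{N|N}`. -/
lemma repr_compressPow {N n : ℕ} (x : EndPow k (N + 1) (N + 1) n) (b : Fin n → Idx N N × Idx N N) :
    (elemBasis k N N n).repr (compressPow k N n x) b =
      (elemBasis k (N + 1) (N + 1) n).repr x fun t => (idxSucc (b t).1, idxSucc (b t).2) := by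
  suffices h : (elemBasis k N N n).coord b ∘ₗ compressPow k N n =
      (elemBasis k (N + 1) (N + 1) n).coord fun t => (idxSucc (b t).1, idxSucc (b t).2) from
    LinearMap.congr_fun h x
  refine (elemBasis k (N + 1) (N + 1) n).ext fun a => ?_
  rw [LinearMap.comp_apply, Basis.coord_apply, Basis.coord_apply, Basis.repr_self]
  have ha : elemBasis k (N + 1) (N + 1) n a = PiTensorProduct.tprod k fun t => elem k (a t) :=
    Basis.piTensorProduct_apply ..
  rw [ha, compressPow, PiTensorProduct.map_tprod, elemBasis, Basis.piTensorProduct_repr_tprod_apply]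
  have hterm : ∀ t,
      (Matrix.stdBasis k (Idx N N) (Idx N N)).repr (compress k N (elem k (a t))) (b t) =
      if a t = (idxSucc (b t).1, idxSucc (b t).2) then 1 else 0 := by
    intro t
    have h1 : ∀ X : Matrix (Idx N N) (Idx N N) k,
        (Matrix.stdBasis k (Idx N N) (Idx N N)).repr X (b t) = X (b t).1 (b t).2 := fun X => by
      rfl
    rw [h1]
    change elem k (a t) (idxSucc (b t).1) (idxSucc (b t).2) = _
    rw [elem, Matrix.stdBasis_eq_single, Matrix.single_apply]
    exact if_congr (Prod.ext_iff (y := (idxSucc (b t).1, idxSucc (b t).2))).symm rfl rfl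
  rw [Finset.prod_congr rfl fun t _ => hterm t, Finsupp.single_apply]
  split_ifs with h
  · exact Finset.prod_eq_one fun t _ => if_pos (congrFun h t)
  · obtain ⟨t, ht⟩ := Function.ne_iff.1 h
    exact Finset.prod_eq_zero (Finset.mem_univ t) (if_neg ht)

lemma repr_permTensor_single {p q n : ℕ} (σ : Equiv.Perm (Fin n)) (b : Fin n → Idx p q × Idx p q) :
    (elemBasis k p q n).repr (permTensor k p q n (MonoidAlgebra.single σ 1)) b =
      if ∀ t, (b t).1 = (b (σ.symm t)).2 then
        (sgn (letterExp σ 1 (Sum.elim (fun t => par (b t).2) fun t => par (b t).2)) : k)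
      else 0 := by
  rw [permTensor_single, map_sum, Finsupp.finsetSum_apply,
    Finset.sum_eq_single fun t => (b t).2]
  · rw [map_smul, Finsupp.smul_apply, Basis.repr_self, Finsupp.single_apply, smul_eq_mul]
    split_ifs with h h' h'
    · rw [mul_one]
    · exact absurd (fun t => (congrArg Prod.fst (congrFun h t)).symm) h'
    · exact (h (funext fun t => Prod.ext (h' t).symm rfl)).elim
    · rw [mul_zero]
  · intro α _ hα
    rw [map_smul, Finsupp.smul_apply, Basis.repr_self, Finsupp.single_apply, if_neg, smul_zero]
    rintro rfl
    exact hα rfl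
  · simp

/-- The compressions are compatible with the tensors of permutations. -/
lemma compressPow_permTensor {N n : ℕ} (x : MonoidAlgebra k (Equiv.Perm (Fin n))) :
    compressPow k N n (permTensor k (N + 1) (N + 1) n x) = permTensor k N N n x := by
  suffices h : compressPow k N n ∘ₗ permTensor k (N + 1) (N + 1) n = permTensor k N N n from
    LinearMap.congr_fun h x
  refine (MonoidAlgebra.basis _ k).ext fun σ => (elemBasis k N N n).ext_elem fun b => ?_
  rw [LinearMap.comp_apply, repr_compressPow, MonoidAlgebra.basis_apply, repr_permTensor_single,
    repr_permTensor_single]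
  simp only [par_idxSucc, idxSucc_injective.eq_iff]

theorem bijOn_permTensor [CharZero k] {n N : ℕ} (h : n ≤ N) :
    Set.BijOn (permTensor k N N n) Set.univ (glInvariants k N N n) :=
  ⟨fun x _ => permTensor_mem_glInvariants x, (permTensor_injective h).injOn, fun _ hx =>
    (exists_permTensor_eq h h hx).imp fun _ hy => ⟨Set.mem_univ _, hy⟩⟩

theorem bijOn_compressPow [CharZero k] {n N : ℕ} (h : n ≤ N) :
    Set.BijOn (compressPow k N n) (glInvariants k (N + 1) (N + 1) n) (glInvariants k N N n) := by
  have h' : n ≤ N + 1 := h.trans N.le_succ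
  refine ⟨fun x hx => ?_, fun x hx y hy hxy => ?_, fun x hx => ?_⟩
  · obtain ⟨x, rfl⟩ := exists_permTensor_eq h' h' hx
    rw [compressPow_permTensor]
    exact permTensor_mem_glInvariants x
  · obtain ⟨x, rfl⟩ := exists_permTensor_eq h' h' hx
    obtain ⟨y, rfl⟩ := exists_permTensor_eq h' h' hy
    rw [compressPow_permTensor, compressPow_permTensor] at hxy
    rw [permTensor_injective h hxy]
  · obtain ⟨x, rfl⟩ := exists_permTensor_eq h h hx
    exact ⟨_, permTensor_mem_glInvariants x, compressPow_permTensor x⟩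

variable (k) in
/-- The germ of the sequence `(μ_N(x))_N`. -/
def stableTensor (n : ℕ) : MonoidAlgebra k (Equiv.Perm (Fin n)) →ₗ[k]
    (germs fun N => endOperad k N N).V n :=
  germ (fun N => endOperad k N N) n ∘ₗ LinearMap.pi fun N => permTensor k N N n

lemma germ_eq_iff (P : ℕ → PreModularOperad k) {n : ℕ} (x y : ∀ N, (P N).V n) :
    germ P n x = germ P n y ↔ ∀ᶠ N in Filter.atTop, x N = y N := by
  rw [germ, Submodule.mkQ_apply, Submodule.mkQ_apply, Submodule.Quotient.eq]
  change (∀ᶠ N in Filter.atTop, x N - y N = 0) ↔ _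
  simp only [sub_eq_zero]

lemma stableTensor_act {m n : ℕ} (e : Fin m ≃ Fin n) (x : MonoidAlgebra k (Equiv.Perm (Fin m))) :
    stableTensor k n (permAct k e x) =
      (germs fun N => endOperad k N N).act e (stableTensor k m x) :=
  congrArg (germ (fun N => endOperad k N N) n) (funext fun _ => permTensor_act e x)

lemma stableTensor_contr {n : ℕ} (x : MonoidAlgebra k (Equiv.Perm (Fin (n + 2)))) :
    stableTensor k n (permContr k n x) =
      (germs fun N => endOperad k N N).contr n (stableTensor k (n + 2) x) :=
  congrArg (germ (fun N => endOperad k N N) n) (funext fun _ => permTensor_contr x)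

lemma stableTensor_comp {m n : ℕ} (x : MonoidAlgebra k (Equiv.Perm (Fin (m + 1))))
    (y : MonoidAlgebra k (Equiv.Perm (Fin (n + 1)))) :
    stableTensor k (m + n) ((permOperad k).comp m n x y) =
      (germs fun N => endOperad k N N).comp m n (stableTensor k (m + 1) x)
        (stableTensor k (n + 1) y) :=
  congrArg (germ (fun N => endOperad k N N) (m + n)) (funext fun _ => permTensor_comp x y)

lemma stableTensor_injective (n : ℕ) : Function.Injective (stableTensor k n) := by
  intro x y h
  have h' := (germ_eq_iff _ _ _).1 h
  obtain ⟨N, hN, hn⟩ := (h'.and (Filter.eventually_ge_atTop n)).exists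
  exact permTensor_injective hn hN

/-- In a stable sequence of invariants, one term `μ_N(y)` in the stable range determines all later
ones, since the compressions are injective on invariants. -/
lemma range_stableTensor [CharZero k] (n : ℕ) :
    LinearMap.range (stableTensor k n) = stableInvariants k n := by
  refine le_antisymm ?_ ?_
  · rintro _ ⟨x, rfl⟩
    exact ⟨fun N => permTensor k N N n x, Filter.Eventually.of_forall fun N =>
      ⟨permTensor_mem_glInvariants x, compressPow_permTensor x⟩, rfl⟩
  · rintro _ ⟨x, hx, rfl⟩
    have hx' : ∀ᶠ N in Filter.atTop,
      x N ∈ glInvariants k N N n ∧ compressPow k N n (x (N + 1)) = x N := hx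
    obtain ⟨M, hM⟩ := Filter.eventually_atTop.1 (hx'.and (Filter.eventually_ge_atTop n))
    obtain ⟨y, hy⟩ := exists_permTensor_eq (hM M le_rfl).2 (hM M le_rfl).2 (hM M le_rfl).1.1
    refine ⟨y, (germ_eq_iff _ _ _).2 (Filter.eventually_atTop.2 ⟨M, fun N hN => ?_⟩)⟩
    induction N, hN using Nat.le_induction with
    | base => exact hy
    | succ N hN ih =>
      refine (bijOn_compressPow (hM N hN).2).injOn (permTensor_mem_glInvariants y)
        (hM (N + 1) (hN.trans N.le_succ)).1.1 ?_
      rw [compressPow_permTensor, (hM N hN).1.2]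
      exact ih

variable (k) in
/-- The direct limit of the invariants. -/
def stableSuboperad [CharZero k] : (germs fun N => endOperad k N N).Suboperad where
  carrier n := stableInvariants k n
  act_mem {m n} e x hx := by
    rw [← range_stableTensor] at hx ⊢
    obtain ⟨x, rfl⟩ := hx
    exact ⟨_, stableTensor_act e x⟩
  contr_mem n x hx := by
    rw [← range_stableTensor] at hx ⊢
    obtain ⟨x, rfl⟩ := hx
    exact ⟨_, stableTensor_contr x⟩
  comp_mem m n x y hx hy := by
    rw [← range_stableTensor] at hx hy ⊢
    obtain ⟨x, rfl⟩ := hx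
    obtain ⟨y, rfl⟩ := hy
    exact ⟨_, stableTensor_comp x y⟩

variable (k) in
/-- The isomorphism of `k[S_n]` with the stable invariants. -/
def stableEquiv [CharZero k] (n : ℕ) :
    MonoidAlgebra k (Equiv.Perm (Fin n)) ≃ₗ[k] stableInvariants k n :=
  (LinearEquiv.ofInjective (stableTensor k n) (stableTensor_injective n)).trans
    (LinearEquiv.ofEq _ _ (range_stableTensor n))

lemma stableSuboperad_gr_zero [CharZero k] (n : ℕ) :
    (stableSuboperad k).toPre.gr n 0 = ⊤ := by
  refine eq_top_iff.2 fun x _ => ?_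
  obtain ⟨x, rfl⟩ := (stableEquiv k n).surjective x
  exact ⟨fun N => permTensor k N N n x,
    fun N _ => mem_endGr_zero_of_invariant (permTensor_mem_glInvariants x), rfl⟩

lemma stableSuboperad_gr_one [CharZero k] (n : ℕ) :
    (stableSuboperad k).toPre.gr n 1 = ⊥ := by
  refine eq_bot_iff.2 fun x hx => ?_
  obtain ⟨x, rfl⟩ := (stableEquiv k n).surjective x
  obtain ⟨z, hz, hzx⟩ := hx
  have h := (germ_eq_iff _ _ _).1 hzx
  obtain ⟨N, hN, hn⟩ := (h.and (Filter.eventually_ge_atTop n)).exists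
  have hN' : z N = permTensor k N N n x := hN
  have hz' : z N ∈ endGr k N N n 1 := hz N (Set.mem_univ N)
  rw [hN'] at hz'
  have h0 := eq_zero_of_invariant_of_odd (permTensor_mem_glInvariants x) hz'
  have hx0 : x = 0 := permTensor_injective hn (h0.trans (map_zero _).symm)
  rw [hx0, map_zero]
  exact Submodule.zero_mem _

variable (k) in
/-- The isomorphism of modular operads from `𝒮` to the stable invariants. -/
def stableIso [CharZero k] : Iso (permOperad k) (stableSuboperad k).toPre where
  equiv n := stableEquiv k n
  map_gr n i := by
    rcases zmod_two_cases i with rfl | rfl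
    · rw [stableSuboperad_gr_zero]
      exact (Submodule.map_top _).trans (LinearEquiv.range (stableEquiv k n))
    · rw [stableSuboperad_gr_one]
      exact Submodule.map_bot _
  map_act e x := Subtype.ext (stableTensor_act e x)
  map_contr n x := Subtype.ext (stableTensor_contr x)
  map_comp m n x y := Subtype.ext (stableTensor_comp x y)

end Stable

end MatrixModular

end

open MatrixModular PreModularOperad in
theorem mainTheorem10 (k : Type u) [Field k] [IsAlgClosed k] [CharZero k] :
    (permOperad k).IsModularOperad ∧
    (∀ N : ℕ, (endOperad k N N).IsModularOperad ∧
      ∃ G : (endOperad k N N).Suboperad,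
        (∀ n, G.carrier n = glInvariants k N N n) ∧ G.toPre.IsModularOperad) ∧
    (∀ n N : ℕ, n ≤ N →
      Set.BijOn (permTensor k N N n) Set.univ (glInvariants k N N n) ∧
      Set.BijOn (compressPow k N n) (glInvariants k (N + 1) (N + 1) n) (glInvariants k N N n)) ∧
    (∃ L : (germs fun N => endOperad k N N).Suboperad,
      (∀ n, L.carrier n = stableInvariants k n) ∧
      L.toPre.IsModularOperad ∧
      ∃ Φ : Iso (permOperad k) L.toPre,
        ∀ (n : ℕ) (x : MonoidAlgebra k (Equiv.Perm (Fin n))),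
          (L.carrier n).subtype (Φ.equiv n x) =
            germ (fun N => endOperad k N N) n (fun N => permTensor k N N n x)) ∧
    (∀ (n : ℕ) (σ : Equiv.Perm (Fin (n + 2))),
      (∀ p q : ℕ, (endOperad k p q).contr n
          (permTensor k p q (n + 2) (MonoidAlgebra.single σ 1)) =
        ((p : k) - (q : k)) ^ emptyCycles (splitPerm σ) •
          permTensor k p q n (MonoidAlgebra.single (glue (splitPerm σ)) 1)) ∧
      (σ 0 = 1 ∨ σ 1 = 0 → 0 < emptyCycles (splitPerm σ) ∧
        (permOperad k).contr n (MonoidAlgebra.single σ 1) = 0)) := by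
  refine ⟨permOperad_isModularOperad, fun N => ⟨endOperad_isModularOperad,
    invariantSuboperad k N N, fun _ => rfl, invariantSuboperad_isModularOperad⟩,
    fun n N h => ⟨bijOn_permTensor h, bijOn_compressPow h⟩,
    ⟨stableSuboperad k, fun _ => rfl, permOperad_isModularOperad.of_iso (stableIso k),
      stableIso k, fun _ _ => rfl⟩,
    fun n σ => ⟨fun p q => endContr_permTensor_single σ, fun h => ⟨emptyCycles_pos h, ?_⟩⟩⟩
  exact (permContr_single σ).trans (if_neg (emptyCycles_pos h).ne')
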